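/- Let $V$ be a finite set of bosonic modes with a metric $\mathrm{dist}$ (for instance a finite part of the $D$-dimensional lattice), let $\mathcal F=\ell^2(\mathbb N_0^V)$ be the multi-mode Fock space with Fock basis $\{|n\rangle\}_{n\in\mathbb N_0^V}$, let $a_j,a_j^\dagger$ be the annihilation and creation operators of mode $j$, $N_j=a_j^\dagger a_j$, let $\mathcal T_1$ be the trace-class operators on $\mathcal F$ with the trace norm, and let $\mathcal T_f=\mathrm{span}\{|n\rangle\langle m|\}\subset\mathcal T_1$. For $v\in V$, $\kappa>0$ and $k>0$ put $$\mathcal W_v^k(x)=\sum_{i\in V}\frac{e^{-\kappa\,\mathrm{dist}(v,i)}}{Z_v}(N_i+1)^{k/2}\,x\,(N_i+1)^{k/2},\qquad Z_v=\sum_{j\in V}e^{-\kappa\,\mathrm{dist}(v,j)},$$ let $W_v^{k,1}\subset\mathcal T_1$ be the domain of (the closure of) $\mathcal W_v^k$, and $\|x\|_{W_v^{k,1}}=\|\mathcal W_v^k(x)\|_1$ (with value $\infty$ if $x\in\mathcal T_1\setminus W_v^{k,1}$). Let $\ell\ge 2$ be an integer, $k\ge 1$ real, $\alpha\in\mathbb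 C^V$, and let $H=\sum_{j\in V}H_{jj}$ be a purely on-site Hamiltonian $$H_{jj}=\sum_{u\in\mathbb N_0^4,\ |u|_1\le d_H}\lambda_j^{(u)}\,a_j^{u_1}a_j^{u_3}(a_j^\dagger)^{u_2}(a_j^\dagger)^{u_4}+\overline{\lambda_j^{(u)}}\,a_j^{u_4}a_j^{u_2}(a_j^\dagger)^{u_3}(a_j^\dagger)^{u_1},\qquad d_H\le 2(\ell-1).$$ On $\mathcal T_f$ let $\mathcal L_\ell=\sum_{j\in V}\mathcal L[a_j^\ell-\alpha_j^\ell]$, where $\mathcal L[L](\rho)=L\rho L^\dagger-\tfrac12\{L^\dagger L,\rho\}$. Put $|\alpha|=\max_j|\alpha_j|$, $\Lambda=\max_j\sum_{|u|_1\le d_H}|\lambda_j^{(u)}|$, $\nu=\ell+k-1$, $$c=(\ell+1)\ell+4|\alpha|^\ell k\,\ell^{k-1}\sqrt{\ell!}+\Lambda(2\ell)^k\sqrt{(2\ell)!},\qquad \mu_k^{(\ell)}=c^\nu\,\frac{(\nu-1)^{\nu-1}}{\nu^\nu}.$$ Then for every state $\rho\in\mathcal T_f$ $$\mathrm{tr}\big[\mathcal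 W_v^k\big((-i[H,\cdot]+\mathcal L_\ell)(\rho)\big)\big]\le-\frac{\ell}{2}\,\mathrm{tr}\big[\mathcal W_v^{k+\ell-1}(\rho)\big]+\frac{\ell}{2}\,\mu_k^{(\ell)}.$$ Moreover, the closure of $(-i[H,\cdot]+\mathcal L_\ell,\ \mathcal T_f)$ is the generator of a quantum Markov semigroup $(T_t)_{t\ge0}$ on $\mathcal T_1$ (a strongly continuous semigroup of completely positive, trace-preserving maps). This semigroup maps $W_v^{k,1}$ into itself; there are constants $C,\omega>0$ with $\|T_t(x)\|_{W_v^{k,1}}\le Ce^{\omega t}\|x\|_{W_v^{k,1}}$ for all $t\ge0$ and all positive $x\in\mathcal T_1$; and it is $(k,v)$-Sobolev-regularizing with a bound that does not depend on the system size: for all $t>0$ $$\|T_t\|_{1\to W_v^{k,1}}\le\Big(\frac{2k}{(\ell-1)\,\ell\,t}\Big)^{\frac{k}{\ell-1}}+\big(\mu_k^{(\ell)}\big)^{\frac{k}{k+\ell-1}},$$ that is, $\|T_t(x)\|_{W_v^{k,1}}$ is at most the right-hand side times $\|x\|_1$ for every $x\in\mathcal T_1$. -/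

import Mathlib

open scoped NNReal ENNReal Topology ComplexOrder

noncomputable section

namespace BosonicQMS

/-! ### Trace-class operators on a complex Hilbert space -/

section TraceClass

variable {E : Type*} [NormedAddCommGroup E] [InnerProductSpace ℂ E]

/-- The trace norm `‖X‖₁ = tr √(X* X)`, in the form of the supremum of `∑ i, |⟨e i, X (f i)⟩|` over
all finite orthonormal families `e` and `f`. It is `⊤` exactly if `X` is not of trace class. -/
def traceNorm (X : E →L[ℂ] E) : ℝ≥0∞ :=
  ⨆ (N : ℕ) (e : Fin N → E) (f : Fin N → E) (_ : Orthonormal ℂ e) (_ : Orthonormal ℂ f),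
    ∑ i, ‖inner ℂ (e i) (X (f i))‖ₑ

theorem sum_le_traceNorm (X : E →L[ℂ] E) {N : ℕ} {e f : Fin N → E} (he : Orthonormal ℂ e)
    (hf : Orthonormal ℂ f) : ∑ i, ‖inner ℂ (e i) (X (f i))‖ₑ ≤ traceNorm X :=
  le_iSup_of_le N <| le_iSup_of_le e <| le_iSup_of_le f <| le_iSup_of_le he <|
    le_iSup_of_le hf le_rfl

theorem traceNorm_le {X : E →L[ℂ] E} {c : ℝ≥0∞}
    (h : ∀ (N : ℕ) (e f : Fin N → E), Orthonormal ℂ e → Orthonormal ℂ f →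
      ∑ i, ‖inner ℂ (e i) (X (f i))‖ₑ ≤ c) : traceNorm X ≤ c :=
  iSup_le fun N => iSup_le fun e => iSup_le fun f => iSup_le fun he => iSup_le fun hf =>
    h N e f he hf

theorem traceNorm_add_le (X Y : E →L[ℂ] E) : traceNorm (X + Y) ≤ traceNorm X + traceNorm Y := by
  refine traceNorm_le fun N e f he hf => ?_
  calc ∑ i, ‖inner ℂ (e i) ((X + Y) (f i))‖ₑ
      ≤ ∑ i, (‖inner ℂ (e i) (X (f i))‖ₑ + ‖inner ℂ (e i) (Y (f i))‖ₑ) := by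
        refine Finset.sum_le_sum fun i _ => ?_
        rw [add_apply, inner_add_right]
        exact enorm_add_le _ _
    _ ≤ _ := by
        rw [Finset.sum_add_distrib]
        exact add_le_add (sum_le_traceNorm X he hf) (sum_le_traceNorm Y he hf)

theorem traceNorm_smul (c : ℂ) (X : E →L[ℂ] E) : traceNorm (c • X) = ‖c‖ₑ * traceNorm X := by
  have h : ∀ (N : ℕ) (e f : Fin N → E), ∑ i, ‖inner ℂ (e i) ((c • X) (f i))‖ₑ
      = ‖c‖ₑ * ∑ i, ‖inner ℂ (e i) (X (f i))‖ₑ := by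
    intro N e f
    rw [Finset.mul_sum]
    refine Finset.sum_congr rfl fun i _ => ?_
    rw [smul_apply, inner_smul_right, enorm_mul]
  simp only [traceNorm, h, ENNReal.mul_iSup]

theorem traceNorm_eq_zero {X : E →L[ℂ] E} (h : traceNorm X = 0) : X = 0 := by
  have key : ∀ e f : E, ‖e‖ = 1 → ‖f‖ = 1 → inner ℂ e (X f) = 0 := by
    intro e f he hf
    have ho : ∀ x : E, ‖x‖ = 1 → Orthonormal ℂ (fun _ : Fin 1 => x) := by
      intro x hx
      exact ⟨fun _ => hx, fun i j hij => absurd (Subsingleton.elim i j) hij⟩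
    have := sum_le_traceNorm X (ho e he) (ho f hf)
    rw [h] at this
    simpa using this
  ext f
  by_contra hX
  have hf0 : f ≠ 0 := by
    rintro rfl
    simp at hX
  have hX' : X f ≠ 0 := by simpa using hX
  have h1 := key ((‖X f‖⁻¹ : ℂ) • X f) ((‖f‖⁻¹ : ℂ) • f)
    (by simp [norm_smul, hX']) (by simp [norm_smul, hf0])
  simp [hX', hf0] at h1

/-- The trace-class operators, as a subspace of the bounded operators. -/
def traceClassSubmodule (E : Type*) [NormedAddCommGroup E] [InnerProductSpace ℂ E] :
    Submodule ℂ (E →L[ℂ] E) where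
  carrier := {X | traceNorm X < ⊤}
  zero_mem' := by
    have : traceNorm (0 : E →L[ℂ] E) = 0 := by
      simpa using traceNorm_smul (0 : ℂ) (0 : E →L[ℂ] E)
    simp [this]
  add_mem' := fun {X Y} hX hY =>
    lt_of_le_of_lt (traceNorm_add_le X Y) (ENNReal.add_lt_top.2 ⟨hX, hY⟩)
  smul_mem' := fun c X hX => by
    simp only [Set.mem_ofPred_eq] at hX ⊢
    rw [traceNorm_smul]
    exact ENNReal.mul_lt_top enorm_lt_top hX

/-- The space `𝒯₁` of trace-class operators on `E`; it carries the trace norm. -/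
def TraceClass (E : Type*) [NormedAddCommGroup E] [InnerProductSpace ℂ E] : Type _ :=
  traceClassSubmodule E

namespace TraceClass

instance : AddCommGroup (TraceClass E) := inferInstanceAs (AddCommGroup (traceClassSubmodule E))

instance : Module ℂ (TraceClass E) := inferInstanceAs (Module ℂ (traceClassSubmodule E))

/-- The bounded operator underlying a trace-class operator, as a linear map. -/
def toCLM : TraceClass E →ₗ[ℂ] (E →L[ℂ] E) := (traceClassSubmodule E).subtype

theorem traceNorm_lt_top (X : TraceClass E) : traceNorm (toCLM X) < ⊤ := X.2

instance : Norm (TraceClass E) := ⟨fun X => (traceNorm (toCLM X)).toReal⟩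

theorem norm_def (X : TraceClass E) : ‖X‖ = (traceNorm (toCLM X)).toReal := rfl

theorem core : NormedSpace.Core ℂ (TraceClass E) where
  norm_nonneg X := ENNReal.toReal_nonneg
  norm_smul c X := by
    rw [norm_def, norm_def, map_smul, traceNorm_smul, ENNReal.toReal_mul, toReal_enorm]
  norm_triangle X Y := by
    rw [norm_def, norm_def, norm_def, map_add,
      ← ENNReal.toReal_add (traceNorm_lt_top X).ne (traceNorm_lt_top Y).ne]
    exact ENNReal.toReal_mono
      (ENNReal.add_lt_top.2 ⟨traceNorm_lt_top X, traceNorm_lt_top Y⟩).ne (traceNorm_add_le _ _)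
  norm_eq_zero_iff X := by
    constructor
    · intro h
      have h0 : toCLM X = 0 := by
        rw [norm_def, ENNReal.toReal_eq_zero_iff] at h
        exact traceNorm_eq_zero (h.resolve_right (traceNorm_lt_top X).ne)
      exact Subtype.ext h0
    · rintro rfl
      have := traceNorm_smul (0 : ℂ) (0 : E →L[ℂ] E)
      simp only [smul_zero, enorm_zero, zero_mul] at this
      rw [norm_def, map_zero, this, ENNReal.toReal_zero]

instance : NormedAddCommGroup (TraceClass E) := NormedAddCommGroup.ofCore core

instance : NormedSpace ℂ (TraceClass E) := NormedSpace.ofCore core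

end TraceClass

theorem traceNorm_rankOne_lt_top (x y : E) :
    traceNorm (InnerProductSpace.rankOne ℂ x y) < ⊤ := by
  refine lt_of_le_of_lt (traceNorm_le (c := ENNReal.ofReal (‖x‖ * ‖y‖)) ?_) ENNReal.ofReal_lt_top
  intro N e f he hf
  have h1 : ∀ i, ‖inner ℂ (e i) (InnerProductSpace.rankOne ℂ x y (f i))‖ₑ
      = ENNReal.ofReal (‖inner ℂ (e i) x‖ * ‖inner ℂ (f i) y‖) := by
    intro i
    rw [InnerProductSpace.rankOne_apply, inner_smul_right, ← ofReal_norm, norm_mul, mul_comm,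
      norm_inner_symm y (f i)]
  simp only [h1]
  rw [← ENNReal.ofReal_sum_of_nonneg fun i _ => by positivity]
  refine ENNReal.ofReal_le_ofReal ?_
  refine (Real.sum_mul_le_sqrt_mul_sqrt _ _ _).trans ?_
  refine mul_le_mul ?_ ?_ (Real.sqrt_nonneg _) (norm_nonneg _)
  · exact Real.sqrt_le_iff.2 ⟨norm_nonneg _, he.sum_inner_products_le x⟩
  · exact Real.sqrt_le_iff.2 ⟨norm_nonneg _, hf.sum_inner_products_le y⟩

/-- The rank-one operator `|x⟩⟨y|` as a trace-class operator. -/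
def ketbra (x y : E) : TraceClass E :=
  ⟨InnerProductSpace.rankOne ℂ x y, traceNorm_rankOne_lt_top x y⟩

end TraceClass

/-! ### The multi-mode Fock space, with one mode for each element of `V` -/

section Fock

/-- The Fock space of the modes `V`: square-summable families over the occupation numbers
`V → ℕ`. -/
abbrev Fock (V : Type*) : Type _ := lp (fun _ : V → ℕ => ℂ) 2

variable {V : Type*} [Fintype V] [DecidableEq V]

/-- The Fock basis vector `|n⟩`. -/
def ket (n : V → ℕ) : Fock V := lp.single 2 n (1 : ℂ)

/-- The trace of a trace-class operator. -/
def trace (X : TraceClass (Fock V)) : ℂ :=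
  ∑' n : V → ℕ, inner ℂ (ket n) (TraceClass.toCLM X (ket n))

/-- Finite linear combinations of Fock basis vectors. -/
abbrev FinVec (V : Type*) : Type _ := (V → ℕ) →₀ ℂ

/-- The space `𝒯_f` of finite linear combinations of the operators `|n⟩⟨m|`; the coefficient of
`|n⟩⟨m|` in `x` is `x (n, m)`. -/
abbrev FinOp (V : Type*) : Type _ := ((V → ℕ) × (V → ℕ)) →₀ ℂ

/-- The inclusion of `𝒯_f` into `𝒯₁`. -/
def FinOp.toTraceClass : FinOp V →ₗ[ℂ] TraceClass (Fock V) :=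
  Finsupp.linearCombination ℂ fun p : (V → ℕ) × (V → ℕ) => ketbra (ket p.1) (ket p.2)

/-- A state (density operator). -/
def IsState (X : TraceClass (Fock V)) : Prop :=
  (TraceClass.toCLM X).IsPositive ∧ trace X = 1

/-- The annihilation operator of the mode `j`: `a_j |n⟩ = √(n_j) |n - δ_j⟩`. -/
def ann (j : V) : Module.End ℂ (FinVec V) :=
  Finsupp.linearCombination ℂ fun n : V → ℕ =>
    Finsupp.single (Function.update n j (n j - 1)) ((√(n j : ℝ) : ℝ) : ℂ)

/-- The creation operator of the mode `j`: `a_j† |n⟩ = √(n_j + 1) |n + δ_j⟩`. -/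
def cre (j : V) : Module.End ℂ (FinVec V) :=
  Finsupp.linearCombination ℂ fun n : V → ℕ =>
    Finsupp.single (Function.update n j (n j + 1)) ((√((n j : ℝ) + 1) : ℝ) : ℂ)

/-- The operator `|φ⟩⟨ψ|` for finite vectors `φ` and `ψ`. -/
def dyad (φ ψ : FinVec V) : FinOp V :=
  φ.sum fun n c => ψ.sum fun m d => Finsupp.single (n, m) (c * starRingEnd ℂ d)

/-- The map `x ↦ A x B†` on `𝒯_f`, that is, `|n⟩⟨m| ↦ |A n⟩⟨B m|`. -/
def sandwich (A B : Module.End ℂ (FinVec V)) : Module.End ℂ (FinOp V) :=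
  Finsupp.linearCombination ℂ fun p : (V → ℕ) × (V → ℕ) =>
    dyad (A (Finsupp.single p.1 1)) (B (Finsupp.single p.2 1))

/-- The map `x ↦ -i [H, x]` on `𝒯_f`, for `H` symmetric on the finite vectors. -/
def hamiltonianPart (H : Module.End ℂ (FinVec V)) : Module.End ℂ (FinOp V) :=
  (-Complex.I) • (sandwich H 1 - sandwich 1 H)

/-- The dissipator `x ↦ L x L† - (L† L x + x L† L) / 2` on `𝒯_f`, where `Ld` is the formal
adjoint `L†` of `L`. -/
def dissipator (L Ld : Module.End ℂ (FinVec V)) : Module.End ℂ (FinOp V) :=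
  sandwich L L - (1 / 2 : ℂ) • (sandwich (Ld * L) 1 + sandwich 1 (Ld * L))

/-- The shifted `ℓ`-photon dissipation `∑ j, 𝓛[a_j ^ ℓ - α_j ^ ℓ]`. -/
def photonDissipation (ℓ : ℕ) (α : V → ℂ) : Module.End ℂ (FinOp V) :=
  ∑ j, dissipator (ann j ^ ℓ - (α j ^ ℓ) • 1) (cre j ^ ℓ - (starRingEnd ℂ (α j) ^ ℓ) • 1)

/-- The exponents `u ∈ ℕ⁴` with `u 0 + u 1 + u 2 + u 3 ≤ d`. -/
def exponents (d : ℕ) : Finset (Fin 4 → ℕ) :=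
  (Fintype.piFinset fun _ => Finset.range (d + 1)).filter fun u => ∑ r, u r ≤ d

/-- The two-body term
`∑ u, (c u • a_i ^ u₁ a_j ^ u₃ a_i† ^ u₂ a_j† ^ u₄ + h.c.)`, `|u| ≤ d`, of a Hamiltonian; the
components `u₁, u₂, u₃, u₄` are `u 0, u 1, u 2, u 3`. -/
def twoBodyTerm (d : ℕ) (c : (Fin 4 → ℕ) → ℂ) (i j : V) : Module.End ℂ (FinVec V) :=
  ∑ u ∈ exponents d,
    (c u • (ann i ^ u 0 * ann j ^ u 2 * cre i ^ u 1 * cre j ^ u 3) +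
      starRingEnd ℂ (c u) • (ann j ^ u 3 * ann i ^ u 1 * cre j ^ u 2 * cre i ^ u 0))

/-- The purely on-site Hamiltonian `H = ∑ j, H_jj` of degree at most `d`. -/
def onSiteHamiltonian (d : ℕ) (lam : V → (Fin 4 → ℕ) → ℂ) : Module.End ℂ (FinVec V) :=
  ∑ j, twoBodyTerm d (lam j) j j

/-- The operator `-i [H, ·] + 𝓛_ℓ` with domain `𝒯_f`. -/
def lindbladian (ℓ d : ℕ) (α : V → ℂ) (lam : V → (Fin 4 → ℕ) → ℂ) : Module.End ℂ (FinOp V) :=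
  hamiltonianPart (onSiteHamiltonian d lam) + photonDissipation ℓ α

/-- The size `Λ` of an on-site Hamiltonian: the largest `ℓ¹`-norm, over all modes, of the
coefficients at one mode. -/
def hamiltonianSize (d : ℕ) (lam : V → (Fin 4 → ℕ) → ℂ) : ℝ :=
  ⨆ j, ∑ u ∈ exponents d, ‖lam j u‖

end Fock

/-! ### The concentrated Sobolev norm -/

section Sobolev

variable {V : Type*} [Fintype V] [DecidableEq V] [MetricSpace V]

/-- The weight `exp (-κ dist (v, i)) / Z_v`. -/
def siteWeight (κ : ℝ) (v i : V) : ℝ :=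
  Real.exp (-κ * dist v i) / ∑ j, Real.exp (-κ * dist v j)

/-- The factor by which
`𝒲_v^k (x) = ∑ i, (exp (-κ dist (v, i)) / Z_v) (N_i + 1) ^ (k / 2) x (N_i + 1) ^ (k / 2)`
multiplies the matrix element `⟨n| x |m⟩`. -/
def sobolevSymbol (κ k : ℝ) (v : V) (n m : V → ℕ) : ℝ :=
  ∑ i, siteWeight κ v i * (((n i : ℝ) + 1) ^ (k / 2) * ((m i : ℝ) + 1) ^ (k / 2))

/-- The operator `𝒲_v^k` on `𝒯_f`. -/
def sobolevOp (κ k : ℝ) (v : V) : Module.End ℂ (FinOp V) :=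
  Finsupp.linearCombination ℂ fun p : (V → ℕ) × (V → ℕ) =>
    Finsupp.single p ((sobolevSymbol κ k v p.1 p.2 : ℝ) : ℂ)

/-- `X` lies in the domain `W_v^{k,1}` of (the closure of) `𝒲_v^k`, and `𝒲_v^k X = Y`. -/
def IsSobolevImage (κ k : ℝ) (v : V) (X Y : TraceClass (Fock V)) : Prop :=
  ∀ n m : V → ℕ, inner ℂ (ket n) (TraceClass.toCLM Y (ket m)) =
    ((sobolevSymbol κ k v n m : ℝ) : ℂ) * inner ℂ (ket n) (TraceClass.toCLM X (ket m))

/-- The norm `‖X‖_{W_v^{k,1}} = ‖𝒲_v^k X‖₁`, with the value `⊤` if `X` is not in `W_v^{k,1}`. -/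
def sobolevNorm (κ k : ℝ) (v : V) (X : TraceClass (Fock V)) : ℝ≥0∞ :=
  ⨅ (Y : TraceClass (Fock V)) (_ : IsSobolevImage κ k v X Y), ‖Y‖ₑ

end Sobolev

/-! ### Quantum Markov semigroups -/

section Semigroup

variable {V : Type*} [Fintype V] [DecidableEq V]

/-- Positivity of the operator with the blocks `X i j` on the `N`-fold direct sum of the Fock
space, that is, on its tensor product with `ℂᴺ`. -/
def IsPositiveBlock {N : ℕ} (X : Fin N → Fin N → TraceClass (Fock V)) : Prop :=
  ∀ ψ : Fin N → Fock V, 0 ≤ ∑ i, ∑ j, inner ℂ (ψ i) (TraceClass.toCLM (X i j) (ψ j))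

/-- Complete positivity. -/
def IsCompletelyPositive (Φ : TraceClass (Fock V) →L[ℂ] TraceClass (Fock V)) : Prop :=
  ∀ (N : ℕ) (X : Fin N → Fin N → TraceClass (Fock V)),
    IsPositiveBlock X → IsPositiveBlock fun i j => Φ (X i j)

/-- Quantum Markov semigroups: strongly continuous semigroups of completely positive,
trace-preserving maps on `𝒯₁`. -/
structure IsQMS (T : ℝ≥0 → TraceClass (Fock V) →L[ℂ] TraceClass (Fock V)) : Prop where
  zero : T 0 = ContinuousLinearMap.id ℂ (TraceClass (Fock V))
  add : ∀ s t : ℝ≥0, T (s + t) = (T s).comp (T t)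
  continuous_zero : ∀ X, Filter.Tendsto (fun t => T t X) (𝓝[>] 0) (𝓝 X)
  completelyPositive : ∀ t, IsCompletelyPositive (T t)
  trace_preserving : ∀ t X, trace (T t X) = trace X

/-- The graph of the generator of `T`. -/
def generatorGraph (T : ℝ≥0 → TraceClass (Fock V) →L[ℂ] TraceClass (Fock V)) :
    Set (TraceClass (Fock V) × TraceClass (Fock V)) :=
  {p | Filter.Tendsto (fun t : ℝ≥0 => ((t : ℝ) : ℂ)⁻¹ • (T t p.1 - p.1)) (𝓝[>] 0) (𝓝 p.2)}

/-- `T` is generated by `L`: its generator is the closure of `L` on the domain `𝒯_f`. -/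
def IsGeneratedBy (T : ℝ≥0 → TraceClass (Fock V) →L[ℂ] TraceClass (Fock V))
    (L : Module.End ℂ (FinOp V)) : Prop :=
  generatorGraph T = closure (Set.range fun x : FinOp V => (x.toTraceClass, (L x).toTraceClass))

end Semigroup

/-! ### Constants -/

/-- The constant `c = (ℓ + 1) ℓ + 4 A ^ ℓ k ℓ ^ (k - 1) √(ℓ!) + Λ (2 ℓ) ^ k √((2 ℓ)!)`. -/
def cConst (ℓ : ℕ) (k A Lam : ℝ) : ℝ :=
  ((ℓ : ℝ) + 1) * ℓ + 4 * A ^ ℓ * k * (ℓ : ℝ) ^ (k - 1) * √(ℓ.factorial : ℝ) +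
    Lam * (2 * (ℓ : ℝ)) ^ k * √((2 * ℓ).factorial : ℝ)

/-- The constant `μ = c ^ ν (ν - 1) ^ (ν - 1) / ν ^ ν` with `ν = ℓ + k - 1`. -/
def muConst (ℓ : ℕ) (k A Lam : ℝ) : ℝ :=
  cConst ℓ k A Lam ^ ((ℓ : ℝ) + k - 1) *
    (((ℓ : ℝ) + k - 1 - 1) ^ ((ℓ : ℝ) + k - 1 - 1) / ((ℓ : ℝ) + k - 1) ^ ((ℓ : ℝ) + k - 1))

end BosonicQMS

end

noncomputable section

namespace BosonicQMS

/-! ### The trace norm -/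

section TraceNorm

variable {E : Type*} [NormedAddCommGroup E] [InnerProductSpace ℂ E]

/-! The core is a Lyapunov inequality for one mode. Write the generator as `K x + x K† + ∑ L_j x
L_j†` with `L_j = a_j^ℓ - α_j^ℓ` and `K = -iH - ½ ∑ L_j† L_j`, and test it with `(N_i + 1)^k`.
Everything is on-site, so only mode `i` contributes. The loss of `ℓ` photons gives a diagonal term
of leading order `-ℓ X^ν` with `X = N_i + 1` and `ν = ℓ + k - 1`. The shift `α` and the Hamiltonian
enter only through commutators with `(N_i + 1)^k`; as the degree is at most `2(ℓ - 1)`, they have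
order at most `X^(ν-1)`. With the correction to the leading term they add up to at most `(ℓ/2) c
X^(ν-1)`. Half of the leading term absorbs this through `c X^(ν-1) - X^ν ≤ μ` (`young_le`), which
gives `mom_lindbladian_le`; averaging with the site weights, which sum to `1`, keeps the constants
independent of the system size.

The semigroup is built by compressing `K` and the `L_j` to the occupation numbers at most `M` in
each mode. The `L_j` never raise an occupation number, so they are not cut at all. Hence each
truncated generator is bounded, generates a completely positive and exactly trace-preserving
semigroup (`isCompletelyPositive_expSemigroup`, `compress_trace_condition`), and satisfies the same
Lyapunov inequality on the box without error terms (`tmom_truncGen`). The generators at levels `M ≤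
N` differ, on the box of `M`, only within a fixed distance of its boundary and by a polynomial in
`M`. A sufficiently high moment, bounded uniformly in `M` on compact time intervals, outweighs this
polynomial (`exists_norm_truncGen_sub_ketbra_le`). Duhamel's formula then makes the truncated
semigroups a Cauchy sequence on the dense space `𝒯_f`, hence strongly convergent on `𝒯₁` by
contractivity.

The limit inherits the semigroup law, complete positivity and preservation of the trace, and its
generator extends the closure of the operator on `𝒯_f`. Equality follows as for Lumer-Phillips: the
generator is dissipative, and the range of `1 - 𝓛` on `𝒯_f` is dense
(`exists_norm_sub_lindbladian_sub_le`), because `∫₀^τ e^(-s) T_s^M y ds` is an approximate resolvent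
lying in `𝒯_f`.

For the regularization, Hölder's inequality turns the Lyapunov inequality into `u' ≤ -(ℓ/2) u^(ν/k)
+ (ℓ/2) μ` for the `k`-th moment `u` of a state. Solutions come down from infinity at a rate
independent of `u 0` (`le_of_deriv_le_rpow`). Complete positivity extends the bound from pure states
to all trace-class operators (`IsCompletelyPositive.norm_apply_le`), and a weak limit in `M`
transfers it to the semigroup itself (`exists_of_tendsto_entry`). -/

theorem sum_enorm_inner_eq (X : E →L[ℂ] E) {N : ℕ} (e f : Fin N → E) :
    ∑ i, ‖inner ℂ (e i) (X (f i))‖ₑ = ENNReal.ofReal (∑ i, ‖inner ℂ (e i) (X (f i))‖) := by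
  rw [ENNReal.ofReal_sum_of_nonneg fun i _ => norm_nonneg _]
  simp

theorem traceNorm_le_ofReal {X : E →L[ℂ] E} {c : ℝ}
    (h : ∀ (N : ℕ) (e f : Fin N → E), Orthonormal ℂ e → Orthonormal ℂ f →
      ∑ i, ‖inner ℂ (e i) (X (f i))‖ ≤ c) : traceNorm X ≤ ENNReal.ofReal c :=
  traceNorm_le fun N e f he hf => by
    rw [sum_enorm_inner_eq]
    exact ENNReal.ofReal_le_ofReal (h N e f he hf)

namespace TraceClass

theorem toCLM_injective : Function.Injective (toCLM : TraceClass E →ₗ[ℂ] (E →L[ℂ] E)) :=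
  Subtype.val_injective

theorem sum_norm_inner_le (X : TraceClass E) {N : ℕ} {e f : Fin N → E} (he : Orthonormal ℂ e)
    (hf : Orthonormal ℂ f) : ∑ i, ‖inner ℂ (e i) (toCLM X (f i))‖ ≤ ‖X‖ := by
  have h := sum_le_traceNorm (toCLM X) he hf
  rw [sum_enorm_inner_eq] at h
  exact (ENNReal.ofReal_le_iff_le_toReal (traceNorm_lt_top X).ne).1 h

theorem norm_le {X : TraceClass E} {c : ℝ} (hc : 0 ≤ c)
    (h : ∀ (N : ℕ) (e f : Fin N → E), Orthonormal ℂ e → Orthonormal ℂ f →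
      ∑ i, ‖inner ℂ (e i) (toCLM X (f i))‖ ≤ c) : ‖X‖ ≤ c :=
  ENNReal.toReal_le_of_le_ofReal hc (traceNorm_le_ofReal h)

/-- A bounded operator with bounded sums `∑ i, |⟨e i, X (f i)⟩|` as a trace-class operator. -/
def ofBound (X : E →L[ℂ] E) (c : ℝ)
    (h : ∀ (N : ℕ) (e f : Fin N → E), Orthonormal ℂ e → Orthonormal ℂ f →
      ∑ i, ‖inner ℂ (e i) (X (f i))‖ ≤ c) : TraceClass E :=
  ⟨X, lt_of_le_of_lt (traceNorm_le_ofReal h) ENNReal.ofReal_lt_top⟩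

@[simp] theorem toCLM_ofBound (X : E →L[ℂ] E) (c : ℝ) (h) : toCLM (ofBound X c h) = X := rfl

theorem orthonormal_const {x : E} (hx : ‖x‖ = 1) : Orthonormal ℂ (fun _ : Fin 1 => x) :=
  ⟨fun _ => hx, fun i j hij => absurd (Subsingleton.elim i j) hij⟩

theorem norm_inner_toCLM_le (X : TraceClass E) (x y : E) :
    ‖inner ℂ x (toCLM X y)‖ ≤ ‖X‖ * ‖x‖ * ‖y‖ := by
  rcases eq_or_ne x 0 with rfl | hx
  · simp
  rcases eq_or_ne y 0 with rfl | hy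
  · simp
  have h := sum_norm_inner_le X
    (orthonormal_const (x := ((‖x‖⁻¹ : ℝ) : ℂ) • x) (by simp [norm_smul, hx]))
    (orthonormal_const (x := ((‖y‖⁻¹ : ℝ) : ℂ) • y) (by simp [norm_smul, hy]))
  simp only [map_smul, inner_smul_left, inner_smul_right, Finset.univ_unique, Finset.sum_const,
    Finset.card_singleton, one_smul, norm_mul, Complex.conj_ofReal, Complex.norm_real, norm_inv,
    norm_norm] at h
  have hx' := norm_pos_iff.2 hx
  have hy' := norm_pos_iff.2 hy
  calc ‖inner ℂ x (toCLM X y)‖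
      = (‖y‖⁻¹ * (‖x‖⁻¹ * ‖inner ℂ x (toCLM X y)‖)) * ‖x‖ * ‖y‖ := by field_simp
    _ ≤ _ := by gcongr

theorem opNorm_toCLM_le (X : TraceClass E) : ‖toCLM X‖ ≤ ‖X‖ := by
  refine ContinuousLinearMap.opNorm_le_bound _ (norm_nonneg _) fun y => ?_
  rcases eq_or_ne (toCLM X y) 0 with h0 | h0
  · rw [h0, norm_zero]; positivity
  have h := norm_inner_toCLM_le X (toCLM X y) y
  rw [inner_self_eq_norm_sq_to_K, norm_pow, RCLike.norm_ofReal, abs_norm] at h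
  have := norm_pos_iff.2 h0
  nlinarith

/-- The inclusion of `𝒯₁` into the bounded operators, as a continuous linear map. -/
def toCLMₗ (E : Type*) [NormedAddCommGroup E] [InnerProductSpace ℂ E] :
    TraceClass E →L[ℂ] (E →L[ℂ] E) :=
  LinearMap.mkContinuous toCLM 1 fun X => by simpa using opNorm_toCLM_le X

@[simp] theorem toCLMₗ_apply (X : TraceClass E) : toCLMₗ E X = toCLM X := rfl

/-- Weak lower semicontinuity of the trace norm: each finite sum in the supremum defining it passes
to the limit. -/
theorem exists_of_tendsto_inner {ι : Type*} {l : Filter ι} [l.NeBot] {Y : ι → TraceClass E}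
    {c : ℝ} (hY : ∀ i, ‖Y i‖ ≤ c) {Z : E →L[ℂ] E}
    (h : ∀ x y : E, Filter.Tendsto (fun i => inner ℂ x (toCLM (Y i) y)) l (𝓝 (inner ℂ x (Z y)))) :
    ∃ X : TraceClass E, toCLM X = Z ∧ ‖X‖ ≤ c := by
  obtain ⟨i₀⟩ : Nonempty ι := l.nonempty_of_neBot
  have hc : 0 ≤ c := (norm_nonneg _).trans (hY i₀)
  have key : ∀ (N : ℕ) (e f : Fin N → E), Orthonormal ℂ e → Orthonormal ℂ f →
      ∑ i, ‖inner ℂ (e i) (Z (f i))‖ ≤ c := by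
    intro N e f he hf
    refine le_of_tendsto (tendsto_finsetSum _ fun j _ => (h (e j) (f j)).norm)
      (Filter.Eventually.of_forall fun i => (sum_norm_inner_le (Y i) he hf).trans (hY i))
  exact ⟨ofBound Z c key, rfl, norm_le hc key⟩

/-- A Cauchy sequence converges in operator norm to some `Z`. Each `Z - u n` is the weak limit of `u
i - u n`, so lower semicontinuity shows that it is of trace class with small trace norm. -/
instance [CompleteSpace E] : CompleteSpace (TraceClass E) := by
  refine Metric.complete_of_cauchySeq_tendsto fun u hu => ?_
  obtain ⟨Z, hZ⟩ := cauchySeq_tendsto_of_complete ((toCLMₗ E).uniformContinuous.comp_cauchySeq hu)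
  have hin : ∀ x y : E,
      Filter.Tendsto (fun i => inner ℂ x (toCLM (u i) y)) Filter.atTop (𝓝 (inner ℂ x (Z y))) := by
    intro x y
    have h1 : Filter.Tendsto (fun i => toCLM (u i) y) Filter.atTop (𝓝 (Z y)) :=
      ((ContinuousLinearMap.apply ℂ E y).continuous.tendsto Z).comp hZ
    exact tendsto_const_nhds.inner h1
  have hdiff : ∀ ε > 0, ∃ N, ∀ n ≥ N, ∃ X : TraceClass E, toCLM X = Z - toCLM (u n) ∧ ‖X‖ ≤ ε := by
    intro ε hε
    obtain ⟨N, hN⟩ := Metric.cauchySeq_iff.1 hu ε hε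
    refine ⟨N, fun n hn => ?_⟩
    refine exists_of_tendsto_inner (l := Filter.atTop) (Y := fun i => u (i + N) - u n) ?_ ?_
    · intro i
      rw [← dist_eq_norm]
      exact (hN _ (by lia) _ hn).le
    · intro x y
      simp only [map_sub, sub_apply, inner_sub_right]
      exact (((Filter.tendsto_add_atTop_iff_nat N).2 (hin x y))).sub_const _
  obtain ⟨N, hN⟩ := hdiff 1 one_pos
  obtain ⟨X, hX, -⟩ := hN N le_rfl
  have hXZ : toCLM (X + u N) = Z := by rw [map_add, hX, sub_add_cancel]
  refine ⟨X + u N, Metric.tendsto_atTop.2 fun ε hε => ?_⟩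
  obtain ⟨N', hN'⟩ := hdiff (ε / 2) (half_pos hε)
  refine ⟨N', fun n hn => ?_⟩
  obtain ⟨W, hW, hWn⟩ := hN' n hn
  have : W = X + u N - u n := toCLM_injective (by rw [hW, map_sub, hXZ])
  rw [dist_comm, dist_eq_norm, ← this]
  linarith

end TraceClass

/-- Singular value decomposition of the restriction of a bounded operator to a finite-dimensional
subspace. -/
theorem exists_singular_decomposition [CompleteSpace E] (Z : E →L[ℂ] E) (B : Submodule ℂ E)
    [FiniteDimensional ℂ B] :
    ∃ (n : ℕ) (a b : Fin n → E) (s : Fin n → ℝ), Orthonormal ℂ a ∧ Orthonormal ℂ b ∧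
      (∀ j, 0 < s j) ∧ (∀ j, b j ∈ B) ∧ (∀ j, Z (b j) = (s j : ℂ) • a j) ∧
      ∀ x ∈ B, Z x = ∑ j, ((s j : ℂ) * inner ℂ (b j) x) • a j := by
  classical
  have hBc : CompleteSpace B := FiniteDimensional.complete ℂ B
  -- The right singular vectors diagonalize `W* W` on `B`; their images under `W` are then
  -- orthogonal.
  let W : B →L[ℂ] E := Z ∘L B.subtypeL
  let T : B →ₗ[ℂ] B := (ContinuousLinearMap.adjoint W ∘L W : B →L[ℂ] B)
  have hT : T.IsSymmetric := by
    intro x y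
    simp [T, ContinuousLinearMap.adjoint_inner_left, ContinuousLinearMap.adjoint_inner_right]
  let β := hT.eigenvectorBasis rfl
  have hW : ∀ i j, i ≠ j → inner ℂ (W (β i)) (W (β j)) = 0 := by
    intro i j hij
    have h1 : inner ℂ (W (β i)) (W (β j)) = inner ℂ (β i) (T (β j)) := by
      simp [T, ContinuousLinearMap.adjoint_inner_right]
    rw [h1, hT.apply_eigenvectorBasis rfl j, inner_smul_right, β.orthonormal.2 hij, mul_zero]
  -- Vectors with image zero are discarded, so that the left singular vectors can be normalized and
  -- all singular values are positive.
  let ι := {j : Fin (Module.finrank ℂ B) // W (β j) ≠ 0}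
  let σ : Fin (Fintype.card ι) ≃ ι := (Fintype.equivFin ι).symm
  have hpos : ∀ j : ι, 0 < ‖W (β j)‖ := fun j => norm_pos_iff.2 j.2
  refine ⟨Fintype.card ι, fun j => ((‖W (β (σ j))‖⁻¹ : ℝ) : ℂ) • W (β (σ j)),
    fun j => (β (σ j) : E), fun j => ‖W (β (σ j))‖, ⟨fun j => ?_, fun i j hij => ?_⟩,
    ⟨fun j => ?_, fun i j hij => ?_⟩, fun j => hpos _, fun j => (β (σ j)).2, fun j => ?_,
    fun x hx => ?_⟩
  · rw [norm_smul, Complex.norm_real, norm_inv, norm_norm, inv_mul_cancel₀ (hpos _).ne']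
  · beta_reduce
    rw [inner_smul_left, inner_smul_right, hW _ _ fun h => hij (σ.injective (Subtype.ext h))]
    simp
  · exact β.orthonormal.1 (σ j)
  · have := β.orthonormal.2 (i := (σ i : Fin _)) (j := (σ j : Fin _))
      fun h => hij (σ.injective (Subtype.ext h))
    simpa using this
  · rw [smul_smul, ← Complex.ofReal_mul, mul_inv_cancel₀ (hpos _).ne', Complex.ofReal_one, one_smul]
    rfl
  · have h1 : Z x = W ⟨x, hx⟩ := rfl
    have h2 : (⟨x, hx⟩ : B) = ∑ j, inner ℂ (β j) (⟨x, hx⟩ : B) • β j := (β.sum_repr' _).symm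
    rw [h1]
    conv_lhs => rw [h2]
    rw [map_sum]
    have h3 : ∀ j : ι, (inner ℂ (β j) (⟨x, hx⟩ : B) : ℂ) • W (β j)
        = (((‖W (β j)‖ : ℝ) : ℂ) * inner ℂ (β j : E) x) •
          (((‖W (β j)‖⁻¹ : ℝ) : ℂ) • W (β j)) := by
      intro j
      rw [smul_smul, mul_right_comm, ← Complex.ofReal_mul, mul_inv_cancel₀ (hpos _).ne',
        Complex.ofReal_one, one_mul]
      rfl
    rw [Equiv.sum_comp σ (fun j : ι => (((‖W (β j)‖ : ℝ) : ℂ) * inner ℂ (β j : E) x) •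
          (((‖W (β j)‖⁻¹ : ℝ) : ℂ) • W (β j)))]
    simp only [← h3]
    simp only [map_smul]
    rw [← Finset.sum_filter_of_ne (p := fun j => W (β j) ≠ 0)
      fun j _ hj h0 => hj (by rw [h0, smul_zero])]
    exact Finset.sum_subtype (p := fun j => W (β j) ≠ 0) _ (by simp) _

namespace TraceClass

theorem sum_norm_mul_norm_le {N : ℕ} {e f : Fin N → E} (he : Orthonormal ℂ e)
    (hf : Orthonormal ℂ f) (x y : E) :
    ∑ i, ‖inner ℂ (e i) x‖ * ‖inner ℂ (f i) y‖ ≤ ‖x‖ * ‖y‖ := by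
  refine (Real.sum_mul_le_sqrt_mul_sqrt _ _ _).trans ?_
  refine mul_le_mul ?_ ?_ (Real.sqrt_nonneg _) (norm_nonneg _)
  · exact Real.sqrt_le_iff.2 ⟨norm_nonneg _, he.sum_inner_products_le x⟩
  · exact Real.sqrt_le_iff.2 ⟨norm_nonneg _, hf.sum_inner_products_le y⟩

/-- Each rank-one term contributes at most `s j * c`, by Cauchy-Schwarz and Bessel for `e` and `f`.
The `a j` need only be bounded, not orthonormal, so the bound applies to images `A (a j)` of
singular vectors. -/
theorem sum_norm_inner_decomposition_le {n N : ℕ} {a b : Fin n → E} {s : Fin n → ℝ}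
    (hs : ∀ j, 0 < s j) {Z : E →L[ℂ] E} {e f : Fin N → E} (he : Orthonormal ℂ e)
    (hf : Orthonormal ℂ f) (hb : ∀ j, ‖b j‖ ≤ 1) {c : ℝ} (ha : ∀ j, ‖a j‖ ≤ c)
    (h : ∀ i, Z (f i) = ∑ j, ((s j : ℂ) * inner ℂ (b j) (f i)) • a j) :
    ∑ i, ‖inner ℂ (e i) (Z (f i))‖ ≤ c * ∑ j, s j := by
  calc ∑ i, ‖inner ℂ (e i) (Z (f i))‖
      ≤ ∑ i, ∑ j, s j * (‖inner ℂ (e i) (a j)‖ * ‖inner ℂ (f i) (b j)‖) := by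
        refine Finset.sum_le_sum fun i _ => ?_
        rw [h i, inner_sum]
        refine (norm_sum_le _ _).trans (Finset.sum_le_sum fun j _ => ?_)
        rw [inner_smul_right, norm_mul, norm_mul, Complex.norm_real, Real.norm_of_nonneg (hs j).le,
          norm_inner_symm (b j)]
        exact le_of_eq (by ring)
    _ = ∑ j, s j * ∑ i, ‖inner ℂ (e i) (a j)‖ * ‖inner ℂ (f i) (b j)‖ := by
        rw [Finset.sum_comm]
        simp only [Finset.mul_sum]
    _ ≤ ∑ j, s j * (c * 1) := by
        refine Finset.sum_le_sum fun j _ => mul_le_mul_of_nonneg_left ?_ (hs j).le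
        refine (sum_norm_mul_norm_le he hf _ _).trans ?_
        exact mul_le_mul (ha j) (hb j) (norm_nonneg _) ((norm_nonneg _).trans (ha j))
    _ = c * ∑ j, s j := by rw [← Finset.sum_mul]; ring

variable [CompleteSpace E]

/-- The ideal property. On the span of `f` the operator `X` has a finite singular decomposition, and
testing `X` against its singular vectors shows that the singular values add up to at most `‖X‖`.
Applying `A` scales the left vectors by at most `‖A‖`. -/
theorem sum_norm_inner_comp_le (A : E →L[ℂ] E) (X : TraceClass E) {N : ℕ} {e f : Fin N → E}
    (he : Orthonormal ℂ e) (hf : Orthonormal ℂ f) :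
    ∑ i, ‖inner ℂ (e i) ((A ∘L toCLM X) (f i))‖ ≤ ‖A‖ * ‖X‖ := by
  have hfin : FiniteDimensional ℂ (Submodule.span ℂ (Set.range f)) :=
    FiniteDimensional.span_of_finite ℂ (Set.finite_range f)
  obtain ⟨n, a, b, s, ha, hb, hs, -, hab, hx⟩ :=
    exists_singular_decomposition (toCLM X) (Submodule.span ℂ (Set.range f))
  have h1 : ∑ j, s j ≤ ‖X‖ := by
    refine le_trans (le_of_eq ?_) (sum_norm_inner_le X ha hb)
    refine Finset.sum_congr rfl fun j _ => ?_
    rw [hab, inner_smul_right, inner_self_eq_norm_sq_to_K, ha.1 j]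
    simp [abs_of_pos (hs j)]
  refine (sum_norm_inner_decomposition_le (a := fun j => A (a j)) hs he hf
    (fun j => (hb.1 j).le) (c := ‖A‖) (fun j => ?_) fun i => ?_).trans
    (mul_le_mul_of_nonneg_left h1 (norm_nonneg _))
  · simpa [ha.1 j] using A.le_opNorm (a j)
  · rw [ContinuousLinearMap.comp_apply, hx _ (Submodule.subset_span ⟨i, rfl⟩), map_sum]
    simp only [map_smul]

/-- The adjoint of a trace-class operator. -/
def star (X : TraceClass E) : TraceClass E :=
  ofBound (ContinuousLinearMap.adjoint (toCLM X)) ‖X‖ fun N e f he hf => by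
    simp only [ContinuousLinearMap.adjoint_inner_right]
    refine le_trans (le_of_eq ?_) (sum_norm_inner_le X hf he)
    exact Finset.sum_congr rfl fun i _ => norm_inner_symm _ _

@[simp] theorem toCLM_star (X : TraceClass E) :
    toCLM (star X) = ContinuousLinearMap.adjoint (toCLM X) := rfl

theorem norm_star_le (X : TraceClass E) : ‖star X‖ ≤ ‖X‖ :=
  norm_le (norm_nonneg _) fun N e f he hf => by
    simp only [toCLM_star, ContinuousLinearMap.adjoint_inner_right]
    refine le_trans (le_of_eq ?_) (sum_norm_inner_le X hf he)
    exact Finset.sum_congr rfl fun i _ => norm_inner_symm _ _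

/-- The product `A X` of a bounded and a trace-class operator. -/
def lmul (A : E →L[ℂ] E) (X : TraceClass E) : TraceClass E :=
  ofBound (A ∘L toCLM X) (‖A‖ * ‖X‖) fun _ _ _ he hf => sum_norm_inner_comp_le A X he hf

theorem norm_lmul_le (A : E →L[ℂ] E) (X : TraceClass E) : ‖lmul A X‖ ≤ ‖A‖ * ‖X‖ :=
  norm_le (by positivity) fun _ _ _ he hf => sum_norm_inner_comp_le A X he hf

/-- The map `X ↦ A X B†` on `𝒯₁`. -/
def conjMap (A B : E →L[ℂ] E) : TraceClass E →L[ℂ] TraceClass E :=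
  LinearMap.mkContinuous
    -- Right multiplication is reduced to left multiplication by `X B† = (B X†)†`.
    { toFun := fun X => lmul A (star (lmul B (star X)))
      map_add' := fun X Y => toCLM_injective (by simp [lmul])
      map_smul' := fun c X => toCLM_injective (by ext; simp [lmul]) } (‖A‖ * ‖B‖) fun X => by
    calc ‖lmul A (star (lmul B (star X)))‖ ≤ ‖A‖ * ‖star (lmul B (star X))‖ := norm_lmul_le _ _
      _ ≤ ‖A‖ * (‖B‖ * ‖X‖) := by
        gcongr
        exact (norm_star_le _).trans ((norm_lmul_le _ _).trans (by gcongr; exact norm_star_le _))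
      _ = _ := by ring

theorem toCLM_conjMap (A B : E →L[ℂ] E) (X : TraceClass E) :
    toCLM (conjMap A B X) = A ∘L toCLM X ∘L ContinuousLinearMap.adjoint B := by
  change A ∘L ContinuousLinearMap.adjoint (B ∘L ContinuousLinearMap.adjoint (toCLM X)) = _
  rw [ContinuousLinearMap.adjoint_comp, ContinuousLinearMap.adjoint_adjoint]

end TraceClass
end TraceNorm

/-! ### Rank-one operators and density -/

section Ketbra

variable {E : Type*} [NormedAddCommGroup E] [InnerProductSpace ℂ E]

open TraceClass

theorem toCLM_ketbra (x y : E) : toCLM (ketbra x y) = InnerProductSpace.rankOne ℂ x y := rfl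

theorem toCLM_ketbra_apply (x y z : E) : toCLM (ketbra x y) z = inner ℂ y z • x := by
  rw [toCLM_ketbra, InnerProductSpace.rankOne_apply]

theorem norm_ketbra_le (x y : E) : ‖ketbra x y‖ ≤ ‖x‖ * ‖y‖ :=
  TraceClass.norm_le (by positivity) fun N e f he hf => by
    refine le_trans (le_of_eq ?_) (sum_norm_mul_norm_le he hf x y)
    refine Finset.sum_congr rfl fun i _ => ?_
    rw [toCLM_ketbra_apply, inner_smul_right, norm_mul, mul_comm, norm_inner_symm y]

/-- `(x, y) ↦ |x⟩⟨y|` as a continuous sesquilinear map. -/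
def ketbraL (E : Type*) [NormedAddCommGroup E] [InnerProductSpace ℂ E] :
    E →L[ℂ] E →L⋆[ℂ] TraceClass E :=
  LinearMap.mkContinuous₂
    (LinearMap.mk₂'ₛₗ (RingHom.id ℂ) (starRingEnd ℂ) ketbra
      (fun x x' y => toCLM_injective (by simp [toCLM_ketbra]))
      (fun c x y => toCLM_injective (by simp [toCLM_ketbra]))
      (fun x y y' => toCLM_injective (by simp [toCLM_ketbra]))
      (fun c x y => toCLM_injective (by simp [toCLM_ketbra]))) 1
    fun x y => by simpa using norm_ketbra_le x y

theorem ketbraL_apply (x y : E) : ketbraL E x y = ketbra x y := rfl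

theorem ketbra_smul_left (c : ℂ) (x y : E) : ketbra (c • x) y = c • ketbra x y := by
  simp [← ketbraL_apply]

theorem ketbra_smul_right (c : ℂ) (x y : E) : ketbra x (c • y) = starRingEnd ℂ c • ketbra x y := by
  simp [← ketbraL_apply]

theorem ketbra_add_left (x x' y : E) : ketbra (x + x') y = ketbra x y + ketbra x' y := by
  simp [← ketbraL_apply]

theorem ketbra_add_right (x y y' : E) : ketbra x (y + y') = ketbra x y + ketbra x y' := by
  simp [← ketbraL_apply]

theorem ketbra_sub_left (x x' y : E) : ketbra (x - x') y = ketbra x y - ketbra x' y := by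
  simp [← ketbraL_apply]

theorem ketbra_sub_right (x y y' : E) : ketbra x (y - y') = ketbra x y - ketbra x y' := by
  simp [← ketbraL_apply]

@[simp] theorem ketbra_zero_left (y : E) : ketbra 0 y = 0 := by
  simp [← ketbraL_apply]

@[simp] theorem ketbra_zero_right (x : E) : ketbra x 0 = 0 := by
  simp [← ketbraL_apply]

theorem orthonormal_append {N n : ℕ} {e : Fin N → E} {a : Fin n → E} (he : Orthonormal ℂ e)
    (ha : Orthonormal ℂ a) (h : ∀ i j, inner ℂ (e i) (a j) = 0) :
    Orthonormal ℂ (Fin.append e a) := by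
  refine ⟨fun i => ?_, fun i j => ?_⟩
  · refine Fin.addCases (fun i => ?_) (fun i => ?_) i
    · simpa using he.1 i
    · simpa using ha.1 i
  · refine Fin.addCases (fun i => ?_) (fun i => ?_) i <;>
      refine Fin.addCases (fun j => ?_) (fun j => ?_) j <;> intro hij
    · simpa using he.2 fun h => hij (by rw [h])
    · simpa using h i j
    · simpa using inner_eq_zero_symm.1 (h j i)
    · simpa using ha.2 fun h => hij (by rw [h])

/-- The orthogonal projection onto the span of an orthonormal family. -/
def familyProj {N : ℕ} (e : Fin N → E) : E →L[ℂ] E :=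
  ∑ i, InnerProductSpace.rankOne ℂ (e i) (e i)

theorem familyProj_apply {N : ℕ} (e : Fin N → E) (x : E) :
    familyProj e x = ∑ i, inner ℂ (e i) x • e i := by
  simp [familyProj]

theorem inner_familyProj {N : ℕ} {e : Fin N → E} (he : Orthonormal ℂ e) (j : Fin N) (x : E) :
    inner ℂ (e j) (familyProj e x) = inner ℂ (e j) x := by
  rw [familyProj_apply, he.inner_right_fintype]

variable [CompleteSpace E]

theorem conjMap_ketbra (A B : E →L[ℂ] E) (x y : E) :
    conjMap A B (ketbra x y) = ketbra (A x) (B y) :=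
  toCLM_injective (by
    ext z
    rw [toCLM_conjMap]
    simp [toCLM_ketbra_apply, ContinuousLinearMap.adjoint_inner_right])

theorem adjoint_familyProj {N : ℕ} (e : Fin N → E) :
    ContinuousLinearMap.adjoint (familyProj e) = familyProj e := by
  simp [familyProj]

/-- The singular vectors of the compressed operator are orthogonal to `e` and to `f` respectively.
Appending them to `e` and `f` gives one admissible pair of families for `‖X‖`, whose sum is the
given sum plus the singular values. -/
theorem norm_conjMap_compl_le {N : ℕ} {e f : Fin N → E} (he : Orthonormal ℂ e)
    (hf : Orthonormal ℂ f) (X : TraceClass E) :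
    ∑ i, ‖inner ℂ (e i) (toCLM X (f i))‖ + ‖conjMap (1 - familyProj e) (1 - familyProj f) X‖
      ≤ ‖X‖ := by
  set Q := 1 - familyProj e
  set R := 1 - familyProj f
  have hR : ContinuousLinearMap.adjoint R = R := by
    simp only [R, map_sub, adjoint_familyProj]
    congr 1
    exact ContinuousLinearMap.adjoint_id
  have hQe : ∀ i x, inner ℂ (e i) (Q x) = 0 := fun i x => by
    simp [Q, inner_familyProj he]
  have hRf : ∀ i x, inner ℂ (f i) (R x) = 0 := fun i x => by
    simp [R, inner_familyProj hf]
  have key : ‖conjMap Q R X‖ ≤ ‖X‖ - ∑ i, ‖inner ℂ (e i) (toCLM X (f i))‖ := by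
    refine TraceClass.norm_le (sub_nonneg.2 (sum_norm_inner_le X he hf)) fun N' e' f' he' hf' => ?_
    have hfin : FiniteDimensional ℂ (Submodule.span ℂ (Set.range fun i => R (f' i))) :=
      FiniteDimensional.span_of_finite ℂ (Set.finite_range _)
    obtain ⟨n, a, b, s, ha, hb, hs, hbB, hab, hx⟩ :=
      exists_singular_decomposition (Q ∘L toCLM X)
        (Submodule.span ℂ (Set.range fun i => R (f' i)))
    have hea : ∀ i j, inner ℂ (e i) (a j) = 0 := by
      intro i j
      have h1 := hQe i (toCLM X (b j))
      rw [show Q (toCLM X (b j)) = (s j : ℂ) • a j from hab j, inner_smul_right] at h1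
      exact (mul_eq_zero.1 h1).resolve_left (by exact_mod_cast (hs j).ne')
    have hfb : ∀ i j, inner ℂ (f i) (b j) = 0 := by
      intro i j
      refine Submodule.span_induction (p := fun x _ => inner ℂ (f i) x = 0) ?_ (by simp)
        (fun x y _ _ h h' => by rw [inner_add_right, h, h', add_zero])
        (fun c x _ h => by rw [inner_smul_right, h, mul_zero]) (hbB j)
      rintro _ ⟨i', rfl⟩
      exact hRf i _
    have hRb : ∀ j, R (b j) = b j := fun j => by
      simp [R, familyProj_apply, hfb]
    have h1 := sum_norm_inner_le X (orthonormal_append he ha hea) (orthonormal_append hf hb hfb)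
    rw [Fin.sum_univ_add] at h1
    simp only [Fin.append_left, Fin.append_right] at h1
    have h2 : ∀ j, ‖inner ℂ (a j) (toCLM X (b j))‖ = s j := by
      intro j
      have h3 : inner ℂ (a j) (Q (toCLM X (b j))) = inner ℂ (a j) (toCLM X (b j)) := by
        simp only [Q, sub_apply, inner_sub_right, one_apply_eq_self]
        rw [familyProj_apply, inner_sum, Finset.sum_eq_zero, sub_zero]
        intro i _
        rw [inner_smul_right, inner_eq_zero_symm.1 (hea i j), mul_zero]
      rw [← h3, show Q (toCLM X (b j)) = (s j : ℂ) • a j from hab j, inner_smul_right,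
        inner_self_eq_norm_sq_to_K, ha.1 j]
      simp [abs_of_pos (hs j)]
    simp only [h2] at h1
    have h4 := sum_norm_inner_decomposition_le (Z := toCLM (conjMap Q R X)) hs he' hf'
      (fun j => (hb.1 j).le) (fun j => (ha.1 j).le) fun i => by
        rw [toCLM_conjMap, hR]
        refine (hx _ (Submodule.subset_span ⟨i, rfl⟩)).trans ?_
        refine Finset.sum_congr rfl fun j _ => ?_
        rw [← ContinuousLinearMap.adjoint_inner_left, hR, hRb]
    linarith
  linarith

/-- If `e` and `f` attain `‖X‖` up to `ε`, then the part of `X` off both spans has trace norm at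
most `ε` by `norm_conjMap_compl_le`, and the rest has finite rank. -/
theorem exists_norm_sub_le_of_mem_span_ketbra (X : TraceClass E) {ε : ℝ} (hε : 0 < ε) :
    ∃ Y ∈ Submodule.span ℂ (Set.range fun p : E × E => ketbra p.1 p.2), ‖X - Y‖ ≤ ε := by
  rcases le_or_gt ‖X‖ ε with h | h
  · exact ⟨0, Submodule.zero_mem _, by simpa using h⟩
  obtain ⟨N, e, f, he, hf, hN⟩ : ∃ (N : ℕ) (e f : Fin N → E), Orthonormal ℂ e ∧
      Orthonormal ℂ f ∧ ‖X‖ - ε < ∑ i, ‖inner ℂ (e i) (toCLM X (f i))‖ := by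
    by_contra! hcon
    have := TraceClass.norm_le (X := X) (sub_nonneg.2 h.le) hcon
    linarith
  set Q := 1 - familyProj e with hQ
  -- With `P` and `P'` the projections onto the spans of `e` and `f`, the witness is `P X + (1 - P)
  -- X P'`, so that the remainder is `(1 - P) X (1 - P')`.
  refine ⟨∑ i, ketbra (e i) (ContinuousLinearMap.adjoint (toCLM X) (e i)) +
    ∑ i, ketbra (Q (toCLM X (f i))) (f i), ?_, ?_⟩
  · exact Submodule.add_mem _ (Submodule.sum_mem _ fun i _ => Submodule.subset_span ⟨(_, _), rfl⟩)
      (Submodule.sum_mem _ fun i _ => Submodule.subset_span ⟨(_, _), rfl⟩)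
  · have h1 := norm_conjMap_compl_le he hf X
    have h2 : X - (∑ i, ketbra (e i) (ContinuousLinearMap.adjoint (toCLM X) (e i)) +
        ∑ i, ketbra (Q (toCLM X (f i))) (f i)) = conjMap Q (1 - familyProj f) X := by
      apply toCLM_injective
      ext z
      rw [toCLM_conjMap, map_sub (ContinuousLinearMap.adjoint) 1 (familyProj f),
        adjoint_familyProj, show ContinuousLinearMap.adjoint (1 : E →L[ℂ] E) = 1 from
          ContinuousLinearMap.adjoint_id]
      simp only [map_sub, map_add, map_sum, sub_apply, add_apply,
        sum_apply, ContinuousLinearMap.comp_apply, toCLM_ketbra_apply,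
        ContinuousLinearMap.adjoint_inner_left, one_apply_eq_self, familyProj_apply,
        map_smul, hQ]
      abel
    rw [h2]
    linarith

/-- A trace-class operator supported on a finite-dimensional subspace is a combination of rank-one
operators whose coefficients add up to at most its trace norm. -/
theorem exists_eq_sum_ketbra (X : TraceClass E) (B : Submodule ℂ E) [FiniteDimensional ℂ B]
    (hX : ∀ x ∈ Bᗮ, toCLM X x = 0) :
    ∃ (n : ℕ) (a b : Fin n → E) (s : Fin n → ℝ), (∀ j, ‖a j‖ = 1) ∧ (∀ j, ‖b j‖ = 1) ∧
      (∀ j, 0 < s j) ∧ X = ∑ j, (s j : ℂ) • ketbra (a j) (b j) ∧ ∑ j, s j ≤ ‖X‖ := by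
  obtain ⟨n, a, b, s, ha, hb, hs, hbB, hab, hx⟩ := exists_singular_decomposition (toCLM X) B
  refine ⟨n, a, b, s, ha.1, hb.1, hs, toCLM_injective ?_, ?_⟩
  · ext x
    have h1 : toCLM X x = toCLM X (B.starProjection x) := by
      rw [← sub_eq_zero, ← map_sub]
      exact hX _ (B.sub_starProjection_mem_orthogonal x)
    rw [h1, hx _ (B.starProjection_apply_mem x)]
    simp only [map_sum, map_smul, sum_apply, smul_apply, toCLM_ketbra_apply,
      smul_smul]
    refine Finset.sum_congr rfl fun j _ => ?_
    rw [← Submodule.inner_starProjection_left_eq_right,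
      Submodule.starProjection_eq_self_iff.2 (hbB j)]
  · refine le_trans (le_of_eq ?_) (sum_norm_inner_le X ha hb)
    refine Finset.sum_congr rfl fun j _ => ?_
    rw [hab, inner_smul_right, inner_self_eq_norm_sq_to_K, ha.1 j]
    simp [abs_of_pos (hs j)]

end Ketbra

theorem exists_self_adjoint_sqrt {E : Type*} [NormedAddCommGroup E] [InnerProductSpace ℂ E]
    [CompleteSpace E] {X : E →L[ℂ] E} (hX : X.IsPositive) :
    ∃ S : E →L[ℂ] E, ∀ x y, inner ℂ x (X y) = inner ℂ (S x) (S y) ∧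
      inner ℂ (S x) y = inner ℂ x (S y) := by
  have hSS : CFC.sqrt X * CFC.sqrt X = X :=
    CFC.sqrt_mul_sqrt_self _ ((ContinuousLinearMap.nonneg_iff_isPositive _).2 hX)
  have hS : ContinuousLinearMap.adjoint (CFC.sqrt X) = CFC.sqrt X :=
    ((ContinuousLinearMap.nonneg_iff_isPositive _).1
      (CFC.sqrt_nonneg X)).isSelfAdjoint.adjoint_eq
  have h2 : ∀ x y, inner ℂ (CFC.sqrt X x) y = inner ℂ x (CFC.sqrt X y) := fun x y => by
    rw [← ContinuousLinearMap.adjoint_inner_right, hS]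
  refine ⟨CFC.sqrt X, fun x y => ⟨?_, h2 x y⟩⟩
  rw [h2, ← mul_apply_eq_comp, hSS]

/-! ### Trace and positivity on the Fock space -/

section FockTrace

open TraceClass

variable {V : Type*} [Fintype V] [DecidableEq V]

/-- The Fock basis as a Hilbert basis. -/
def fockBasis (V : Type*) [Fintype V] [DecidableEq V] : HilbertBasis (V → ℕ) ℂ (Fock V) :=
  HilbertBasis.ofRepr (LinearIsometryEquiv.refl ℂ _)

@[simp] theorem fockBasis_apply (n : V → ℕ) : fockBasis V n = ket n := by
  rw [← HilbertBasis.repr_symm_single]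
  unfold ket fockBasis
  rw [LinearIsometryEquiv.symm_apply_eq]
  change _ = (lp.single 2 n (1 : ℂ) : Fock V)
  congr

theorem orthonormal_ket : Orthonormal ℂ (ket : (V → ℕ) → Fock V) := by
  have h := (fockBasis V).orthonormal
  rwa [show (fockBasis V : (V → ℕ) → Fock V) = ket from funext fockBasis_apply] at h

@[simp] theorem norm_ket (n : V → ℕ) : ‖ket n‖ = 1 := orthonormal_ket.1 n

theorem inner_ket_ket (n m : V → ℕ) : inner ℂ (ket n) (ket m) = if n = m then (1 : ℂ) else 0 :=
  orthonormal_iff_ite.1 orthonormal_ket n m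

theorem hasSum_inner_ket (x y : Fock V) :
    HasSum (fun n => inner ℂ x (ket n) * inner ℂ (ket n) y) (inner ℂ x y) := by
  simpa using (fockBasis V).hasSum_inner_mul_inner x y

theorem topologicalClosure_span_ket :
    (Submodule.span ℂ (Set.range (ket : (V → ℕ) → Fock V))).topologicalClosure = ⊤ := by
  have h := (fockBasis V).dense_span
  rwa [show (fockBasis V : (V → ℕ) → Fock V) = ket from funext fockBasis_apply] at h

theorem ext_inner_ket {X Y : Fock V →L[ℂ] Fock V}
    (h : ∀ n m, inner ℂ (ket n) (X (ket m)) = inner ℂ (ket n) (Y (ket m))) : X = Y := by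
  have hd : Dense (Submodule.span ℂ (Set.range (ket : (V → ℕ) → Fock V)) : Set (Fock V)) :=
    Submodule.dense_iff_topologicalClosure_eq_top.2 topologicalClosure_span_ket
  refine ContinuousLinearMap.ext_on hd ?_
  rintro _ ⟨m, rfl⟩
  refine (fockBasis V).repr.injective (lp.ext (funext fun n => ?_))
  rw [HilbertBasis.repr_apply_apply, HilbertBasis.repr_apply_apply, fockBasis_apply, h]

theorem toTraceClass_single (p : (V → ℕ) × (V → ℕ)) (c : ℂ) :
    FinOp.toTraceClass (Finsupp.single p c) = c • ketbra (ket p.1) (ket p.2) := by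
  simp [FinOp.toTraceClass]

/-- `𝒯_f` is dense in `𝒯₁`. -/
theorem topologicalClosure_range_toTraceClass :
    (LinearMap.range (FinOp.toTraceClass (V := V))).topologicalClosure = ⊤ := by
  set R := (LinearMap.range (FinOp.toTraceClass (V := V))).topologicalClosure with hR
  have h1 : ∀ n m : V → ℕ, ketbra (ket n) (ket m) ∈ R := fun n m =>
    Submodule.le_topologicalClosure _ ⟨Finsupp.single (n, m) 1, by simp [toTraceClass_single]⟩
  have hcl : IsClosed (R : Set (TraceClass (Fock V))) := Submodule.isClosed_topologicalClosure _
  have h2 : ∀ (x : Fock V) (m : V → ℕ), ketbra x (ket m) ∈ R := by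
    intro x m
    have : (Submodule.span ℂ (Set.range (ket : (V → ℕ) → Fock V))).topologicalClosure ≤
        R.comap ((ketbraL (Fock V)).flip (ket m) : Fock V →ₗ[ℂ] TraceClass (Fock V)) := by
      refine Submodule.topologicalClosure_minimal _ (Submodule.span_le.2 ?_)
        (hcl.preimage ((ketbraL (Fock V)).flip (ket m)).continuous)
      rintro _ ⟨n, rfl⟩
      exact h1 n m
    rw [topologicalClosure_span_ket] at this
    exact this (Submodule.mem_top (x := x))
  have h3 : ∀ (x y : Fock V), ketbra x y ∈ R := by
    intro x y
    have hy : y ∈ closure (Submodule.span ℂ (Set.range (ket : (V → ℕ) → Fock V)) : Set (Fock V)) :=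
      by
        have := (topologicalClosure_span_ket (V := V)).ge (Submodule.mem_top (x := y))
        exact this
    refine closure_minimal (fun z hz => ?_) (hcl.preimage (ketbraL (Fock V) x).continuous) hy
    change ketbra x z ∈ R
    refine Submodule.span_induction (p := fun z _ => ketbra x z ∈ R) ?_ (by simp)
      (fun u v _ _ hu hv => by rw [ketbra_add_right]; exact R.add_mem hu hv)
      (fun c u _ hu => by rw [ketbra_smul_right]; exact R.smul_mem _ hu) hz
    rintro _ ⟨m, rfl⟩
    exact h2 x m
  refine eq_top_iff.2 fun X _ => ?_
  refine hcl.closure_subset_iff.2 (subset_refl _) (Metric.mem_closure_iff.2 fun ε hε => ?_)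
  obtain ⟨Y, hY, hXY⟩ := exists_norm_sub_le_of_mem_span_ketbra X (half_pos hε)
  refine ⟨Y, ?_, by rw [dist_eq_norm]; linarith⟩
  exact (Submodule.span_le.2 (by rintro _ ⟨p, rfl⟩; exact h3 p.1 p.2) :
    Submodule.span ℂ _ ≤ R) hY

theorem denseRange_toTraceClass : DenseRange (FinOp.toTraceClass (V := V)) := by
  have := Submodule.dense_iff_topologicalClosure_eq_top.2
    (topologicalClosure_range_toTraceClass (V := V))
  rwa [LinearMap.coe_range] at this

theorem ext_ketbra_ket {F : Type*} [NormedAddCommGroup F] [NormedSpace ℂ F]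
    {Φ Ψ : TraceClass (Fock V) →L[ℂ] F}
    (h : ∀ n m, Φ (ketbra (ket n) (ket m)) = Ψ (ketbra (ket n) (ket m))) : Φ = Ψ := by
  have h1 : (Φ : TraceClass (Fock V) →ₗ[ℂ] F) ∘ₗ FinOp.toTraceClass =
      (Ψ : TraceClass (Fock V) →ₗ[ℂ] F) ∘ₗ FinOp.toTraceClass := by
    refine Finsupp.lhom_ext fun p c => ?_
    simp [toTraceClass_single, h]
  refine ContinuousLinearMap.coeFn_injective (denseRange_toTraceClass.equalizer Φ.continuous
    Ψ.continuous (funext fun x => ?_))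
  exact LinearMap.congr_fun h1 x

/-- The matrix element `⟨n| X |m⟩`. -/
def entry (n m : V → ℕ) : TraceClass (Fock V) →L[ℂ] ℂ :=
  innerSL ℂ (ket n) ∘L ContinuousLinearMap.apply ℂ (Fock V) (ket m) ∘L toCLMₗ (Fock V)

theorem entry_apply (n m : V → ℕ) (X : TraceClass (Fock V)) :
    entry n m X = inner ℂ (ket n) (toCLM X (ket m)) := rfl

theorem ext_entry {X Y : TraceClass (Fock V)} (h : ∀ n m, entry n m X = entry n m Y) : X = Y :=
  toCLM_injective (ext_inner_ket h)

theorem entry_ketbra (n m : V → ℕ) (x y : Fock V) :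
    entry n m (ketbra x y) = inner ℂ (ket n) x * inner ℂ y (ket m) := by
  rw [entry_apply, toCLM_ketbra_apply, inner_smul_right, mul_comm]

theorem entry_toTraceClass (n m : V → ℕ) (x : FinOp V) :
    entry n m x.toTraceClass = x (n, m) := by
  induction x using Finsupp.induction_linear with
  | zero => simp
  | add x y hx hy => simp [hx, hy]
  | single p c =>
    obtain ⟨p, q⟩ := p
    rw [toTraceClass_single, map_smul, entry_ketbra, inner_ket_ket, inner_ket_ket]
    by_cases h1 : n = p <;> by_cases h2 : q = m <;> simp [h1, h2]

theorem toTraceClass_injective : Function.Injective (FinOp.toTraceClass (V := V)) := by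
  intro x y h
  ext ⟨n, m⟩
  rw [← entry_toTraceClass, h, entry_toTraceClass]

theorem sum_norm_entry_diag_le (X : TraceClass (Fock V)) (s : Finset (V → ℕ)) :
    ∑ n ∈ s, ‖entry n n X‖ ≤ ‖X‖ := by
  have h : Orthonormal ℂ (fun i : Fin s.card => (ket (s.equivFin.symm i : V → ℕ) : Fock V)) :=
    orthonormal_ket.comp _ (Subtype.val_injective.comp s.equivFin.symm.injective)
  refine le_trans (le_of_eq ?_) (sum_norm_inner_le X h h)
  rw [← Finset.sum_coe_sort]
  exact (Equiv.sum_comp s.equivFin.symm fun n : s => ‖entry (n : V → ℕ) n X‖).symm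

theorem summable_norm_entry_diag (X : TraceClass (Fock V)) :
    Summable fun n : V → ℕ => ‖entry n n X‖ :=
  summable_of_sum_le (fun _ => norm_nonneg _) (sum_norm_entry_diag_le X)

theorem hasSum_trace (X : TraceClass (Fock V)) :
    HasSum (fun n : V → ℕ => entry n n X) (trace X) :=
  (summable_norm_entry_diag X).of_norm.hasSum

/-- The trace as a continuous linear functional. -/
def traceL (V : Type*) [Fintype V] [DecidableEq V] : TraceClass (Fock V) →L[ℂ] ℂ :=
  LinearMap.mkContinuous
    { toFun := trace
      map_add' := fun X Y => by
        refine (hasSum_trace (X + Y)).unique ?_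
        simpa using (hasSum_trace X).add (hasSum_trace Y)
      map_smul' := fun c X => by
        refine (hasSum_trace (c • X)).unique ?_
        simpa using (hasSum_trace X).mul_left c } 1 fun X => by
    rw [one_mul]
    exact tsum_of_norm_bounded ((summable_norm_entry_diag X).hasSum) (fun _ => le_rfl) |>.trans
      ((summable_norm_entry_diag X).tsum_le_of_sum_le (sum_norm_entry_diag_le X))

@[simp] theorem traceL_apply (X : TraceClass (Fock V)) : traceL V X = trace X := rfl

theorem trace_ketbra (x y : Fock V) : trace (ketbra x y) = inner ℂ y x := by
  refine (hasSum_trace _).unique ?_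
  simp only [entry_ketbra]
  simpa only [mul_comm] using hasSum_inner_ket y x

theorem trace_toTraceClass (x : FinOp V) :
    trace x.toTraceClass = x.sum fun p c => if p.1 = p.2 then c else 0 := by
  rw [← traceL_apply]
  simp only [FinOp.toTraceClass, Finsupp.linearCombination_apply, Finsupp.sum, map_sum, map_smul,
    traceL_apply, trace_ketbra, inner_ket_ket, smul_eq_mul, mul_ite, mul_one, mul_zero]
  exact Finset.sum_congr rfl fun p _ => by simp [eq_comm]

/-- With `X = S²`, both sides become sums of `|⟨e i, S n⟩|²`: expand `‖S e_i‖²` in the Fock basis,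
exchange the sums, and use Bessel for `e` on each `S |n⟩`. -/
theorem sum_inner_le_trace {X : TraceClass (Fock V)} (hX : (toCLM X).IsPositive) {N : ℕ}
    {e : Fin N → Fock V} (he : Orthonormal ℂ e) :
    ∑ i, (inner ℂ (e i) (toCLM X (e i))).re ≤ (trace X).re := by
  obtain ⟨S, hS⟩ := exists_self_adjoint_sqrt hX
  have h1 : ∀ i, HasSum (fun n : V → ℕ => ‖inner ℂ (e i) (S (ket n))‖ ^ 2)
      (inner ℂ (e i) (toCLM X (e i))).re := by
    intro i
    rw [(hS _ _).1]
    refine ((hasSum_inner_ket (S (e i)) (S (e i))).mapL Complex.reCLM).congr_fun fun n => ?_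
    rw [← inner_conj_symm (ket n) (S (e i)), Complex.mul_conj, Complex.normSq_eq_norm_sq,
      Complex.reCLM_apply, Complex.ofReal_re, (hS _ _).2]
  have h2 := (hasSum_trace X).mapL Complex.reCLM
  refine hasSum_le (fun n => ?_) (hasSum_sum fun i _ => h1 i) h2
  refine (he.sum_inner_products_le _).trans (le_of_eq ?_)
  rw [Complex.reCLM_apply, entry_apply, (hS _ _).1, inner_self_eq_norm_sq_to_K]
  norm_cast

/-- Positivity of the `2 × 2` form at `(c e, f)` with `|c| = 1`, with the phase of `c` chosen to
align the off-diagonal terms. The arithmetic mean, rather than the geometric one, is what adds up to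
traces over orthonormal families. -/
theorem IsPositiveBlock.norm_inner_le {X : Fin 2 → Fin 2 → TraceClass (Fock V)}
    (hX : IsPositiveBlock X) (e f : Fock V) :
    ‖inner ℂ e (toCLM (X 0 1) f)‖ ≤
      ((inner ℂ e (toCLM (X 0 0) e)).re + (inner ℂ f (toCLM (X 1 1) f)).re) / 2 := by
  set a := inner ℂ e (toCLM (X 0 0) e)
  set d := inner ℂ f (toCLM (X 1 1) f)
  set b := inner ℂ e (toCLM (X 0 1) f)
  set b' := inner ℂ f (toCLM (X 1 0) e)
  have key : ∀ c : ℂ, 0 ≤ starRingEnd ℂ c * c * a + starRingEnd ℂ c * b + c * b' + d := by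
    intro c
    have h := hX ![c • e, f]
    simp only [Fin.sum_univ_two, Matrix.cons_val_zero, Matrix.cons_val_one, map_smul,
      inner_smul_left, inner_smul_right] at h
    convert h using 1
    ring
  -- The imaginary parts at `c = 0, 1, -1, i` vanish, and together they force `b' = conj b`.
  have h0 := (Complex.nonneg_iff.1 (key 0)).2
  have h1 := (Complex.nonneg_iff.1 (key 1)).2
  have hm := (Complex.nonneg_iff.1 (key (-1))).2
  have hi := (Complex.nonneg_iff.1 (key Complex.I)).2
  simp at h0 h1 hm hi
  have hb : b' = starRingEnd ℂ b := by
    apply Complex.ext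
    · simp; linarith
    · simp; linarith
  rcases eq_or_ne b 0 with hb0 | hb0
  · have h0 := (Complex.nonneg_iff.1 (key 0)).1
    have h1 := (Complex.nonneg_iff.1 (key 1)).1
    have h2 := hX ![e, 0]
    simp only [Fin.sum_univ_two, Matrix.cons_val_zero, Matrix.cons_val_one, map_zero,
      inner_zero_left, inner_zero_right, add_zero] at h2
    have h2 := (Complex.nonneg_iff.1 h2).1
    simp at h0
    rw [hb0, norm_zero]
    have : 0 ≤ a.re := h2
    linarith
  -- This unit phase turns the two cross terms into `-2 ‖b‖`.
  · have h := (Complex.nonneg_iff.1 (key (-(b / (‖b‖ : ℂ))))).1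
    have hbn : (‖b‖ : ℂ) ≠ 0 := by exact_mod_cast (norm_pos_iff.2 hb0).ne'
    have e1 : b * starRingEnd ℂ b = (‖b‖ : ℂ) * ‖b‖ := by
      rw [Complex.mul_conj, Complex.normSq_eq_norm_sq]; push_cast; ring
    have e2 : starRingEnd ℂ (-(b / (‖b‖ : ℂ))) * (-(b / (‖b‖ : ℂ))) * a +
        starRingEnd ℂ (-(b / (‖b‖ : ℂ))) * b + (-(b / (‖b‖ : ℂ))) * b' + d
        = a + d - 2 * (‖b‖ : ℂ) := by
      rw [hb]
      simp only [map_neg, map_div₀, Complex.conj_ofReal]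
      field_simp
      linear_combination (a - 2 * (‖b‖ : ℂ)) * e1
    rw [e2] at h
    simp at h
    linarith

theorem isPositive_of_isPositiveBlock {X : TraceClass (Fock V)}
    (hX : IsPositiveBlock fun _ _ : Fin 1 => X) : (toCLM X).IsPositive := by
  refine (ContinuousLinearMap.isPositive_iff_complex _).2 fun x => ?_
  have h := hX fun _ => x
  simp only [Fin.sum_univ_one] at h
  rw [← inner_conj_symm]
  obtain ⟨h1, h2⟩ := Complex.nonneg_iff.1 h
  rw [RCLike.re_eq_complex_re, Complex.conj_re]
  refine ⟨?_, h1⟩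
  apply Complex.ext
  · simp only [Complex.ofReal_re, Complex.conj_re]
  · simp only [Complex.ofReal_im, Complex.conj_im, ← h2, neg_zero]

theorem IsPositive.isPositiveBlock {X : TraceClass (Fock V)} (hX : (toCLM X).IsPositive)
    (N : ℕ) : IsPositiveBlock fun _ _ : Fin N => X := fun ψ => by
  have := hX.inner_nonneg_right (∑ i, ψ i)
  rw [Finset.sum_comm]
  simpa only [map_sum, sum_inner, inner_sum] using this

theorem isPositiveBlock_ketbra {N : ℕ} (φ : Fin N → Fock V) :
    IsPositiveBlock fun i j => ketbra (φ i) (φ j) := by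
  intro ψ
  have : ∑ i, ∑ j, inner ℂ (ψ i) (toCLM (ketbra (φ i) (φ j)) (ψ j)) =
      starRingEnd ℂ (∑ i, inner ℂ (φ i) (ψ i)) * ∑ j, inner ℂ (φ j) (ψ j) := by
    rw [map_sum, Finset.sum_mul_sum]
    simp [toCLM_ketbra_apply, mul_comm]
  rw [this, mul_comm, Complex.mul_conj]
  exact_mod_cast Complex.normSq_nonneg _

theorem isPositive_ketbra (φ : Fock V) : (toCLM (ketbra φ φ)).IsPositive :=
  isPositive_of_isPositiveBlock (isPositiveBlock_ketbra fun _ => φ)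

theorem IsPositive.norm_inner_le {X : TraceClass (Fock V)} (hX : (toCLM X).IsPositive)
    (e f : Fock V) :
    ‖inner ℂ e (toCLM X f)‖ ≤ ((inner ℂ e (toCLM X e)).re + (inner ℂ f (toCLM X f)).re) / 2 := by
  exact (IsPositive.isPositiveBlock hX 2).norm_inner_le e f

theorem IsPositiveBlock.norm_le {X : Fin 2 → Fin 2 → TraceClass (Fock V)}
    (hX : IsPositiveBlock X) (h0 : (toCLM (X 0 0)).IsPositive) (h1 : (toCLM (X 1 1)).IsPositive) :
    ‖X 0 1‖ ≤ ((trace (X 0 0)).re + (trace (X 1 1)).re) / 2 := by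
  have key : ∀ (N : ℕ) (e f : Fin N → Fock V), Orthonormal ℂ e → Orthonormal ℂ f →
      ∑ i, ‖inner ℂ (e i) (toCLM (X 0 1) (f i))‖ ≤
        ((trace (X 0 0)).re + (trace (X 1 1)).re) / 2 := by
    intro N e f he hf
    refine (Finset.sum_le_sum fun i _ => hX.norm_inner_le (e i) (f i)).trans ?_
    rw [← Finset.sum_div, Finset.sum_add_distrib]
    have := sum_inner_le_trace h0 he
    have := sum_inner_le_trace h1 hf
    linarith
  refine TraceClass.norm_le ?_ key
  simpa using key 0 Fin.elim0 Fin.elim0 ⟨fun i => i.elim0, fun i => i.elim0⟩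
    ⟨fun i => i.elim0, fun i => i.elim0⟩

theorem IsPositive.norm_le_trace {X : TraceClass (Fock V)} (hX : (toCLM X).IsPositive) :
    ‖X‖ ≤ (trace X).re := by
  have h := (IsPositive.isPositiveBlock hX 2).norm_le hX hX
  linarith

/-! ### Completely positive maps -/

namespace IsCompletelyPositive

theorem isPositive {Φ : TraceClass (Fock V) →L[ℂ] TraceClass (Fock V)}
    (hΦ : IsCompletelyPositive Φ) {X : TraceClass (Fock V)} (hX : (toCLM X).IsPositive) :
    (toCLM (Φ X)).IsPositive :=
  isPositive_of_isPositiveBlock (hΦ 1 _ (IsPositive.isPositiveBlock hX 1))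

theorem norm_inner_ketbra_le {Φ : TraceClass (Fock V) →L[ℂ] TraceClass (Fock V)}
    (hΦ : IsCompletelyPositive Φ) (x y e f : Fock V) :
    ‖inner ℂ e (toCLM (Φ (ketbra x y)) f)‖ ≤
      ((inner ℂ e (toCLM (Φ (ketbra x x)) e)).re +
        (inner ℂ f (toCLM (Φ (ketbra y y)) f)).re) / 2 := by
  simpa using (hΦ 2 _ (isPositiveBlock_ketbra ![x, y])).norm_inner_le e f

/-- A completely positive map is bounded by its norm on pure states. -/
theorem norm_apply_le {Φ : TraceClass (Fock V) →L[ℂ] TraceClass (Fock V)}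
    (hΦ : IsCompletelyPositive Φ) {c : ℝ}
    (h : ∀ x, ‖x‖ = 1 → (trace (Φ (ketbra x x))).re ≤ c) (X : TraceClass (Fock V)) :
    ‖Φ X‖ ≤ c * ‖X‖ := by
  -- Complete positivity of order two, applied to the positive block with entries `|x_i⟩⟨x_j|`,
  -- controls `Φ (|x⟩⟨y|)` by the traces of `Φ` on the two pure states.
  have h1 : ∀ x y, ‖x‖ = 1 → ‖y‖ = 1 → ‖Φ (ketbra x y)‖ ≤ c := by
    intro x y hx hy
    have h2 := (hΦ 2 _ (isPositiveBlock_ketbra ![x, y])).norm_le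
      (hΦ.isPositive (isPositive_ketbra x)) (hΦ.isPositive (isPositive_ketbra y))
    simp only [Matrix.cons_val_zero, Matrix.cons_val_one] at h2
    have := h x hx
    have := h y hy
    linarith
  have hc : 0 ≤ c := (norm_nonneg _).trans (h1 (ket 0) (ket 0) (norm_ket _) (norm_ket _))
  refine denseRange_toTraceClass.induction_on X
    (isClosed_le (by fun_prop) (by fun_prop)) fun x => ?_
  -- An element of `𝒯_f` vanishes off a finite-dimensional space, so it is a sum of rank-one
  -- operators with unit vectors and total weight at most its trace norm. No positivity of the
  -- element is used.
  let B : Submodule ℂ (Fock V) :=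
    Submodule.span ℂ ((fun p : (V → ℕ) × (V → ℕ) => (ket p.2 : Fock V)) '' x.support)
  have hB : FiniteDimensional ℂ B :=
    FiniteDimensional.span_of_finite ℂ (x.support.finite_toSet.image _)
  obtain ⟨n, a, b, s, ha, hb, hs, hsum, hle⟩ := exists_eq_sum_ketbra x.toTraceClass B fun z hz => by
    simp only [FinOp.toTraceClass, Finsupp.linearCombination_apply, Finsupp.sum, map_sum, map_smul,
      sum_apply, smul_apply, toCLM_ketbra_apply]
    refine Finset.sum_eq_zero fun p hp => ?_
    rw [(Submodule.mem_orthogonal B z).1 hz _ (Submodule.subset_span ⟨p, hp, rfl⟩), zero_smul,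
      smul_zero]
  calc ‖Φ x.toTraceClass‖ = ‖∑ j, (s j : ℂ) • Φ (ketbra (a j) (b j))‖ := by
        conv_lhs => rw [hsum]
        simp
    _ ≤ ∑ j, s j * c := by
        refine (norm_sum_le _ _).trans (Finset.sum_le_sum fun j _ => ?_)
        rw [norm_smul, Complex.norm_real, Real.norm_of_nonneg (hs j).le]
        exact mul_le_mul_of_nonneg_left (h1 _ _ (ha j) (hb j)) (hs j).le
    _ ≤ c * ‖x.toTraceClass‖ := by
        rw [← Finset.sum_mul, mul_comm]
        exact mul_le_mul_of_nonneg_left hle hc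

theorem one : IsCompletelyPositive (1 : TraceClass (Fock V) →L[ℂ] TraceClass (Fock V)) :=
  fun _ _ hX => hX

theorem zero : IsCompletelyPositive (0 : TraceClass (Fock V) →L[ℂ] TraceClass (Fock V)) :=
  fun _ _ _ _ => by simp

theorem add {Φ Ψ : TraceClass (Fock V) →L[ℂ] TraceClass (Fock V)}
    (hΦ : IsCompletelyPositive Φ) (hΨ : IsCompletelyPositive Ψ) :
    IsCompletelyPositive (Φ + Ψ) := fun N X hX ψ => by
  have := add_nonneg (hΦ N X hX ψ) (hΨ N X hX ψ)
  simpa only [add_apply, map_add, inner_add_right, Finset.sum_add_distrib] using this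

theorem sum {ι : Type*} (s : Finset ι) {Φ : ι → TraceClass (Fock V) →L[ℂ] TraceClass (Fock V)}
    (hΦ : ∀ i, IsCompletelyPositive (Φ i)) : IsCompletelyPositive (∑ i ∈ s, Φ i) := by
  classical
  induction s using Finset.induction_on with
  | empty => simpa using zero
  | insert i s hi ih => rw [Finset.sum_insert hi]; exact (hΦ i).add ih

theorem smul {Φ : TraceClass (Fock V) →L[ℂ] TraceClass (Fock V)}
    (hΦ : IsCompletelyPositive Φ) {c : ℝ} (hc : 0 ≤ c) :
    IsCompletelyPositive ((c : ℂ) • Φ) := fun N X hX ψ => by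
  have h := mul_nonneg (Complex.zero_le_real.2 hc) (hΦ N X hX ψ)
  simpa only [smul_apply, map_smul, inner_smul_right, Finset.mul_sum] using h

theorem mul {Φ Ψ : TraceClass (Fock V) →L[ℂ] TraceClass (Fock V)}
    (hΦ : IsCompletelyPositive Φ) (hΨ : IsCompletelyPositive Ψ) :
    IsCompletelyPositive (Φ * Ψ) := fun N X hX => hΦ N _ (hΨ N X hX)

theorem pow {Φ : TraceClass (Fock V) →L[ℂ] TraceClass (Fock V)}
    (hΦ : IsCompletelyPositive Φ) (n : ℕ) : IsCompletelyPositive (Φ ^ n) := by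
  induction n with
  | zero => simpa using one
  | succ n ih => rw [pow_succ]; exact ih.mul hΦ

theorem conjMap (A : Fock V →L[ℂ] Fock V) : IsCompletelyPositive (TraceClass.conjMap A A) := by
  intro N X hX ψ
  have := hX fun i => ContinuousLinearMap.adjoint A (ψ i)
  simpa only [toCLM_conjMap, ContinuousLinearMap.comp_apply,
    ← ContinuousLinearMap.adjoint_inner_left] using this

theorem of_tendsto {ι : Type*} {l : Filter ι} [l.NeBot]
    {Φ : ι → TraceClass (Fock V) →L[ℂ] TraceClass (Fock V)}
    {Ψ : TraceClass (Fock V) →L[ℂ] TraceClass (Fock V)} (hΦ : ∀ i, IsCompletelyPositive (Φ i))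
    (h : ∀ X, Filter.Tendsto (fun i => Φ i X) l (𝓝 (Ψ X))) : IsCompletelyPositive Ψ := by
  intro N X hX ψ
  refine ge_of_tendsto' (f := fun k => ∑ i, ∑ j, inner ℂ (ψ i) (toCLM (Φ k (X i j)) (ψ j)))
    (x := l) ?_ fun k => hΦ k N X hX ψ
  refine tendsto_finsetSum _ fun i _ => tendsto_finsetSum _ fun j _ => ?_
  have hc : Continuous fun Y : TraceClass (Fock V) => inner ℂ (ψ i) (toCLM Y (ψ j)) :=
    (innerSL ℂ (ψ i) ∘L ContinuousLinearMap.apply ℂ (Fock V) (ψ j) ∘L toCLMₗ (Fock V)).continuous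
  exact (hc.tendsto _).comp (h _)

end IsCompletelyPositive

end FockTrace

/-! ### Exponentials of bounded operators -/

section Exponential

variable {F : Type*} [NormedAddCommGroup F] [NormedSpace ℂ F] [CompleteSpace F]

/-- The semigroup `t ↦ exp (t G)` generated by a bounded operator `G`. -/
def expSemigroup (G : F →L[ℂ] F) (t : ℝ) : F →L[ℂ] F := NormedSpace.exp (t • G)

@[simp] theorem expSemigroup_zero (G : F →L[ℂ] F) : expSemigroup G 0 = 1 := by
  simp [expSemigroup]

theorem expSemigroup_add (G : F →L[ℂ] F) (s t : ℝ) :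
    expSemigroup G (s + t) = expSemigroup G s * expSemigroup G t := by
  let _ : NormedAlgebra ℚ (F →L[ℂ] F) := NormedAlgebra.restrictScalars ℚ ℝ _
  rw [expSemigroup, add_smul]
  exact NormedSpace.exp_add_of_commute (((Commute.refl G).smul_left s).smul_right t)

theorem expSemigroup_nat_mul (G : F →L[ℂ] F) (n : ℕ) (t : ℝ) :
    expSemigroup G (n * t) = expSemigroup G t ^ n := by
  induction n with
  | zero => simp
  | succ n ih =>
    rw [Nat.cast_succ, add_mul, one_mul, expSemigroup_add, ih, pow_succ]

theorem commute_expSemigroup {G Q : F →L[ℂ] F} (h : Commute Q G) (t : ℝ) :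
    Commute Q (expSemigroup G t) :=
  (h.smul_right t).exp_right

theorem hasDerivAt_expSemigroup (G : F →L[ℂ] F) (t : ℝ) :
    HasDerivAt (expSemigroup G) (expSemigroup G t * G) t :=
  hasDerivAt_exp_smul_const G t

theorem continuous_expSemigroup (G : F →L[ℂ] F) : Continuous (expSemigroup G) :=
  continuous_iff_continuousAt.2 fun t => (hasDerivAt_expSemigroup G t).continuousAt

theorem hasDerivAt_expSemigroup_apply (G : F →L[ℂ] F) (X : F) (t : ℝ) :
    HasDerivAt (fun s => expSemigroup G s X) (expSemigroup G t (G X)) t :=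
  ((ContinuousLinearMap.apply ℂ F X).restrictScalars ℝ).hasFDerivAt.comp_hasDerivAt t
    (hasDerivAt_expSemigroup G t)

theorem expSemigroup_apply_comm (G : F →L[ℂ] F) (X : F) (t : ℝ) :
    expSemigroup G t (G X) = G (expSemigroup G t X) :=
  DFunLike.congr_fun (commute_expSemigroup (Commute.refl G) t).symm.eq X

theorem hasDerivAt_expSemigroup_apply' (G : F →L[ℂ] F) (X : F) (t : ℝ) :
    HasDerivAt (fun s => expSemigroup G s X) (G (expSemigroup G t X)) t := by
  rw [← expSemigroup_apply_comm]
  exact hasDerivAt_expSemigroup_apply G X t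

theorem apply_expSemigroup_of_comp_eq_zero {F' : Type*} [NormedAddCommGroup F'] [NormedSpace ℂ F']
    {G : F →L[ℂ] F} {ξ : F →L[ℂ] F'} (h : ξ ∘L G = 0) (X : F) (t : ℝ) :
    ξ (expSemigroup G t X) = ξ X := by
  have hd : ∀ s, HasDerivAt (fun s => ξ (expSemigroup G s X)) 0 s := fun s => by
    have h1 := (ξ.restrictScalars ℝ).hasFDerivAt.comp_hasDerivAt s
      (hasDerivAt_expSemigroup_apply' G X s)
    have h2 : ξ (G (expSemigroup G s X)) = 0 := DFunLike.congr_fun h _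
    exact h1.congr_deriv h2
  have := is_const_of_deriv_eq_zero (fun s => (hd s).differentiableAt) (fun s => (hd s).deriv) t 0
  simpa using this

/-- Telescoping: the factors `a` are exchanged for `b` one at a time. The trailing `b ^ j` makes the
induction on `k` close; the case `j = 0` is the one of interest. -/
theorem norm_pow_mul_sub_pow_le {R : Type*} [NormedRing R] {a b : R} {n : ℕ} {C C' : ℝ}
    (hC : 0 ≤ C) (ha : ∀ i ≤ n, ‖a ^ i‖ ≤ C) (hb : ∀ i ≤ n, ‖b ^ i‖ ≤ C') (k : ℕ) :
    ∀ j, k + j ≤ n → ‖a ^ k * b ^ j - b ^ (k + j)‖ ≤ k * (C * ‖a - b‖ * C') := by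
  induction k with
  | zero => intro j _; simp
  | succ k ih =>
    intro j hj
    have h1 : a ^ (k + 1) * b ^ j - b ^ (k + 1 + j) =
        a ^ k * (a - b) * b ^ j + (a ^ k * b ^ (j + 1) - b ^ (k + (j + 1))) := by
      rw [show k + 1 + j = k + (j + 1) by ring]
      rw [mul_sub, sub_mul, pow_succ, pow_succ']
      simp only [mul_assoc]
      abel
    rw [h1]
    refine (norm_add_le _ _).trans ?_
    have h2 : ‖a ^ k * (a - b) * b ^ j‖ ≤ C * ‖a - b‖ * C' := by
      refine (norm_mul_le _ _).trans ?_
      refine mul_le_mul ((norm_mul_le _ _).trans ?_) (hb j (by lia)) (norm_nonneg _) (by positivity)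
      exact mul_le_mul_of_nonneg_right (ha k (by lia)) (norm_nonneg _)
    have h3 := ih (j + 1) (by lia)
    push_cast
    linarith

/-- Euler's product formula: one step agrees with `exp (t G / n)` up to `o(1/n)`, the powers are
bounded uniformly, and telescoping gives an error `n · o(1/n)`. The second-order term `D` does not
affect the limit; it is there to make each step completely positive. -/
theorem tendsto_pow_expSemigroup (G D : F →L[ℂ] F) {t : ℝ} (ht : 0 ≤ t) :
    Filter.Tendsto (fun n : ℕ => (1 + (t / n) • G + (t / n) ^ 2 • D) ^ n) Filter.atTop
      (𝓝 (expSemigroup G t)) := by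
  set M := t * ‖G‖ + t ^ 2 * ‖D‖ with hM
  have hM0 : 0 ≤ M := by positivity
  obtain ⟨C', hC'⟩ := (isCompact_Icc (a := (0 : ℝ)) (b := t)).exists_bound_of_continuousOn
    (continuous_expSemigroup G).continuousOn
  have hlittle : Filter.Tendsto (fun n : ℕ =>
      (n : ℝ) * ‖(1 + (t / n) • G + (t / n) ^ 2 • D) - expSemigroup G (t / n)‖) Filter.atTop
      (𝓝 0) := by
    rcases ht.eq_or_lt with rfl | htpos
    · simp
    have h0 := hasDerivAt_iff_isLittleO.1 (hasDerivAt_expSemigroup G 0)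
    simp only [sub_zero, expSemigroup_zero, one_mul] at h0
    have hdiv : Filter.Tendsto (fun n : ℕ => t / (n : ℝ)) Filter.atTop (𝓝 0) :=
      tendsto_const_div_atTop_nhds_zero_nat t
    have h1 := h0.comp_tendsto hdiv
    have h2 : Filter.Tendsto (fun n : ℕ => t * (‖expSemigroup G (t / n) - 1 - (t / n) • G‖ / ‖t / (n : ℝ)‖)
        + t * ((t / n) * ‖D‖)) Filter.atTop (𝓝 (t * 0 + t * (0 * ‖D‖))) :=
      ((h1.norm_norm.tendsto_div_nhds_zero).const_mul t).add ((hdiv.mul_const _).const_mul t)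
    simp only [mul_zero, zero_mul, add_zero] at h2
    refine squeeze_zero' (Filter.Eventually.of_forall fun n => by positivity) ?_ h2
    filter_upwards [Filter.eventually_gt_atTop 0] with n hn
    have hn' : (0 : ℝ) < n := by exact_mod_cast hn
    have h3 : (1 + (t / n) • G + (t / n) ^ 2 • D) - expSemigroup G (t / n) =
        (t / n) ^ 2 • D - (expSemigroup G (t / n) - 1 - (t / n) • G) := by abel
    have h4 : ‖(t / (n : ℝ)) ^ 2 • D‖ = (t / n) ^ 2 * ‖D‖ := by
      rw [norm_smul, Real.norm_of_nonneg (by positivity)]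
    rw [h3]
    calc (n : ℝ) * ‖(t / (n : ℝ)) ^ 2 • D - (expSemigroup G (t / n) - 1 - (t / n) • G)‖
        ≤ n * ((t / n) ^ 2 * ‖D‖ + ‖expSemigroup G (t / n) - 1 - (t / n) • G‖) := by
          gcongr
          exact (norm_sub_le _ _).trans (by rw [h4])
      _ = _ := by
          rw [Real.norm_of_nonneg (show 0 ≤ t / (n : ℝ) by positivity)]
          field_simp
          ring
  have hbound : Filter.Tendsto (fun n : ℕ => (n : ℝ) * (Real.exp M *
      ‖(1 + (t / n) • G + (t / n) ^ 2 • D) - expSemigroup G (t / n)‖ * C')) Filter.atTop (𝓝 0) := by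
    have := (hlittle.const_mul (Real.exp M)).mul_const C'
    simp only [mul_zero, zero_mul] at this
    refine this.congr fun n => by ring
  refine tendsto_iff_norm_sub_tendsto_zero.2 (squeeze_zero' (Filter.Eventually.of_forall fun n =>
    norm_nonneg _) ?_ hbound)
  filter_upwards [Filter.eventually_gt_atTop 0] with n hn
  have hn' : (0 : ℝ) < n := by exact_mod_cast hn
  have hb : expSemigroup G t = expSemigroup G (t / n) ^ n := by
    rw [← expSemigroup_nat_mul]
    congr 1
    field_simp
  have ha1 : ‖1 + (t / n) • G + (t / n) ^ 2 • D‖ ≤ 1 + M / n := by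
    refine (norm_add₃_le).trans ?_
    rw [norm_smul, norm_smul, Real.norm_of_nonneg (by positivity), Real.norm_of_nonneg (by positivity)]
    have h1 : ‖(1 : F →L[ℂ] F)‖ ≤ 1 := ContinuousLinearMap.norm_id_le
    have h2 : (t / n) ^ 2 * ‖D‖ ≤ t ^ 2 * ‖D‖ / n := by
      rw [div_pow, div_mul_eq_mul_div]
      refine div_le_div_of_nonneg_left (by positivity) hn' ?_
      have : (1 : ℝ) ≤ n := by exact_mod_cast hn
      nlinarith
    have h3 : M / n = t / n * ‖G‖ + t ^ 2 * ‖D‖ / n := by rw [hM]; ring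
    rw [h3]
    linarith
  have key := norm_pow_mul_sub_pow_le (a := 1 + (t / n) • G + (t / n) ^ 2 • D)
    (b := expSemigroup G (t / n)) (n := n) (C := Real.exp M) (C' := C') (Real.exp_pos _).le
    (fun i hi => ?_) (fun i hi => ?_) n 0 (by lia)
  · rw [hb]
    simpa using key
  · have h1 : ‖(1 + (t / n) • G + (t / n) ^ 2 • D) ^ i‖ ≤ (1 + M / n) ^ i := by
      rcases Nat.eq_zero_or_pos i with rfl | hi0
      · rw [pow_zero, pow_zero]; exact ContinuousLinearMap.norm_id_le
      · exact (norm_pow_le' _ hi0).trans (pow_le_pow_left₀ (norm_nonneg _) ha1 _)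
    have h2 : (1 : ℝ) ≤ 1 + M / n := le_add_of_nonneg_right (by positivity)
    refine h1.trans ((pow_le_pow_right₀ h2 hi).trans ?_)
    have h3 := Real.add_one_le_exp (M / n)
    calc (1 + M / n) ^ n ≤ Real.exp (M / n) ^ n :=
          pow_le_pow_left₀ (by positivity) (by linarith) _
      _ = Real.exp M := by
        rw [← Real.exp_nat_mul]
        congr 1
        field_simp
  · rw [← expSemigroup_nat_mul]
    refine hC' _ ⟨by positivity, ?_⟩
    have : (i : ℝ) ≤ n := by exact_mod_cast hi
    calc (i : ℝ) * (t / n) ≤ n * (t / n) := by gcongr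
      _ = t := by field_simp

end Exponential

/-! ### Lindblad generators with bounded operators -/

section BoundedLindblad

open TraceClass

variable {V : Type*} [Fintype V] [DecidableEq V] {J : Type*} [Fintype J]

/-- The map `X ↦ K X + X K† + ∑ j, L_j X L_j†`. -/
def boundedLindbladian (K : Fock V →L[ℂ] Fock V) (L : J → Fock V →L[ℂ] Fock V) :
    TraceClass (Fock V) →L[ℂ] TraceClass (Fock V) :=
  conjMap K 1 + conjMap 1 K + ∑ j, conjMap (L j) (L j)

theorem boundedLindbladian_ketbra (K : Fock V →L[ℂ] Fock V) (L : J → Fock V →L[ℂ] Fock V)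
    (x y : Fock V) : boundedLindbladian K L (ketbra x y) =
      ketbra (K x) y + ketbra x (K y) + ∑ j, ketbra (L j x) (L j y) := by
  simp [boundedLindbladian, conjMap_ketbra, sum_apply]

variable {K : Fock V →L[ℂ] Fock V} {L : J → Fock V →L[ℂ] Fock V}

/-- With step `h = t / n`, the Euler step corrected by `h² K X K†` is in Kraus form, namely `(1 +
hK) X (1 + hK)† + h ∑ L_j X L_j†`. Powers and strong limits preserve complete positivity. -/
theorem isCompletelyPositive_expSemigroup (K : Fock V →L[ℂ] Fock V)
    (L : J → Fock V →L[ℂ] Fock V) {t : ℝ} (ht : 0 ≤ t) :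
    IsCompletelyPositive (expSemigroup (boundedLindbladian K L) t) := by
  have h1 : ∀ n : ℕ, 1 + (t / n) • boundedLindbladian K L + (t / n) ^ 2 • conjMap K K =
      conjMap (1 + ((t / n : ℝ) : ℂ) • K) (1 + ((t / n : ℝ) : ℂ) • K) +
        ((t / n : ℝ) : ℂ) • ∑ j, conjMap (L j) (L j) := by
    intro n
    refine ext_ketbra_ket fun x y => ?_
    generalize t / (n : ℝ) = h
    simp only [add_apply, smul_apply, one_apply_eq_self, sum_apply, conjMap_ketbra,
      boundedLindbladian_ketbra, ketbra_add_left, ketbra_add_right, ketbra_smul_left,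
      ketbra_smul_right, Complex.conj_ofReal, smul_add, smul_smul, ← Complex.coe_smul,
      Complex.ofReal_mul, sq]
    abel
  refine IsCompletelyPositive.of_tendsto (l := Filter.atTop)
    (Φ := fun n : ℕ => (1 + (t / n) • boundedLindbladian K L + (t / n) ^ 2 • conjMap K K) ^ n)
    (fun n => ?_) fun X => ?_
  · rw [h1]
    refine IsCompletelyPositive.pow (IsCompletelyPositive.add (IsCompletelyPositive.conjMap _) ?_) n
    exact IsCompletelyPositive.smul (IsCompletelyPositive.sum _ fun j =>
      IsCompletelyPositive.conjMap _) (by positivity)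
  · exact ((ContinuousLinearMap.apply ℂ _ X).continuous.tendsto _).comp
      (tendsto_pow_expSemigroup _ (conjMap K K) ht)

/-- The hypothesis is `K + K† + ∑ L_j† L_j = 0` in matrix elements. -/
theorem trace_boundedLindbladian
    (hKL : ∀ n m : V → ℕ, inner ℂ (ket m) (K (ket n)) + inner ℂ (K (ket m)) (ket n) +
      ∑ j, inner ℂ (L j (ket m)) (L j (ket n)) = 0) :
    traceL V ∘L boundedLindbladian K L = 0 :=
  ext_ketbra_ket fun n m => by
    rw [ContinuousLinearMap.comp_apply, boundedLindbladian_ketbra, map_add, map_add, map_sum]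
    simpa only [traceL_apply, trace_ketbra, zero_apply] using hKL n m

theorem trace_expSemigroup
    (hKL : ∀ n m : V → ℕ, inner ℂ (ket m) (K (ket n)) + inner ℂ (K (ket m)) (ket n) +
      ∑ j, inner ℂ (L j (ket m)) (L j (ket n)) = 0) (t : ℝ) (X : TraceClass (Fock V)) :
    trace (expSemigroup (boundedLindbladian K L) t X) = trace X :=
  apply_expSemigroup_of_comp_eq_zero (trace_boundedLindbladian hKL) X t

theorem norm_expSemigroup_apply_le
    (hKL : ∀ n m : V → ℕ, inner ℂ (ket m) (K (ket n)) + inner ℂ (K (ket m)) (ket n) +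
      ∑ j, inner ℂ (L j (ket m)) (L j (ket n)) = 0) {t : ℝ} (ht : 0 ≤ t)
    (X : TraceClass (Fock V)) : ‖expSemigroup (boundedLindbladian K L) t X‖ ≤ ‖X‖ := by
  have := (isCompletelyPositive_expSemigroup K L ht).norm_apply_le (c := 1) (fun x hx => ?_) X
  · simpa using this
  · rw [trace_expSemigroup hKL, trace_ketbra, inner_self_eq_norm_sq_to_K, hx]
    simp

end BoundedLindblad

/-! ### Scalar inequalities -/

section Scalar

/-- With `X = n + 1` this is the product inequality `∏ (1 - (i+1)/X) ≥ 1 - ∑ (i+1)/X` over `i < j`,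
cleared of denominators; the sum of the `i + 1` is `j (j + 1) / 2`. -/
theorem pow_mul_le_descFactorial_mul (n : ℕ) (j : ℕ) (hj : j ≤ n) :
    ((n : ℝ) + 1) ^ j * ((n : ℝ) + 1 - j * (j + 1) / 2) ≤ n.descFactorial j * ((n : ℝ) + 1) := by
  induction j with
  | zero => simp
  | succ j ih =>
    have ih := ih (by lia)
    have hX : (0 : ℝ) < (n : ℝ) + 1 := by positivity
    have hjn : (j : ℝ) + 1 ≤ n := by exact_mod_cast hj
    -- If the new bracket is nonpositive there is nothing to prove. Otherwise all brackets are
    -- positive and the inductive bound can be multiplied by `n - j`.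
    rcases le_or_gt ((n : ℝ) + 1 - ((j + 1 : ℕ) : ℝ) * (((j + 1 : ℕ) : ℝ) + 1) / 2) 0 with h | h
    · exact (mul_nonpos_of_nonneg_of_nonpos (by positivity) h).trans (by positivity)
    · rw [Nat.descFactorial_succ, Nat.cast_mul, Nat.cast_sub (by lia)]
      push_cast at h ⊢
      calc ((n : ℝ) + 1) ^ (j + 1) * ((n : ℝ) + 1 - (j + 1) * (j + 1 + 1) / 2)
          = ((n : ℝ) + 1) ^ j * (((n : ℝ) + 1) * ((n : ℝ) + 1 - (j + 1) * (j + 1 + 1) / 2)) := by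
            ring
        _ ≤ ((n : ℝ) + 1) ^ j * ((n - j) * ((n : ℝ) + 1 - j * (j + 1) / 2)) := by
            refine mul_le_mul_of_nonneg_left ?_ (by positivity)
            have : (0 : ℝ) ≤ (j + 1) * (j * (j + 1) / 2) := by positivity
            nlinarith
        _ = (n - j) * (((n : ℝ) + 1) ^ j * ((n : ℝ) + 1 - j * (j + 1) / 2)) := by ring
        _ ≤ (n - j) * (n.descFactorial j * ((n : ℝ) + 1)) := by
            gcongr
            linarith
        _ = _ := by ring

/-- The rate `n! / (n-ℓ)!` is at least `X^ℓ (1 - ℓ(ℓ+1)/(2X))`, and the drop of `X^k` under the loss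
of `ℓ` photons is at least `ℓ X^(k-1)`. The correction is the source of the summand `(ℓ + 1) ℓ` of
`cConst`. -/
theorem descFactorial_mul_sub_ge {k : ℝ} (hk : 1 ≤ k) {ℓ : ℕ} (hℓ : 1 ≤ ℓ) (n : ℕ) :
    ℓ * ((n : ℝ) + 1) ^ ((ℓ : ℝ) + k - 1) -
        ℓ / 2 * (((ℓ : ℝ) + 1) * ℓ) * ((n : ℝ) + 1) ^ ((ℓ : ℝ) + k - 1 - 1) ≤
      n.descFactorial ℓ * (((n : ℝ) + 1) ^ k - (((n - ℓ : ℕ) : ℝ) + 1) ^ k) := by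
  set X : ℝ := (n : ℝ) + 1 with hX
  have hX0 : 0 < X := by positivity
  have hℓ' : (1 : ℝ) ≤ ℓ := by exact_mod_cast hℓ
  have hsplit : X ^ ((ℓ : ℝ) + k - 1) = X ^ ((ℓ : ℝ) + k - 1 - 1) * X := by
    rw [← Real.rpow_add_one hX0.ne']
    congr 1
    ring
  have hfac : ℓ * X ^ ((ℓ : ℝ) + k - 1) - ℓ / 2 * (((ℓ : ℝ) + 1) * ℓ) * X ^ ((ℓ : ℝ) + k - 1 - 1)
      = ℓ * X ^ ((ℓ : ℝ) + k - 1 - 1) * (X - ℓ * (ℓ + 1) / 2) := by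
    rw [hsplit]; ring
  rw [hfac]
  rcases lt_or_ge n ℓ with h | h
  -- Below `ℓ` photons no loss occurs, and the left side is nonpositive because `X ≤ ℓ ≤ ℓ (ℓ + 1) /
  -- 2`.
  · rw [Nat.descFactorial_eq_zero_iff_lt.2 h, Nat.cast_zero, zero_mul]
    refine mul_nonpos_of_nonneg_of_nonpos (by positivity) ?_
    have : X ≤ ℓ := by rw [hX]; exact_mod_cast h
    nlinarith
  · have hsub : ((n - ℓ : ℕ) : ℝ) + 1 = X - ℓ := by rw [Nat.cast_sub h, hX]; ring
    have hXℓ : (ℓ : ℝ) ≤ X := by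
      have : (ℓ : ℝ) ≤ n := by exact_mod_cast h
      linarith
    rw [hsub]
    have hd : ℓ * X ^ (k - 1) ≤ X ^ k - (X - ℓ) ^ k := by
      have h1 : (X - ℓ) ^ k ≤ X ^ (k - 1) * (X - ℓ) := by
        rcases hXℓ.eq_or_lt with h0 | h0
        · rw [← h0, sub_self, Real.zero_rpow (by linarith), mul_zero]
        · have h2 : 0 < X - ℓ := by linarith
          calc (X - ℓ) ^ k = (X - ℓ) ^ (k - 1) * (X - ℓ) := by
                rw [← Real.rpow_add_one h2.ne', sub_add_cancel]
            _ ≤ X ^ (k - 1) * (X - ℓ) := by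
                gcongr
                linarith
      have h2 : X ^ k = X ^ (k - 1) * X := by rw [← Real.rpow_add_one hX0.ne', sub_add_cancel]
      rw [h2]
      linarith
    have hp := pow_mul_le_descFactorial_mul n ℓ h
    have h3 : X ^ ((ℓ : ℝ) + k - 1 - 1) * X = X ^ ℓ * X ^ (k - 1) := by
      rw [← hsplit, ← Real.rpow_natCast, ← Real.rpow_add hX0]
      congr 1
      ring
    refine le_of_mul_le_mul_right ?_ hX0
    calc ℓ * X ^ ((ℓ : ℝ) + k - 1 - 1) * (X - ℓ * (ℓ + 1) / 2) * X
        = (X ^ ((ℓ : ℝ) + k - 1 - 1) * X) * (ℓ * (X - ℓ * (ℓ + 1) / 2)) := by ring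
      _ = X ^ ℓ * (X - ℓ * (ℓ + 1) / 2) * (ℓ * X ^ (k - 1)) := by rw [h3]; ring
      _ ≤ n.descFactorial ℓ * X * (ℓ * X ^ (k - 1)) := by gcongr
      _ ≤ n.descFactorial ℓ * X * (X ^ k - (X - ℓ) ^ k) := by gcongr
      _ = _ := by ring

theorem add_descFactorial_le (x r : ℕ) :
    ((x + r).descFactorial r : ℝ) ≤ r.factorial * ((x : ℝ) + 1) ^ r := by
  rw [Nat.add_descFactorial_eq_ascFactorial]
  induction r with
  | zero => simp
  | succ r ih =>
    rw [Nat.ascFactorial_succ, Nat.factorial_succ, pow_succ]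
    push_cast
    have h : (x : ℝ) + 1 + r ≤ (r + 1) * (x + 1) := by
      have : (0 : ℝ) ≤ (r : ℝ) * x := by positivity
      nlinarith
    calc ((x : ℝ) + 1 + r) * ((x + 1).ascFactorial r : ℝ)
        ≤ ((r + 1) * (x + 1)) * (r.factorial * ((x : ℝ) + 1) ^ r) := by gcongr
      _ = _ := by ring

/-- Bernoulli's inequality for `y / (y + q) = 1 - q / (y + q)`. -/
theorem rpow_sub_rpow_le {k : ℝ} (hk : 1 ≤ k) {y q : ℝ} (hy : 0 < y) (hq : 0 ≤ q) :
    (y + q) ^ k - y ^ k ≤ k * q * (y + q) ^ (k - 1) := by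
  have hY : 0 < y + q := by linarith
  have hb := one_add_mul_self_le_rpow_one_add (s := -(q / (y + q))) (p := k)
    (by rw [neg_le_neg_iff, div_le_one hY]; linarith) hk
  have h1 : 1 + -(q / (y + q)) = y / (y + q) := by field_simp; ring
  rw [h1, Real.div_rpow hy.le hY.le, le_div_iff₀ (by positivity)] at hb
  have h2 : (y + q) ^ k = (y + q) ^ (k - 1) * (y + q) := by
    rw [← Real.rpow_add_one hY.ne', sub_add_cancel]
  have h3 : (1 + k * -(q / (y + q))) * (y + q) ^ k =
      (y + q) ^ k - k * q * (y + q) ^ (k - 1) := by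
    rw [h2]; field_simp
    ring
  linarith

/-- The matrix elements of `a ^ p (a†) ^ r`, weighted with the increment of `(N + 1) ^ k`. -/
theorem sqrt_descFactorial_mul_sub_le {k : ℝ} (hk : 1 ≤ k) {ℓ : ℕ} (x p q : ℕ)
    (hpq : p + (p + q) + 2 ≤ 2 * ℓ) :
    √(((x + (p + q)).descFactorial (p + q) : ℝ) * ((x + (p + q)).descFactorial p : ℝ)) *
        (((x + q : ℕ) + 1 : ℝ) ^ k - ((x : ℝ) + 1) ^ k) ≤
      √(((p + q).factorial : ℝ) * p.factorial) * (k * q * (1 + q : ℝ) ^ ((k - 1) / 2)) *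
        √(((x : ℝ) + 1) ^ ((ℓ : ℝ) + k - 1 - 1) * ((x + q : ℕ) + 1 : ℝ) ^ ((ℓ : ℝ) + k - 1 - 1)) := by
  set y : ℝ := (x : ℝ) + 1 with hy
  have hY : ((x + q : ℕ) + 1 : ℝ) = y + q := by push_cast; rw [hy]; ring
  rw [hY]
  have hy1 : 1 ≤ y := by rw [hy]; linarith [Nat.cast_nonneg (α := ℝ) x]
  have hy0 : 0 < y := by linarith
  have hq0 : (0 : ℝ) ≤ q := Nat.cast_nonneg q
  have hY0 : 0 < y + q := by linarith
  have hk1 : 0 ≤ k - 1 := by linarith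
  have hYy : y + q ≤ (1 + q) * y := by nlinarith
  have hw : √(y ^ ((ℓ : ℝ) + k - 1 - 1) * (y + q) ^ ((ℓ : ℝ) + k - 1 - 1)) =
      √((y * (y + q)) ^ (ℓ - 1)) * (y * (y + q)) ^ ((k - 1) / 2) := by
    rw [← Real.mul_rpow hy0.le hY0.le, Real.sqrt_eq_rpow, Real.sqrt_eq_rpow,
      ← Real.rpow_natCast, ← Real.rpow_mul (by positivity), ← Real.rpow_mul (by positivity),
      ← Real.rpow_add (by positivity), Nat.cast_sub (by lia)]
    congr 1
    push_cast
    ring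
  have h1 : ((x + (p + q)).descFactorial (p + q) : ℝ) * ((x + (p + q)).descFactorial p : ℝ) ≤
      ((p + q).factorial : ℝ) * p.factorial * (y * (y + q)) ^ (ℓ - 1) := by
    have e1 := add_descFactorial_le x (p + q)
    have e2 := add_descFactorial_le (x + q) p
    rw [show x + q + p = x + (p + q) by ring, hY] at e2
    -- The exponents balance to `(2p + q) / 2 ≤ ℓ - 1` on each of `y` and `y + q`; squaring avoids
    -- half-integer powers.
    have e3 : y ^ (p + q) * (y + q) ^ p ≤ (y * (y + q)) ^ (ℓ - 1) := by
      have hring : ∀ a b : ℝ, (a ^ (p + q) * b ^ p) ^ 2 = (a * b) ^ (2 * p) * (a * a) ^ q := by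
        intro a b
        ring
      refine (sq_le_sq₀ (by positivity) (by positivity)).1 ?_
      calc (y ^ (p + q) * (y + q) ^ p) ^ 2 = (y * (y + q)) ^ (2 * p) * (y * y) ^ q := hring _ _
        _ ≤ (y * (y + q)) ^ (2 * p) * (y * (y + q)) ^ q := by
          gcongr
          linarith
        _ = (y * (y + q)) ^ (2 * p + q) := by rw [pow_add]
        _ ≤ (y * (y + q)) ^ ((ℓ - 1) * 2) := by
          refine pow_le_pow_right₀ ?_ (by lia)
          nlinarith
        _ = _ := by rw [pow_mul]
    calc _ ≤ ((p + q).factorial * y ^ (p + q)) * (p.factorial * (y + q) ^ p) := by gcongr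
      _ = ((p + q).factorial : ℝ) * p.factorial * (y ^ (p + q) * (y + q) ^ p) := by ring
      _ ≤ _ := by gcongr
  -- Half of the power of `y + q` is traded for a power of `y` at the price `(1 + q)^((k-1)/2)`. The
  -- symmetric weight `√(w(x) w(y))` is the one that pairs with an off-diagonal matrix element of a
  -- positive operator.
  have h2 : (y + q) ^ k - y ^ k ≤
      k * q * (1 + q : ℝ) ^ ((k - 1) / 2) * (y * (y + q)) ^ ((k - 1) / 2) := by
    refine (rpow_sub_rpow_le hk hy0 hq0).trans ?_
    rw [mul_assoc (k * (q : ℝ))]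
    refine mul_le_mul_of_nonneg_left ?_ (by positivity)
    calc (y + q) ^ (k - 1) = (y + q) ^ ((k - 1) / 2) * (y + q) ^ ((k - 1) / 2) := by
          rw [← Real.rpow_add hY0]; congr 1; ring
      _ ≤ ((1 + q) * y) ^ ((k - 1) / 2) * (y + q) ^ ((k - 1) / 2) := by gcongr
      _ = _ := by
        rw [Real.mul_rpow (by positivity) hy0.le, Real.mul_rpow hy0.le hY0.le]; ring
  have h3 : 0 ≤ (y + q) ^ k - y ^ k :=
    sub_nonneg.2 (Real.rpow_le_rpow hy0.le (by linarith) (by linarith))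
  rw [hw]
  calc _ ≤ √(((p + q).factorial : ℝ) * p.factorial * (y * (y + q)) ^ (ℓ - 1)) *
        (k * q * (1 + q : ℝ) ^ ((k - 1) / 2) * (y * (y + q)) ^ ((k - 1) / 2)) := by
        gcongr
    _ = _ := by
      rw [Real.sqrt_mul (by positivity)]
      ring

theorem dissipation_const_le {k : ℝ} (hk : 1 ≤ k) {ℓ : ℕ} (hℓ : 2 ≤ ℓ) :
    k * ℓ * (1 + ℓ : ℝ) ^ ((k - 1) / 2) ≤ k * ℓ * (ℓ : ℝ) ^ (k - 1) := by
  have hℓ' : (2 : ℝ) ≤ ℓ := by exact_mod_cast hℓ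
  refine mul_le_mul_of_nonneg_left ?_ (by positivity)
  calc (1 + ℓ : ℝ) ^ ((k - 1) / 2) ≤ ((ℓ : ℝ) ^ (2 : ℝ)) ^ ((k - 1) / 2) := by
        refine Real.rpow_le_rpow (by positivity) ?_ (by linarith)
        norm_cast
        nlinarith
    _ = _ := by rw [← Real.rpow_mul (by positivity)]; congr 1; ring

/-- Put `L = 2ℓ`. Here `(p+q)! p!` divides `(2p+q)!`, which is at most `(L-2)!`, so passing to
`√(L!)` gains a factor `L - 1` that pays for `q`. The factor `k` is paid by `k ≤ 2 L^((k-1)/2)`,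
which is Bernoulli's `1 + k ≤ 2^k` together with `4 ≤ L`. -/
theorem hamiltonian_const_le {k : ℝ} (hk : 1 ≤ k) {ℓ : ℕ} {p q : ℕ}
    (hpq : p + (p + q) + 2 ≤ 2 * ℓ) :
    2 * (√(((p + q).factorial : ℝ) * p.factorial) * (k * q * (1 + q : ℝ) ^ ((k - 1) / 2))) ≤
      ℓ / 2 * ((2 * (ℓ : ℝ)) ^ k * √((2 * ℓ).factorial : ℝ)) := by
  rcases Nat.eq_zero_or_pos q with rfl | hq
  · simp only [Nat.cast_zero, mul_zero, zero_mul]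
    positivity
  have hℓ : 2 ≤ ℓ := by lia
  set L : ℝ := 2 * (ℓ : ℝ) with hL
  have hL4 : 4 ≤ L := by
    have : (2 : ℝ) ≤ ℓ := by exact_mod_cast hℓ
    linarith
  have hqL : (q : ℝ) ≤ L - 2 := by
    have : (q : ℝ) + 2 ≤ 2 * ℓ := by exact_mod_cast (by lia : q + 2 ≤ 2 * ℓ)
    linarith
  have hf : √(((p + q).factorial : ℝ) * p.factorial) * (L - 1) ≤ √((2 * ℓ).factorial : ℝ) := by
    rw [← Real.sqrt_sq (by linarith : 0 ≤ L - 1), ← Real.sqrt_mul (by positivity)]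
    refine Real.sqrt_le_sqrt ?_
    obtain ⟨s, hs⟩ : ∃ s, 2 * ℓ = s + 2 := ⟨2 * ℓ - 2, by lia⟩
    have h1 : ((p + q).factorial : ℝ) * p.factorial ≤ s.factorial := by
      have h2 : (p + q).factorial * p.factorial ≤ s.factorial :=
        (Nat.le_of_dvd (Nat.factorial_pos _) (Nat.factorial_mul_factorial_dvd_factorial_add _ _)).trans
          (Nat.factorial_le (by lia))
      exact_mod_cast h2
    have hLs : L = s + 2 := by rw [hL]; exact_mod_cast hs
    rw [hs, Nat.factorial_succ, Nat.factorial_succ]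
    push_cast
    have : (0 : ℝ) < s.factorial := by positivity
    have h0 : (0 : ℝ) ≤ s := by positivity
    calc _ ≤ (s.factorial : ℝ) * (L - 1) ^ 2 := by gcongr
      _ ≤ _ := by rw [hLs]; nlinarith
  have hpow : (1 + q : ℝ) ^ ((k - 1) / 2) ≤ L ^ ((k - 1) / 2) :=
    Real.rpow_le_rpow (by positivity) (by linarith) (by linarith)
  have hk2 : k ≤ 2 * L ^ ((k - 1) / 2) := by
    have h1 := one_add_mul_self_le_rpow_one_add (s := 1) (p := k) (by norm_num) hk
    have h2 : (2 : ℝ) ^ k = 2 * (4 : ℝ) ^ ((k - 1) / 2) := by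
      rw [show (4 : ℝ) = 2 ^ (2 : ℝ) by norm_num, ← Real.rpow_mul (by norm_num)]
      conv_rhs => rw [← Real.rpow_one_add' (by norm_num) (by ring_nf; linarith)]
      congr 1
      ring
    have h3 : (4 : ℝ) ^ ((k - 1) / 2) ≤ L ^ ((k - 1) / 2) :=
      Real.rpow_le_rpow (by norm_num) hL4 (by linarith)
    norm_num at h1
    linarith
  have hLk : L ^ k = L * (L ^ ((k - 1) / 2) * L ^ ((k - 1) / 2)) := by
    rw [← Real.rpow_add (by linarith), ← Real.rpow_one_add' (by linarith) (by ring_nf; linarith)]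
    congr 1
    ring
  set R := L ^ ((k - 1) / 2)
  have hR : 0 < R := by positivity
  set S := √(((p + q).factorial : ℝ) * p.factorial)
  have hS : 0 ≤ S := Real.sqrt_nonneg _
  rw [hLk, show (ℓ : ℝ) / 2 = L / 4 by rw [hL]; ring]
  calc 2 * (S * (k * q * (1 + q : ℝ) ^ ((k - 1) / 2)))
      ≤ 2 * (S * ((2 * R) * (L - 1) * R)) := by
        have hL1 : 0 ≤ L - 1 := by linarith
        have hqL' : (q : ℝ) ≤ L - 1 := by linarith
        gcongr
    _ = 4 * (R * R) * (S * (L - 1)) := by ring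
    _ ≤ (L / 4 * L) * (R * R) * √((2 * ℓ).factorial : ℝ) := by
        have h4 : 4 ≤ L / 4 * L := by nlinarith
        have hL1 : 0 ≤ L - 1 := by linarith
        gcongr
    _ = _ := by ring

/-- Weighted AM-GM with weights `1/ν` and `(ν-1)/ν`. The two points are scaled so that their
geometric mean is `c X^(ν-1)` and the second arithmetic term is exactly `X^ν`. -/
theorem young_le {c ν X : ℝ} (hc : 0 ≤ c) (hν : 1 < ν) (hX : 0 ≤ X) :
    c * X ^ (ν - 1) - X ^ ν ≤ c ^ ν * ((ν - 1) ^ (ν - 1) / ν ^ ν) := by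
  have hν0 : 0 < ν := by linarith
  have hν1 : 0 < ν - 1 := by linarith
  have h := Real.geom_mean_le_arith_mean2_weighted (w₁ := 1 / ν) (w₂ := (ν - 1) / ν)
    (p₁ := c ^ ν * ((ν - 1) / ν) ^ (ν - 1)) (p₂ := X ^ ν * (ν / (ν - 1)))
    (by positivity) (by positivity) (by positivity) (by positivity) (by field_simp; ring)
  have e1 : (c ^ ν * ((ν - 1) / ν) ^ (ν - 1)) ^ (1 / ν) = c * ((ν - 1) / ν) ^ ((ν - 1) / ν) := by
    rw [Real.mul_rpow (by positivity) (by positivity), ← Real.rpow_mul hc,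
      ← Real.rpow_mul (by positivity), mul_one_div_cancel hν0.ne', Real.rpow_one]
    congr 2
    ring
  have e2 : (X ^ ν * (ν / (ν - 1))) ^ ((ν - 1) / ν) =
      X ^ (ν - 1) * (((ν - 1) / ν) ^ ((ν - 1) / ν))⁻¹ := by
    rw [Real.mul_rpow (by positivity) (by positivity), ← Real.rpow_mul hX,
      ← Real.inv_rpow (by positivity), inv_div]
    congr 2
    field_simp
  have h0 : 0 < ((ν - 1) / ν) ^ ((ν - 1) / ν) := by positivity
  rw [e1, e2] at h
  have e3 : c * ((ν - 1) / ν) ^ ((ν - 1) / ν) *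
      (X ^ (ν - 1) * (((ν - 1) / ν) ^ ((ν - 1) / ν))⁻¹) = c * X ^ (ν - 1) := by
    field_simp
  have e4 : 1 / ν * (c ^ ν * ((ν - 1) / ν) ^ (ν - 1)) =
      c ^ ν * ((ν - 1) ^ (ν - 1) / ν ^ ν) := by
    rw [Real.div_rpow hν1.le hν0.le, show ν ^ ν = ν ^ (ν - 1) * ν by
      rw [← Real.rpow_add_one hν0.ne', sub_add_cancel]]
    field_simp
  have e5 : (ν - 1) / ν * (X ^ ν * (ν / (ν - 1))) = X ^ ν := by field_simp
  rw [e3, e4, e5] at h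
  linarith

end Scalar

/-! ### Finite vectors and operators on them -/

section FiniteVectors

open TraceClass

variable {V : Type*} [Fintype V] [DecidableEq V]

/-- The inclusion of the finite vectors into the Fock space. -/
def vec : FinVec V →ₗ[ℂ] Fock V := Finsupp.linearCombination ℂ ket

@[simp] theorem vec_single (n : V → ℕ) (c : ℂ) : vec (Finsupp.single n c) = c • ket n := by
  simp [vec]

theorem inner_ket_vec (n : V → ℕ) (φ : FinVec V) : inner ℂ (ket n) (vec φ) = φ n := by
  induction φ using Finsupp.induction_linear with
  | zero => simp
  | add φ ψ h h' => simp [h, h']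
  | single m c =>
    rw [vec_single, inner_smul_right, inner_ket_ket]
    by_cases h : n = m <;> simp [h]

theorem inner_vec_ket (n : V → ℕ) (φ : FinVec V) :
    inner ℂ (vec φ) (ket n) = starRingEnd ℂ (φ n) := by
  rw [← inner_ket_vec, inner_conj_symm]

theorem toTraceClass_dyad (φ ψ : FinVec V) :
    (dyad φ ψ).toTraceClass = ketbra (vec φ) (vec ψ) := by
  simp only [dyad, Finsupp.sum, map_sum, toTraceClass_single, vec, Finsupp.linearCombination_apply,
    ← ketbraL_apply, map_smulₛₗ, sum_apply, smul_apply, smul_smul, Finset.smul_sum, RingHom.id_apply]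
  rw [Finset.sum_comm]
  simp only [mul_comm]

theorem toTraceClass_sandwich_single (A B : Module.End ℂ (FinVec V)) (n m : V → ℕ) :
    (sandwich A B (Finsupp.single (n, m) 1)).toTraceClass =
      ketbra (vec (A (Finsupp.single n 1))) (vec (B (Finsupp.single m 1))) := by
  simp [sandwich, toTraceClass_dyad]

/-- The diagonal operator `f(N)` on the finite vectors. -/
def diag (f : (V → ℕ) → ℝ) : Module.End ℂ (FinVec V) :=
  Finsupp.linearCombination ℂ fun n => Finsupp.single n ((f n : ℝ) : ℂ)

theorem diag_single (f : (V → ℕ) → ℝ) (n : V → ℕ) (c : ℂ) :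
    diag f (Finsupp.single n c) = Finsupp.single n (c * f n) := by
  simp [diag]

/-- The moment `tr (f(N) y)`. -/
def mom (f : (V → ℕ) → ℝ) : FinOp V →ₗ[ℂ] ℂ :=
  Finsupp.linearCombination ℂ fun p => if p.1 = p.2 then ((f p.1 : ℝ) : ℂ) else 0

theorem mom_single (f : (V → ℕ) → ℝ) (n m : V → ℕ) (c : ℂ) :
    mom f (Finsupp.single (n, m) c) = if n = m then c * f n else 0 := by
  simp [mom]

theorem mom_dyad (f : (V → ℕ) → ℝ) (φ ψ : FinVec V) :
    mom f (dyad φ ψ) = inner ℂ (vec ψ) (vec (diag f φ)) := by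
  have h : vec (diag f φ) = ∑ n ∈ φ.support, (φ n * f n) • ket n := by
    conv_lhs => rw [← Finsupp.sum_single φ]
    simp only [Finsupp.sum, map_sum, diag_single, vec_single]
  rw [h]
  simp only [dyad, Finsupp.sum, map_sum, mom_single, vec, Finsupp.linearCombination_apply,
    sum_inner, inner_sum, inner_smul_left, inner_smul_right, inner_ket_ket]
  refine Finset.sum_congr rfl fun n _ => ?_
  rw [Finset.mul_sum]
  refine Finset.sum_congr rfl fun m _ => ?_
  by_cases h : n = m
  · simp [h]; ring
  · rw [if_neg h, if_neg (Ne.symm h)]; simp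

theorem mom_one (y : FinOp V) : mom (fun _ => 1) y = trace y.toTraceClass := by
  rw [trace_toTraceClass, mom, Finsupp.linearCombination_apply]
  refine Finsupp.sum_congr fun p _ => ?_
  by_cases h : p.1 = p.2 <;> simp [h]

/-- The matrix element of `a ^ p (a†) ^ r` between the occupation numbers `x` and `y`. -/
def shiftKernel (p r x y : ℕ) : ℝ :=
  if x + r = y + p then √(((x + r).descFactorial r : ℝ) * ((x + r).descFactorial p : ℝ)) else 0

theorem shiftKernel_symm (p r x y : ℕ) : shiftKernel p r x y = shiftKernel r p y x := by
  unfold shiftKernel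
  by_cases h : x + r = y + p
  · rw [if_pos h, if_pos h.symm, h, mul_comm]
  · rw [if_neg h, if_neg (Ne.symm h)]

theorem ann_single (j : V) (n : V → ℕ) (c : ℂ) : ann j (Finsupp.single n c) =
    Finsupp.single (Function.update n j (n j - 1)) (c * ((√(n j : ℝ) : ℝ) : ℂ)) := by
  simp [ann]

theorem cre_single (j : V) (n : V → ℕ) (c : ℂ) : cre j (Finsupp.single n c) =
    Finsupp.single (Function.update n j (n j + 1)) (c * ((√((n j : ℝ) + 1) : ℝ) : ℂ)) := by
  simp [cre]

theorem ann_pow_single (j : V) (p : ℕ) (n : V → ℕ) (c : ℂ) : (ann j ^ p) (Finsupp.single n c) =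
    Finsupp.single (Function.update n j (n j - p))
      (c * ((√((n j).descFactorial p : ℝ) : ℝ) : ℂ)) := by
  induction p with
  | zero => simp
  | succ p ih =>
    rw [pow_succ', Module.End.mul_apply, ih, ann_single]
    congr 1
    · simp [Nat.sub_sub]
    · rw [Function.update_self, mul_assoc, ← Complex.ofReal_mul, ← Real.sqrt_mul (by positivity),
        Nat.descFactorial_succ]
      push_cast
      rw [mul_comm (((n j - p : ℕ)) : ℝ)]

theorem cre_pow_single (j : V) (r : ℕ) (n : V → ℕ) (c : ℂ) : (cre j ^ r) (Finsupp.single n c) =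
    Finsupp.single (Function.update n j (n j + r))
      (c * ((√((n j + r).descFactorial r : ℝ) : ℝ) : ℂ)) := by
  induction r with
  | zero => simp
  | succ r ih =>
    rw [pow_succ', Module.End.mul_apply, ih, cre_single]
    congr 1
    · simp [add_assoc]
    · rw [Function.update_self, mul_assoc, ← Complex.ofReal_mul, ← Real.sqrt_mul (by positivity),
        Nat.add_descFactorial_eq_ascFactorial, Nat.add_descFactorial_eq_ascFactorial,
        Nat.ascFactorial_succ]
      push_cast
      rw [mul_comm ((n j : ℝ) + 1 + r)]
      congr 4
      ring

theorem ann_pow_mul_cre_pow_apply (j : V) (p r : ℕ) (n m : V → ℕ) :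
    (ann j ^ p * cre j ^ r) (Finsupp.single n 1) m =
      if m = Function.update n j (m j) then ((shiftKernel p r (n j) (m j) : ℝ) : ℂ) else 0 := by
  rw [Module.End.mul_apply, cre_pow_single, ann_pow_single, Finsupp.single_apply]
  simp only [Function.update_self, Function.update_idem, one_mul, ← Complex.ofReal_mul]
  rw [← Real.sqrt_mul (by positivity)]
  unfold shiftKernel
  by_cases h1 : m = Function.update n j (m j)
  · rw [if_pos h1]
    by_cases h2 : n j + r = m j + p
    · rw [if_pos h2, if_pos]
      refine Eq.trans ?_ h1.symm
      congr 1
      lia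
    · rw [if_neg h2]
      -- The natural subtraction `n j + r - p` may be truncated here; the coefficient is then a
      -- vanishing falling factorial.
      by_cases h3 : n j + r < p
      · rw [Nat.descFactorial_eq_zero_iff_lt.2 h3]
        simp
      · rw [if_neg]
        · simp
        · intro h4
          have := congrFun h4 j
          rw [Function.update_self] at this
          lia
  · rw [if_neg h1, if_neg]
    rintro rfl
    simp at h1

theorem eq_update_symm {j : V} {n m : V → ℕ} :
    m = Function.update n j (m j) ↔ n = Function.update m j (n j) := by
  constructor <;> intro h <;> funext i <;> by_cases hi : i = j
  · subst hi; simp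
  · have := congrFun h i
    simp [hi] at this ⊢
    exact this.symm
  · subst hi; simp
  · have := congrFun h i
    simp [hi] at this ⊢
    exact this.symm

/-- `B` is a formal adjoint of `A`. -/
def IsFormalAdjoint (A B : Module.End ℂ (FinVec V)) : Prop :=
  ∀ n m, A (Finsupp.single n 1) m = starRingEnd ℂ (B (Finsupp.single m 1) n)

theorem IsFormalAdjoint.inner_eq {A B : Module.End ℂ (FinVec V)} (h : IsFormalAdjoint A B)
    (φ ψ : FinVec V) : inner ℂ (vec ψ) (vec (A φ)) = inner ℂ (vec (B ψ)) (vec φ) := by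
  induction φ using Finsupp.induction_linear with
  | zero => simp
  | add φ φ' h h' => simp only [map_add, inner_add_right, h, h']
  | single n c =>
    induction ψ using Finsupp.induction_linear with
    | zero => simp
    | add ψ ψ' h h' => simp only [map_add, inner_add_left, h, h']
    | single m d =>
      have h1 : ∀ (n : V → ℕ) (c : ℂ), (Finsupp.single n c : FinVec V) = c • Finsupp.single n 1 :=
        fun n c => by simp
      rw [h1 n, h1 m]
      simp only [map_smul, inner_smul_left, inner_smul_right]
      rw [vec_single, vec_single, one_smul, one_smul, inner_ket_vec, inner_vec_ket, h]

theorem isFormalAdjoint_ann_cre (j : V) (p r : ℕ) :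
    IsFormalAdjoint (ann j ^ p * cre j ^ r) (ann j ^ r * cre j ^ p) := by
  intro n m
  rw [ann_pow_mul_cre_pow_apply, ann_pow_mul_cre_pow_apply, shiftKernel_symm]
  by_cases h : m = Function.update n j (m j)
  · rw [if_pos h, if_pos (eq_update_symm.1 h), Complex.conj_ofReal]
  · rw [if_neg h, if_neg fun h' => h (eq_update_symm.2 h'), map_zero]

theorem IsFormalAdjoint.add {A B A' B' : Module.End ℂ (FinVec V)} (h : IsFormalAdjoint A B)
    (h' : IsFormalAdjoint A' B') : IsFormalAdjoint (A + A') (B + B') := fun n m => by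
  simp [h n m, h' n m]

theorem IsFormalAdjoint.sub {A B A' B' : Module.End ℂ (FinVec V)} (h : IsFormalAdjoint A B)
    (h' : IsFormalAdjoint A' B') : IsFormalAdjoint (A - A') (B - B') := fun n m => by
  simp [h n m, h' n m]

theorem IsFormalAdjoint.smul {A B : Module.End ℂ (FinVec V)} (h : IsFormalAdjoint A B) (c : ℂ) :
    IsFormalAdjoint (c • A) (starRingEnd ℂ c • B) := fun n m => by
  simp [h n m]

theorem IsFormalAdjoint.sum {ι : Type*} (s : Finset ι) {A B : ι → Module.End ℂ (FinVec V)}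
    (h : ∀ i, IsFormalAdjoint (A i) (B i)) : IsFormalAdjoint (∑ i ∈ s, A i) (∑ i ∈ s, B i) :=
  fun n m => by
    simp only [LinearMap.sum_apply, Finsupp.finsetSum_apply, map_sum]
    exact Finset.sum_congr rfl fun i _ => h i n m

theorem isFormalAdjoint_one : IsFormalAdjoint (1 : Module.End ℂ (FinVec V)) 1 := fun n m => by
  simp only [Module.End.one_apply, Finsupp.single_apply]
  by_cases h : n = m
  · simp [h]
  · rw [if_neg h, if_neg (Ne.symm h), map_zero]

variable (ℓ d : ℕ) (α : V → ℂ) (lam : V → (Fin 4 → ℕ) → ℂ)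

theorem twoBodyTerm_self (c : (Fin 4 → ℕ) → ℂ) (j : V) : twoBodyTerm d c j j =
    ∑ u ∈ exponents d, (c u • (ann j ^ (u 0 + u 2) * cre j ^ (u 1 + u 3)) +
      starRingEnd ℂ (c u) • (ann j ^ (u 1 + u 3) * cre j ^ (u 0 + u 2))) := by
  unfold twoBodyTerm
  refine Finset.sum_congr rfl fun u _ => ?_
  rw [← pow_add, mul_assoc, ← pow_add, ← pow_add, mul_assoc (ann j ^ (u 3 + u 1)), ← pow_add,
    add_comm (u 3), add_comm (u 2)]

theorem isFormalAdjoint_onSiteHamiltonian :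
    IsFormalAdjoint (onSiteHamiltonian d lam) (onSiteHamiltonian d lam) := by
  refine IsFormalAdjoint.sum _ fun j => ?_
  rw [twoBodyTerm_self]
  refine IsFormalAdjoint.sum _ fun u => ?_
  have h1 := (isFormalAdjoint_ann_cre j (u 0 + u 2) (u 1 + u 3)).smul (lam j u)
  have h2 := (isFormalAdjoint_ann_cre j (u 1 + u 3) (u 0 + u 2)).smul (starRingEnd ℂ (lam j u))
  rw [Complex.conj_conj] at h2
  simpa only [add_comm] using h1.add h2

/-- The jump operator `a_j ^ ℓ - α_j ^ ℓ`. -/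
def jump (j : V) : Module.End ℂ (FinVec V) := ann j ^ ℓ - (α j ^ ℓ) • 1

/-- The formal adjoint of the jump operator. -/
def jumpAdj (j : V) : Module.End ℂ (FinVec V) := cre j ^ ℓ - (starRingEnd ℂ (α j) ^ ℓ) • 1

theorem isFormalAdjoint_jump (j : V) : IsFormalAdjoint (jumpAdj ℓ α j) (jump ℓ α j) := by
  have h1 := isFormalAdjoint_ann_cre j 0 ℓ
  simp only [pow_zero, one_mul, mul_one] at h1
  have h2 := (isFormalAdjoint_one (V := V)).smul (starRingEnd ℂ (α j) ^ ℓ)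
  rw [map_pow, Complex.conj_conj] at h2
  exact h1.sub h2

/-- The non-hermitian Hamiltonian `-i H - ∑ j, L_j† L_j / 2`. -/
def driftOp : Module.End ℂ (FinVec V) :=
  (-Complex.I) • onSiteHamiltonian d lam -
    (1 / 2 : ℂ) • ∑ j, jumpAdj ℓ α j * jump ℓ α j

/-- The form `K x + x K† + ∑ L_j x L_j†` separates the drift, which a truncation has to cut, from
the jumps, which it need not. -/
theorem toTraceClass_lindbladian_single (n m : V → ℕ) :
    (lindbladian ℓ d α lam (Finsupp.single (n, m) 1)).toTraceClass =
      ketbra (vec (driftOp ℓ d α lam (Finsupp.single n 1))) (ket m) +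
      ketbra (ket n) (vec (driftOp ℓ d α lam (Finsupp.single m 1))) +
      ∑ j, ketbra (vec (jump ℓ α j (Finsupp.single n 1)))
        (vec (jump ℓ α j (Finsupp.single m 1))) := by
  have hdiss : photonDissipation ℓ α = ∑ j, dissipator (jump ℓ α j) (jumpAdj ℓ α j) := rfl
  simp only [lindbladian, hamiltonianPart, hdiss, dissipator, LinearMap.add_apply,
    LinearMap.smul_apply, LinearMap.sub_apply, LinearMap.sum_apply, map_add, map_sub, map_smul,
    map_sum, toTraceClass_sandwich_single, driftOp, Module.End.one_apply, vec_single, one_smul,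
    ← ketbraL_apply, map_smulₛₗ, smul_apply, sub_apply, sum_apply, Finset.sum_sub_distrib,
    Finset.smul_sum, map_neg, Complex.conj_I, map_div₀, map_one, map_ofNat,
    Finset.sum_add_distrib, smul_add, smul_sub, neg_neg, neg_smul, neg_apply]
  abel

theorem inner_driftOp (n m : V → ℕ) :
    driftOp ℓ d α lam (Finsupp.single n 1) m =
      -Complex.I * onSiteHamiltonian d lam (Finsupp.single n 1) m -
      1 / 2 * ∑ j, inner ℂ (vec (jump ℓ α j (Finsupp.single m 1)))
        (vec (jump ℓ α j (Finsupp.single n 1))) := by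
  have h : ∀ j, (jumpAdj ℓ α j * jump ℓ α j) (Finsupp.single n 1) m =
      inner ℂ (vec (jump ℓ α j (Finsupp.single m 1))) (vec (jump ℓ α j (Finsupp.single n 1))) := by
    intro j
    rw [← (isFormalAdjoint_jump ℓ α j).inner_eq, vec_single, one_smul, inner_ket_vec]
    rfl
  simp only [driftOp, LinearMap.sub_apply, LinearMap.smul_apply, LinearMap.sum_apply,
    Finsupp.sub_apply, Finsupp.smul_apply, Finsupp.finsetSum_apply, h, smul_eq_mul]

/-- In the sum with `inner_driftOp` the Hamiltonian cancels and minus the full jump term remains,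
which is conservation of the trace; with unequal weights the two combine to a commutator with `H`.
-/
theorem conj_driftOp (n m : V → ℕ) :
    starRingEnd ℂ (driftOp ℓ d α lam (Finsupp.single m 1) n) =
      Complex.I * onSiteHamiltonian d lam (Finsupp.single n 1) m -
      1 / 2 * ∑ j, inner ℂ (vec (jump ℓ α j (Finsupp.single m 1)))
        (vec (jump ℓ α j (Finsupp.single n 1))) := by
  rw [inner_driftOp]
  simp only [map_sub, map_mul, map_neg, Complex.conj_I, neg_neg, map_sum, inner_conj_symm, map_div₀,
    map_one, map_ofNat]
  rw [← isFormalAdjoint_onSiteHamiltonian d lam n m]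

end FiniteVectors

/-! ### The Lyapunov inequality -/

section Lyapunov

open TraceClass

variable {V : Type*} [Fintype V] [DecidableEq V]
variable (ℓ d : ℕ) (α : V → ℂ) (lam : V → (Fin 4 → ℕ) → ℂ)

theorem diag_apply (f : (V → ℕ) → ℝ) (φ : FinVec V) (m : V → ℕ) : diag f φ m = f m * φ m := by
  induction φ using Finsupp.induction_linear with
  | zero => simp
  | add φ ψ h h' => simp [h, h', mul_add]
  | single n c =>
    rw [diag_single, Finsupp.single_apply, Finsupp.single_apply]
    by_cases h : n = m
    · simp [h, mul_comm]
    · simp [h]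

/-- The matrix element of `a_j ^ p (a_j†) ^ r` between Fock basis vectors. -/
def shiftEntry (j : V) (p r : ℕ) (n m : V → ℕ) : ℝ :=
  if m = Function.update n j (m j) then shiftKernel p r (n j) (m j) else 0

theorem ann_pow_mul_cre_pow_apply' (j : V) (p r : ℕ) (n m : V → ℕ) :
    (ann j ^ p * cre j ^ r) (Finsupp.single n 1) m = shiftEntry j p r n m := by
  rw [ann_pow_mul_cre_pow_apply, shiftEntry]
  split_ifs <;> simp

theorem shiftEntry_symm (j : V) (p r : ℕ) (n m : V → ℕ) :
    shiftEntry j p r n m = shiftEntry j r p m n := by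
  unfold shiftEntry
  rw [shiftKernel_symm]
  by_cases h : m = Function.update n j (m j)
  · rw [if_pos h, if_pos (eq_update_symm.1 h)]
  · rw [if_neg h, if_neg fun h' => h (eq_update_symm.2 h')]

theorem ann_pow_apply (j : V) (p : ℕ) (n m : V → ℕ) :
    (ann j ^ p) (Finsupp.single n 1) m = shiftEntry j p 0 n m := by
  rw [← ann_pow_mul_cre_pow_apply', pow_zero, mul_one]

/-- Locality: an operator of mode `j` leaves the occupation of mode `i` unchanged, hence commutes
with every function of `N_i`. -/
theorem shiftEntry_mul_sub_eq_zero {i j : V} (hij : j ≠ i) (p r : ℕ) (n m : V → ℕ) (F : ℕ → ℝ) :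
    shiftEntry j p r n m * (F (m i) - F (n i)) = 0 := by
  unfold shiftEntry
  split_ifs with h
  · rw [h, Function.update_of_ne hij.symm, sub_self, mul_zero]
  · rw [zero_mul]

theorem lindbladian_single (n m : V → ℕ) :
    lindbladian ℓ d α lam (Finsupp.single (n, m) 1) =
      dyad (driftOp ℓ d α lam (Finsupp.single n 1)) (Finsupp.single m 1) +
      dyad (Finsupp.single n 1) (driftOp ℓ d α lam (Finsupp.single m 1)) +
      ∑ j, dyad (jump ℓ α j (Finsupp.single n 1)) (jump ℓ α j (Finsupp.single m 1)) := by
  apply toTraceClass_injective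
  rw [toTraceClass_lindbladian_single]
  simp only [map_add, map_sum, toTraceClass_dyad, vec_single, one_smul]

theorem inner_jump (f : (V → ℕ) → ℝ) (j : V) (n m : V → ℕ) :
    inner ℂ (vec (jump ℓ α j (Finsupp.single m 1)))
        (vec (diag f (jump ℓ α j (Finsupp.single n 1)))) =
      inner ℂ (vec ((ann j ^ ℓ) (Finsupp.single m 1)))
        (vec (diag f ((ann j ^ ℓ) (Finsupp.single n 1)))) -
      α j ^ ℓ * shiftEntry j ℓ 0 m n * f n -
      starRingEnd ℂ (α j ^ ℓ) * shiftEntry j ℓ 0 n m * f m +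
      starRingEnd ℂ (α j ^ ℓ) * α j ^ ℓ * (if m = n then (f n : ℂ) else 0) := by
  simp only [jump, LinearMap.sub_apply, LinearMap.smul_apply, Module.End.one_apply, map_sub,
    map_smul, inner_sub_left, inner_sub_right, inner_smul_left, inner_smul_right, diag_single,
    vec_single, one_mul, one_smul, inner_vec_ket, inner_ket_vec, diag_apply, ann_pow_apply,
    inner_ket_ket, Complex.conj_ofReal]
  by_cases h : m = n
  · simp only [h, if_true]; ring
  · simp only [h, if_false]; ring

/-- Since `a_j^ℓ` maps basis vectors to multiples of distinct basis vectors or to zero, this form is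
diagonal. The constant `c` is later the mean of the two weights, which comes from the anticommutator
in the dissipator. -/
theorem inner_ann_pow (f : (V → ℕ) → ℝ) (c : ℝ) (j : V) (n m : V → ℕ) :
    inner ℂ (vec ((ann j ^ ℓ) (Finsupp.single m 1)))
        (vec (diag f ((ann j ^ ℓ) (Finsupp.single n 1)))) -
      c * inner ℂ (vec ((ann j ^ ℓ) (Finsupp.single m 1)))
        (vec ((ann j ^ ℓ) (Finsupp.single n 1))) =
      if n = m then (((n j).descFactorial ℓ * (f (Function.update n j (n j - ℓ)) - c) : ℝ) : ℂ)
      else 0 := by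
  simp only [ann_pow_single, diag_single, vec_single, inner_smul_left, inner_smul_right, one_mul,
    inner_ket_ket, Complex.conj_ofReal]
  by_cases h : n = m
  · subst h
    have := Real.mul_self_sqrt (Nat.cast_nonneg (α := ℝ) ((n j).descFactorial ℓ))
    simp only [if_true, mul_one]
    rw [← Complex.ofReal_mul, ← Complex.ofReal_mul, ← Complex.ofReal_mul, ← Complex.ofReal_mul,
      ← Complex.ofReal_sub]
    congr 1
    linear_combination (f (Function.update n j (n j - ℓ)) - c) * this
  · rw [if_neg h]
    -- Truncated subtraction would identify levels below `ℓ`, but `a_j^ℓ` annihilates them.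
    by_cases h1 : n j < ℓ
    · simp [Nat.descFactorial_eq_zero_iff_lt.2 h1]
    by_cases h2 : m j < ℓ
    · simp [Nat.descFactorial_eq_zero_iff_lt.2 h2]
    rw [if_neg]
    · simp
    · intro h3
      refine h (funext fun i => ?_)
      have h4 := congrFun h3 i
      by_cases hi : i = j
      · subst hi
        rw [Function.update_self, Function.update_self] at h4
        lia
      · rw [Function.update_of_ne hi, Function.update_of_ne hi] at h4
        exact h4.symm

/-- The three lines are the photon loss, the linear effect of the shift `α`, and the Hamiltonian.
The last two see only the increment `F (m i) - F (n i)`, which costs one power of the occupation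
number compared with `F` itself. -/
theorem mom_lindbladian_single (F : ℕ → ℝ) (i : V) (n m : V → ℕ) :
    mom (fun n => F (n i)) (lindbladian ℓ d α lam (Finsupp.single (n, m) 1)) =
      (if n = m then (((n i).descFactorial ℓ * (F (n i - ℓ) - F (n i)) : ℝ) : ℂ) else 0) +
      (α i ^ ℓ / 2 * (shiftEntry i 0 ℓ n m * (F (m i) - F (n i)) : ℝ) -
        starRingEnd ℂ (α i ^ ℓ) / 2 * (shiftEntry i ℓ 0 n m * (F (m i) - F (n i)) : ℝ)) +
      ∑ u ∈ exponents d, (-Complex.I) *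
        (lam i u * (shiftEntry i (u 0 + u 2) (u 1 + u 3) n m * (F (m i) - F (n i)) : ℝ) +
        starRingEnd ℂ (lam i u) *
          (shiftEntry i (u 1 + u 3) (u 0 + u 2) n m * (F (m i) - F (n i)) : ℝ)) := by
  have hH : onSiteHamiltonian d lam (Finsupp.single n 1) m * ((F (m i) : ℂ) - F (n i)) =
      ∑ u ∈ exponents d,
        (lam i u * (shiftEntry i (u 0 + u 2) (u 1 + u 3) n m * (F (m i) - F (n i)) : ℝ) +
        starRingEnd ℂ (lam i u) *
          (shiftEntry i (u 1 + u 3) (u 0 + u 2) n m * (F (m i) - F (n i)) : ℝ)) := by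
    simp only [onSiteHamiltonian, twoBodyTerm_self, LinearMap.sum_apply, LinearMap.add_apply,
      LinearMap.smul_apply, Finsupp.finsetSum_apply, Finsupp.add_apply, Finsupp.smul_apply,
      ann_pow_mul_cre_pow_apply', smul_eq_mul]
    rw [Finset.sum_mul, Finset.sum_eq_single i]
    · rw [Finset.sum_mul]
      refine Finset.sum_congr rfl fun u _ => ?_
      push_cast
      ring
    · intro j _ hj
      rw [Finset.sum_mul]
      refine Finset.sum_eq_zero fun u _ => ?_
      have h1 := shiftEntry_mul_sub_eq_zero hj (u 0 + u 2) (u 1 + u 3) n m F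
      have h2 := shiftEntry_mul_sub_eq_zero hj (u 1 + u 3) (u 0 + u 2) n m F
      have h1' := congrArg (fun x : ℝ => (x : ℂ)) h1
      have h2' := congrArg (fun x : ℝ => (x : ℂ)) h2
      push_cast at h1' h2'
      linear_combination lam j u * h1' + starRingEnd ℂ (lam j u) * h2'
    · simp
  -- The jump term is compared with the anticommutator, which has the mean weight `(F (m i) + F (n
  -- i)) / 2`. The `|α|²` terms cancel, and each term linear in `α` keeps half the increment.
  have hL : ∑ j, (inner ℂ (vec (jump ℓ α j (Finsupp.single m 1)))
        (vec (diag (fun n => F (n i)) (jump ℓ α j (Finsupp.single n 1)))) -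
      (((F (m i) + F (n i)) / 2 : ℝ) : ℂ) * inner ℂ (vec (jump ℓ α j (Finsupp.single m 1)))
        (vec (jump ℓ α j (Finsupp.single n 1)))) =
      (if n = m then (((n i).descFactorial ℓ * (F (n i - ℓ) - F (n i)) : ℝ) : ℂ) else 0) +
      (α i ^ ℓ / 2 * (shiftEntry i 0 ℓ n m * (F (m i) - F (n i)) : ℝ) -
        starRingEnd ℂ (α i ^ ℓ) / 2 * (shiftEntry i ℓ 0 n m * (F (m i) - F (n i)) : ℝ)) := by
    have hone : ∀ φ : FinVec V, diag (fun _ => 1) φ = φ := fun φ => by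
      ext m; simp [diag_apply]
    have hterm : ∀ j, inner ℂ (vec (jump ℓ α j (Finsupp.single m 1)))
        (vec (diag (fun n => F (n i)) (jump ℓ α j (Finsupp.single n 1)))) -
      (((F (m i) + F (n i)) / 2 : ℝ) : ℂ) * inner ℂ (vec (jump ℓ α j (Finsupp.single m 1)))
        (vec (jump ℓ α j (Finsupp.single n 1))) =
      (if n = m then (((n j).descFactorial ℓ *
        (F ((Function.update n j (n j - ℓ)) i) - F (n i)) : ℝ) : ℂ) else 0) +
      (α j ^ ℓ / 2 * (shiftEntry j 0 ℓ n m * (F (m i) - F (n i)) : ℝ) -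
        starRingEnd ℂ (α j ^ ℓ) / 2 * (shiftEntry j ℓ 0 n m * (F (m i) - F (n i)) : ℝ)) := by
      intro j
      have h1 := inner_jump ℓ α (fun n => F (n i)) j n m
      have h2 := inner_jump ℓ α (fun _ => 1) j n m
      have h3 := inner_ann_pow ℓ (fun n => F (n i)) ((F (m i) + F (n i)) / 2) j n m
      rw [hone, hone] at h2
      rw [h1, h2, shiftEntry_symm j 0 ℓ]
      by_cases h : n = m
      · subst h
        simp only [if_true, sub_self, mul_zero, Complex.ofReal_zero] at h3 ⊢
        push_cast at h3 ⊢
        linear_combination h3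
      · simp only [h, if_false, Ne.symm h] at h3 ⊢
        push_cast at h3 ⊢
        linear_combination h3
    simp only [hterm]
    rw [Finset.sum_eq_single i]
    · simp
    · intro j _ hj
      rw [shiftEntry_mul_sub_eq_zero hj, shiftEntry_mul_sub_eq_zero hj,
        Function.update_of_ne hj.symm]
      simp
    · simp
  rw [Finset.sum_sub_distrib, ← Finset.mul_sum] at hL
  rw [lindbladian_single, map_add, map_add, map_sum]
  simp only [mom_dyad, diag_single, vec_single, one_mul, one_smul, inner_ket_vec, diag_apply,
    inner_smul_right, inner_vec_ket]
  rw [inner_driftOp, conj_driftOp, ← hL, ← Finset.mul_sum, ← hH]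
  push_cast
  ring

end Lyapunov

/-! ### Estimates of the commutator terms and the Lyapunov inequality for one mode -/

section LyapunovBound

open TraceClass

variable {V : Type*} [Fintype V] [DecidableEq V]

/-- The constant in the bound for the commutator of `a ^ p (a†) ^ r` with `(N + 1) ^ k`. -/
def shiftConst (k : ℝ) (p r : ℕ) : ℝ :=
  √((r.factorial : ℝ) * p.factorial) *
    (k * ((p - r + (r - p) : ℕ) : ℝ) * (1 + ((p - r + (r - p) : ℕ) : ℝ)) ^ ((k - 1) / 2))

theorem shiftConst_symm (k : ℝ) (p r : ℕ) : shiftConst k p r = shiftConst k r p := by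
  unfold shiftConst
  rw [mul_comm (r.factorial : ℝ), add_comm (p - r)]

theorem shiftConst_nonneg {k : ℝ} (hk : 1 ≤ k) (p r : ℕ) : 0 ≤ shiftConst k p r := by
  unfold shiftConst
  positivity

theorem shiftKernel_mul_sub_le {k : ℝ} (hk : 1 ≤ k) {ℓ p r : ℕ} (hpr : p + r + 2 ≤ 2 * ℓ)
    (x y : ℕ) :
    shiftKernel p r x y * |((y : ℝ) + 1) ^ k - ((x : ℝ) + 1) ^ k| ≤ shiftConst k p r *
      √(((x : ℝ) + 1) ^ ((ℓ : ℝ) + k - 1 - 1) * ((y : ℝ) + 1) ^ ((ℓ : ℝ) + k - 1 - 1)) := by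
  wlog h : p ≤ r generalizing p r x y
  · have := this (p := r) (r := p) (by lia) y x (by lia)
    rw [shiftKernel_symm, shiftConst_symm, abs_sub_comm, mul_comm (((x : ℝ) + 1) ^ _)]
    exact this
  by_cases hxy : x + r = y + p
  · obtain ⟨q, rfl⟩ := Nat.exists_eq_add_of_le h
    have hy : y = x + q := by lia
    subst hy
    have hmono : ((x : ℝ) + 1) ^ k ≤ ((x + q : ℕ) + 1 : ℝ) ^ k := by
      refine Real.rpow_le_rpow (by positivity) ?_ (by linarith)
      push_cast
      linarith [Nat.cast_nonneg (α := ℝ) q]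
    rw [shiftKernel, if_pos hxy, abs_of_nonneg (sub_nonneg.2 hmono), shiftConst,
      show p - (p + q) + (p + q - p) = q by lia]
    exact sqrt_descFactorial_mul_sub_le hk x p q (by lia)
  · rw [shiftKernel, if_neg hxy, zero_mul]
    have := shiftConst_nonneg hk p r
    positivity

theorem abs_shiftEntry_mul_sub_le {k : ℝ} (hk : 1 ≤ k) {ℓ p r : ℕ} (hpr : p + r + 2 ≤ 2 * ℓ)
    (i : V) (n m : V → ℕ) :
    |shiftEntry i p r n m * (((m i : ℝ) + 1) ^ k - ((n i : ℝ) + 1) ^ k)| ≤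
      if m = Function.update n i (m i) ∧ n i + r = m i + p then shiftConst k p r *
        √(((n i : ℝ) + 1) ^ ((ℓ : ℝ) + k - 1 - 1) * ((m i : ℝ) + 1) ^ ((ℓ : ℝ) + k - 1 - 1))
      else 0 := by
  unfold shiftEntry
  by_cases h1 : m = Function.update n i (m i)
  · rw [if_pos h1]
    by_cases h2 : n i + r = m i + p
    · rw [if_pos ⟨h1, h2⟩, abs_mul, abs_of_nonneg]
      · exact shiftKernel_mul_sub_le hk hpr _ _
      · unfold shiftKernel
        split_ifs
        positivity
    · rw [if_neg fun h => h2 h.2, shiftKernel, if_neg h2, zero_mul, abs_zero]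
  · rw [if_neg h1, if_neg fun h => h1 h.1, zero_mul, abs_zero]

theorem re_apply_diag_nonneg {y : FinOp V} (hy : (toCLM y.toTraceClass).IsPositive) (n : V → ℕ) :
    0 ≤ (y (n, n)).re := by
  have := hy.inner_nonneg_right (ket n)
  rw [← entry_apply, entry_toTraceClass] at this
  exact (Complex.nonneg_iff.1 this).1

/-- Positivity tested on the rescaled vectors `√a |n⟩` and `√b |m⟩`. -/
theorem sqrt_mul_norm_apply_le {y : FinOp V} (hy : (toCLM y.toTraceClass).IsPositive)
    {a b : ℝ} (ha : 0 ≤ a) (hb : 0 ≤ b) (n m : V → ℕ) :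
    √(a * b) * ‖y (n, m)‖ ≤ (a * (y (n, n)).re + b * (y (m, m)).re) / 2 := by
  have h := IsPositive.norm_inner_le hy (((√a : ℝ) : ℂ) • ket n) (((√b : ℝ) : ℂ) • ket m)
  simp only [map_smul, inner_smul_left, inner_smul_right, Complex.conj_ofReal, ← entry_apply,
    entry_toTraceClass, ← mul_assoc, ← Complex.ofReal_mul, Real.mul_self_sqrt ha,
    Real.mul_self_sqrt hb, Complex.re_ofReal_mul] at h
  rw [norm_mul, Complex.norm_real, ← Real.sqrt_mul hb, Real.norm_of_nonneg (Real.sqrt_nonneg _),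
    mul_comm b] at h
  exact h

/-- The expectation of a commutator of `a ^ p (a†) ^ r` with `(N + 1) ^ k`. -/
theorem norm_sum_shiftEntry_le {y : FinOp V} (hy : (toCLM y.toTraceClass).IsPositive)
    {k : ℝ} (hk : 1 ≤ k) {ℓ p r : ℕ} (hpr : p + r + 2 ≤ 2 * ℓ)
    (i : V) (T : Finset (V → ℕ)) :
    ‖∑ n ∈ T, ∑ m ∈ T, y (n, m) *
        (shiftEntry i p r n m * (((m i : ℝ) + 1) ^ k - ((n i : ℝ) + 1) ^ k) : ℝ)‖ ≤
      shiftConst k p r * ∑ n ∈ T, ((n i : ℝ) + 1) ^ ((ℓ : ℝ) + k - 1 - 1) * (y (n, n)).re := by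
  classical
  set w : (V → ℕ) → ℝ := fun n => ((n i : ℝ) + 1) ^ ((ℓ : ℝ) + k - 1 - 1) with hw
  have hw0 : ∀ n, 0 ≤ w n := fun n => by positivity
  let R : (V → ℕ) → (V → ℕ) → Prop := fun n m => m = Function.update n i (m i) ∧ n i + r = m i + p
  have hC := shiftConst_nonneg hk p r
  have hd := re_apply_diag_nonneg hy
  have h1 : ∀ n m, ‖y (n, m) *
      (shiftEntry i p r n m * (((m i : ℝ) + 1) ^ k - ((n i : ℝ) + 1) ^ k) : ℝ)‖ ≤
      (if R n m then shiftConst k p r * (w n * (y (n, n)).re / 2) else 0) +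
      (if R n m then shiftConst k p r * (w m * (y (m, m)).re / 2) else 0) := by
    intro n m
    rw [norm_mul, Complex.norm_real, Real.norm_eq_abs]
    have h2 := abs_shiftEntry_mul_sub_le hk hpr i n m
    by_cases hR : R n m
    · rw [if_pos hR, if_pos hR]
      rw [if_pos hR] at h2
      calc _ ≤ ‖y (n, m)‖ * (shiftConst k p r * √(w n * w m)) := by gcongr
        _ = shiftConst k p r * (√(w n * w m) * ‖y (n, m)‖) := by ring
        _ ≤ shiftConst k p r * ((w n * (y (n, n)).re + w m * (y (m, m)).re) / 2) := by
          gcongr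
          exact sqrt_mul_norm_apply_le hy (hw0 n) (hw0 m) n m
        _ = _ := by ring
    · rw [if_neg hR, if_neg hR]
      rw [if_neg hR] at h2
      rw [le_antisymm h2 (abs_nonneg _)]
      simp
  -- A Schur test: the relation `R` determines each index by the other, because `m i - n i = r - p`
  -- is fixed and the other modes agree. The double sum therefore collapses to diagonal moments.
  have hsum : ∀ (Q : (V → ℕ) → Prop) [DecidablePred Q] (c : ℝ), 0 ≤ c →
      (∀ a b, Q a → Q b → a = b) → ∑ m ∈ T, (if Q m then c else 0) ≤ c := by
    intro Q _ c hc hQ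
    rw [← Finset.sum_filter, Finset.sum_const, nsmul_eq_mul]
    have : (T.filter Q).card ≤ 1 := Finset.card_le_one.2 fun a ha b hb =>
      hQ a b (Finset.mem_filter.1 ha).2 (Finset.mem_filter.1 hb).2
    have : ((T.filter Q).card : ℝ) ≤ 1 := by exact_mod_cast this
    nlinarith
  have hu1 : ∀ n a b, R n a → R n b → a = b := by
    rintro n a b ⟨ha, ha'⟩ ⟨hb, hb'⟩
    rw [ha, hb]
    congr 1
    lia
  have hu2 : ∀ m a b, R a m → R b m → a = b := by
    rintro m a b ⟨ha, ha'⟩ ⟨hb, hb'⟩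
    rw [eq_update_symm.1 ha, eq_update_symm.1 hb]
    congr 1
    lia
  calc _ ≤ ∑ n ∈ T, ∑ m ∈ T,
        ((if R n m then shiftConst k p r * (w n * (y (n, n)).re / 2) else 0) +
        (if R n m then shiftConst k p r * (w m * (y (m, m)).re / 2) else 0)) :=
        (norm_sum_le _ _).trans (Finset.sum_le_sum fun n _ => (norm_sum_le _ _).trans
          (Finset.sum_le_sum fun m _ => h1 n m))
    _ = ∑ n ∈ T, ∑ m ∈ T, (if R n m then shiftConst k p r * (w n * (y (n, n)).re / 2) else 0) +
        ∑ m ∈ T, ∑ n ∈ T, (if R n m then shiftConst k p r * (w m * (y (m, m)).re / 2) else 0) := by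
        simp only [Finset.sum_add_distrib]
        rw [Finset.sum_comm (f := fun n m =>
          if R n m then shiftConst k p r * (w m * (y (m, m)).re / 2) else 0)]
    _ ≤ ∑ n ∈ T, shiftConst k p r * (w n * (y (n, n)).re / 2) +
        ∑ m ∈ T, shiftConst k p r * (w m * (y (m, m)).re / 2) := by
        refine add_le_add (Finset.sum_le_sum fun n _ => ?_) (Finset.sum_le_sum fun m _ => ?_)
        · exact hsum (R n) _ (mul_nonneg hC (div_nonneg (mul_nonneg (hw0 n) (hd n)) zero_le_two))
            (hu1 n)
        · exact hsum (fun n => R n m) _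
            (mul_nonneg hC (div_nonneg (mul_nonneg (hw0 m) (hd m)) zero_le_two)) (hu2 m)
    _ = _ := by
        rw [← Finset.sum_add_distrib, Finset.mul_sum]
        exact Finset.sum_congr rfl fun n _ => by ring

theorem apply_eq_sum_of_support_subset {W : Type*} [AddCommGroup W] [Module ℂ W]
    (g : FinOp V →ₗ[ℂ] W) {y : FinOp V} {T : Finset (V → ℕ)} (hT : y.support ⊆ T ×ˢ T) :
    g y = ∑ n ∈ T, ∑ m ∈ T, y (n, m) • g (Finsupp.single (n, m) 1) := by
  conv_lhs => rw [← Finsupp.sum_single y]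
  rw [Finsupp.sum_of_support_subset y hT _ (by simp), map_sum, Finset.sum_product]
  refine Finset.sum_congr rfl fun n _ => Finset.sum_congr rfl fun m _ => ?_
  rw [← map_smul, Finsupp.smul_single, smul_eq_mul, mul_one]

theorem exists_support_subset (y : FinOp V) : ∃ T : Finset (V → ℕ), y.support ⊆ T ×ˢ T := by
  classical
  refine ⟨y.support.image Prod.fst ∪ y.support.image Prod.snd, fun p hp => ?_⟩
  rw [Finset.mem_product]
  exact ⟨Finset.mem_union_left _ (Finset.mem_image_of_mem _ hp),
    Finset.mem_union_right _ (Finset.mem_image_of_mem _ hp)⟩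

theorem mom_re_eq_sum (f : (V → ℕ) → ℝ) {y : FinOp V} {T : Finset (V → ℕ)}
    (hT : y.support ⊆ T ×ˢ T) : (mom f y).re = ∑ n ∈ T, f n * (y (n, n)).re := by
  rw [apply_eq_sum_of_support_subset _ hT, Complex.re_sum]
  refine Finset.sum_congr rfl fun n hn => ?_
  rw [Finset.sum_eq_single n]
  · rw [mom_single, if_pos rfl, one_mul, smul_eq_mul, Complex.re_mul_ofReal, mul_comm]
  · intro m _ hm
    rw [mom_single, if_neg (Ne.symm hm), smul_zero]
  · exact fun h => absurd hn h

theorem cConst_nonneg (ℓ : ℕ) {k A Lam : ℝ} (hk : 1 ≤ k) (hA : 0 ≤ A) (hLam : 0 ≤ Lam) :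
    0 ≤ cConst ℓ k A Lam := by
  unfold cConst
  positivity

theorem muConst_nonneg {ℓ : ℕ} {k A Lam : ℝ} (hk : 1 ≤ k) (hℓ : 2 ≤ ℓ) (hA : 0 ≤ A)
    (hLam : 0 ≤ Lam) : 0 ≤ muConst ℓ k A Lam := by
  have := cConst_nonneg ℓ hk hA hLam
  have hℓ' : (2 : ℝ) ≤ ℓ := by exact_mod_cast hℓ
  unfold muConst
  have h1 : 0 ≤ (ℓ : ℝ) + k - 1 - 1 := by linarith
  have h2 : 0 ≤ (ℓ : ℝ) + k - 1 := by linarith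
  positivity

theorem iSup_norm_nonneg (α : V → ℂ) : 0 ≤ ⨆ j, ‖α j‖ := Real.iSup_nonneg fun _ => norm_nonneg _

theorem hamiltonianSize_nonneg (d : ℕ) (lam : V → (Fin 4 → ℕ) → ℂ) : 0 ≤ hamiltonianSize d lam :=
  Real.iSup_nonneg fun _ => Finset.sum_nonneg fun _ _ => norm_nonneg _

/-- The expectation of the commutator of `a ^ p (a†) ^ r` with `(N + 1) ^ k`, where `y` is supported
in `T`. -/
def shiftSum (k : ℝ) (i : V) (T : Finset (V → ℕ)) (y : FinOp V) (p r : ℕ) : ℂ :=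
  ∑ n ∈ T, ∑ m ∈ T, y (n, m) *
    (shiftEntry i p r n m * (((m i : ℝ) + 1) ^ k - ((n i : ℝ) + 1) ^ k) : ℝ)

theorem mom_lindbladian_eq (k : ℝ) (ℓ : ℕ) (α : V → ℂ) (d : ℕ) (lam : V → (Fin 4 → ℕ) → ℂ)
    {y : FinOp V} (i : V) {T : Finset (V → ℕ)} (hT : y.support ⊆ T ×ˢ T) :
    mom (fun n => ((n i : ℝ) + 1) ^ k) (lindbladian ℓ d α lam y) =
      ∑ n ∈ T, y (n, n) * (((n i).descFactorial ℓ *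
        ((((n i - ℓ : ℕ) : ℝ) + 1) ^ k - ((n i : ℝ) + 1) ^ k) : ℝ) : ℂ) +
      (α i ^ ℓ / 2 * shiftSum k i T y 0 ℓ - starRingEnd ℂ (α i ^ ℓ) / 2 * shiftSum k i T y ℓ 0) +
      ∑ u ∈ exponents d, (-Complex.I) * (lam i u * shiftSum k i T y (u 0 + u 2) (u 1 + u 3) +
        starRingEnd ℂ (lam i u) * shiftSum k i T y (u 1 + u 3) (u 0 + u 2)) := by
  have h1 := apply_eq_sum_of_support_subset
    (mom (fun n => ((n i : ℝ) + 1) ^ k) ∘ₗ lindbladian ℓ d α lam) hT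
  simp only [LinearMap.comp_apply, smul_eq_mul] at h1
  rw [h1]
  have h2 : ∀ n m, mom (fun n => ((n i : ℝ) + 1) ^ k)
      (lindbladian ℓ d α lam (Finsupp.single (n, m) 1)) = _ := fun n m =>
    mom_lindbladian_single ℓ d α lam (fun x => ((x : ℝ) + 1) ^ k) i n m
  simp only [h2]
  generalize hE : (fun (p r : ℕ) (n m : V → ℕ) =>
    ((shiftEntry i p r n m * (((m i : ℝ) + 1) ^ k - ((n i : ℝ) + 1) ^ k) : ℝ) : ℂ)) = E
  have hE' : ∀ (p r : ℕ) (n m : V → ℕ), ((shiftEntry i p r n m *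
      (((m i : ℝ) + 1) ^ k - ((n i : ℝ) + 1) ^ k) : ℝ) : ℂ) = E p r n m := fun p r n m => by
    rw [← hE]
  simp only [shiftSum, hE', mul_add, Finset.sum_add_distrib]
  congr 1
  · congr 1
    · refine Finset.sum_congr rfl fun n hn => ?_
      rw [Finset.sum_eq_single n (fun m _ hm => by rw [if_neg (Ne.symm hm), mul_zero])
        (fun h => absurd hn h), if_pos rfl]
    · simp only [mul_sub, Finset.sum_sub_distrib, Finset.mul_sum]
      congr 1 <;> exact Finset.sum_congr rfl fun n _ => Finset.sum_congr rfl fun m _ => by ring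
  · have hc : ∀ f : (V → ℕ) → (V → ℕ) → (Fin 4 → ℕ) → ℂ,
        ∑ n ∈ T, ∑ m ∈ T, y (n, m) * ∑ u ∈ exponents d, f n m u =
        ∑ u ∈ exponents d, ∑ n ∈ T, ∑ m ∈ T, y (n, m) * f n m u := by
      intro f
      simp only [Finset.mul_sum]
      exact (Finset.sum_congr rfl fun n _ => Finset.sum_comm).trans Finset.sum_comm
    simp only [← Finset.sum_add_distrib, ← mul_add]
    rw [hc]
    refine Finset.sum_congr rfl fun u _ => ?_
    simp only [Finset.mul_sum, ← Finset.sum_add_distrib]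
    exact Finset.sum_congr rfl fun n _ => Finset.sum_congr rfl fun m _ => by ring

theorem norm_dissipation_sum_le {k : ℝ} (hk : 1 ≤ k) {ℓ : ℕ} (hℓ : 2 ≤ ℓ) {a : ℂ} {A : ℝ}
    (hA : ‖a‖ ≤ A) {W : ℝ} (hW0 : 0 ≤ W) {Θ : ℕ → ℕ → ℂ}
    (hΘ : ∀ p r, p + r + 2 ≤ 2 * ℓ → ‖Θ p r‖ ≤ shiftConst k p r * W) :
    ‖a ^ ℓ / 2 * Θ 0 ℓ - starRingEnd ℂ (a ^ ℓ) / 2 * Θ ℓ 0‖ ≤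
      ℓ / 2 * (4 * A ^ ℓ * k * (ℓ : ℝ) ^ (k - 1) * √(ℓ.factorial : ℝ)) * W := by
  have hA0 : 0 ≤ A := (norm_nonneg _).trans hA
  have hc : shiftConst k 0 ℓ ≤ √(ℓ.factorial : ℝ) * (k * ℓ * (ℓ : ℝ) ^ (k - 1)) := by
    unfold shiftConst
    simp only [Nat.zero_sub, Nat.sub_zero, zero_add, Nat.factorial_zero, Nat.cast_one, mul_one]
    exact mul_le_mul_of_nonneg_left (dissipation_const_le hk hℓ) (Real.sqrt_nonneg _)
  have h1 := hΘ 0 ℓ (by lia)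
  have h2 := hΘ ℓ 0 (by lia)
  rw [shiftConst_symm] at h2
  have h3 : ‖a‖ ^ ℓ ≤ A ^ ℓ := pow_le_pow_left₀ (norm_nonneg _) hA _
  calc _ ≤ ‖a‖ ^ ℓ / 2 * ‖Θ 0 ℓ‖ + ‖a‖ ^ ℓ / 2 * ‖Θ ℓ 0‖ := by
        refine (norm_sub_le _ _).trans (le_of_eq ?_)
        simp
    _ ≤ A ^ ℓ / 2 * (shiftConst k 0 ℓ * W) + A ^ ℓ / 2 * (shiftConst k 0 ℓ * W) := by gcongr
    _ = A ^ ℓ * shiftConst k 0 ℓ * W := by ring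
    _ ≤ A ^ ℓ * (√(ℓ.factorial : ℝ) * (k * ℓ * (ℓ : ℝ) ^ (k - 1))) * W := by gcongr
    -- A factor of two is given away here; the constant `4 A^ℓ k ℓ^(k-1) √(ℓ!)` is twice what this
    -- estimate needs.
    _ ≤ 2 * (A ^ ℓ * (√(ℓ.factorial : ℝ) * (k * ℓ * (ℓ : ℝ) ^ (k - 1))) * W) := by
        have : 0 ≤ A ^ ℓ * (√(ℓ.factorial : ℝ) * (k * ℓ * (ℓ : ℝ) ^ (k - 1))) * W := by positivity
        linarith
    _ = _ := by ring

theorem norm_hamiltonian_sum_le {k : ℝ} (hk : 1 ≤ k) {ℓ : ℕ} (hℓ : 2 ≤ ℓ) {d : ℕ}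
    (hd : d ≤ 2 * (ℓ - 1)) {c : (Fin 4 → ℕ) → ℂ} {Lam : ℝ}
    (hLam : ∑ u ∈ exponents d, ‖c u‖ ≤ Lam) {W : ℝ} (hW0 : 0 ≤ W) {Θ : ℕ → ℕ → ℂ}
    (hΘ : ∀ p r, p + r + 2 ≤ 2 * ℓ → ‖Θ p r‖ ≤ shiftConst k p r * W) :
    ‖∑ u ∈ exponents d, (-Complex.I) * (c u * Θ (u 0 + u 2) (u 1 + u 3) +
        starRingEnd ℂ (c u) * Θ (u 1 + u 3) (u 0 + u 2))‖ ≤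
      ℓ / 2 * (Lam * (2 * (ℓ : ℝ)) ^ k * √((2 * ℓ).factorial : ℝ)) * W := by
  have h1 : ∀ u ∈ exponents d, ‖(-Complex.I) * (c u * Θ (u 0 + u 2) (u 1 + u 3) +
      starRingEnd ℂ (c u) * Θ (u 1 + u 3) (u 0 + u 2))‖ ≤
      ‖c u‖ * (ℓ / 2 * ((2 * (ℓ : ℝ)) ^ k * √((2 * ℓ).factorial : ℝ)) * W) := by
    intro u hu
    have hu' : ∑ r, u r ≤ d := (Finset.mem_filter.1 hu).2
    rw [Fin.sum_univ_four] at hu'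
    have hle : u 0 + u 2 + (u 1 + u 3) + 2 ≤ 2 * ℓ := by lia
    have h2 := hΘ (u 0 + u 2) (u 1 + u 3) hle
    have h3 := hΘ (u 1 + u 3) (u 0 + u 2) (by lia)
    rw [shiftConst_symm] at h3
    have hconst : 2 * shiftConst k (u 0 + u 2) (u 1 + u 3) ≤
        ℓ / 2 * ((2 * (ℓ : ℝ)) ^ k * √((2 * ℓ).factorial : ℝ)) := by
      generalize u 0 + u 2 = p at hle
      generalize u 1 + u 3 = r at hle
      rcases le_total p r with h | h
      · obtain ⟨q, rfl⟩ := Nat.exists_eq_add_of_le h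
        have := hamiltonian_const_le hk (p := p) (q := q) (ℓ := ℓ) (by lia)
        rw [shiftConst, show p - (p + q) + (p + q - p) = q by lia]
        exact this
      · obtain ⟨q, rfl⟩ := Nat.exists_eq_add_of_le h
        have := hamiltonian_const_le hk (p := r) (q := q) (ℓ := ℓ) (by lia)
        rw [shiftConst_symm, shiftConst, show r - (r + q) + (r + q - r) = q by lia]
        exact this
    rw [norm_mul, norm_neg, Complex.norm_I, one_mul]
    calc _ ≤ ‖c u‖ * ‖Θ (u 0 + u 2) (u 1 + u 3)‖ + ‖c u‖ * ‖Θ (u 1 + u 3) (u 0 + u 2)‖ := by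
          refine (norm_add_le _ _).trans (le_of_eq ?_)
          simp
      _ ≤ ‖c u‖ * (shiftConst k (u 0 + u 2) (u 1 + u 3) * W) +
          ‖c u‖ * (shiftConst k (u 0 + u 2) (u 1 + u 3) * W) := by gcongr
      _ = ‖c u‖ * ((2 * shiftConst k (u 0 + u 2) (u 1 + u 3)) * W) := by ring
      _ ≤ _ := by gcongr
  calc _ ≤ ∑ u ∈ exponents d,
        ‖c u‖ * (ℓ / 2 * ((2 * (ℓ : ℝ)) ^ k * √((2 * ℓ).factorial : ℝ)) * W) :=
        (norm_sum_le _ _).trans (Finset.sum_le_sum h1)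
    _ = (∑ u ∈ exponents d, ‖c u‖) *
        (ℓ / 2 * ((2 * (ℓ : ℝ)) ^ k * √((2 * ℓ).factorial : ℝ)) * W) := by rw [Finset.sum_mul]
    _ ≤ Lam * (ℓ / 2 * ((2 * (ℓ : ℝ)) ^ k * √((2 * ℓ).factorial : ℝ)) * W) := by gcongr
    _ = _ := by ring

/-- The Lyapunov inequality for the moments of the mode `i`. -/
theorem mom_lindbladian_le {k : ℝ} (hk : 1 ≤ k) {ℓ : ℕ} (hℓ : 2 ≤ ℓ) (α : V → ℂ) {d : ℕ}
    (hd : d ≤ 2 * (ℓ - 1)) (lam : V → (Fin 4 → ℕ) → ℂ) {y : FinOp V}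
    (hy : (toCLM y.toTraceClass).IsPositive) (i : V) :
    (mom (fun n => ((n i : ℝ) + 1) ^ k) (lindbladian ℓ d α lam y)).re ≤
      -((ℓ : ℝ) / 2) * (mom (fun n => ((n i : ℝ) + 1) ^ (k + ℓ - 1)) y).re +
        ℓ / 2 * muConst ℓ k (⨆ j, ‖α j‖) (hamiltonianSize d lam) * (mom (fun _ => 1) y).re := by
  obtain ⟨T, hT⟩ := exists_support_subset y
  set A := ⨆ j, ‖α j‖
  set Lam := hamiltonianSize d lam
  set ν : ℝ := (ℓ : ℝ) + k - 1 with hν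
  have hℓ' : (2 : ℝ) ≤ ℓ := by exact_mod_cast hℓ
  have hA : ‖α i‖ ≤ A :=
    le_ciSup (f := fun j => ‖α j‖) (Set.finite_range _).bddAbove i
  have hLam : ∑ u ∈ exponents d, ‖lam i u‖ ≤ Lam :=
    le_ciSup (f := fun j => ∑ u ∈ exponents d, ‖lam j u‖) (Set.finite_range _).bddAbove i
  have hA0 : 0 ≤ A := iSup_norm_nonneg α
  have hLam0 : 0 ≤ Lam := hamiltonianSize_nonneg d lam
  have hy0 := re_apply_diag_nonneg hy
  set W := ∑ n ∈ T, ((n i : ℝ) + 1) ^ (ν - 1) * (y (n, n)).re with hW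
  have hW0 : 0 ≤ W := Finset.sum_nonneg fun n _ => mul_nonneg (by positivity) (hy0 n)
  have hΘ : ∀ p r, p + r + 2 ≤ 2 * ℓ → ‖shiftSum k i T y p r‖ ≤ shiftConst k p r * W :=
    fun p r hpr => norm_sum_shiftEntry_le hy hk hpr i T
  have hmain : (∑ n ∈ T, y (n, n) * (((n i).descFactorial ℓ *
        ((((n i - ℓ : ℕ) : ℝ) + 1) ^ k - ((n i : ℝ) + 1) ^ k) : ℝ) : ℂ)).re ≤
      -ℓ * ∑ n ∈ T, ((n i : ℝ) + 1) ^ ν * (y (n, n)).re +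
        ℓ / 2 * (((ℓ : ℝ) + 1) * ℓ) * W := by
    rw [Complex.re_sum, hW, Finset.mul_sum, Finset.mul_sum, ← Finset.sum_add_distrib]
    refine Finset.sum_le_sum fun n _ => ?_
    rw [Complex.re_mul_ofReal]
    have := descFactorial_mul_sub_ge hk (by lia : 1 ≤ ℓ) (n i)
    have h2 := mul_le_mul_of_nonneg_left this (hy0 n)
    rw [← hν] at h2
    linarith
  -- Half of the leading term `-ℓ X^ν` stays in the conclusion; the other half absorbs `(ℓ/2) c
  -- X^(ν-1)`, leaving `(ℓ/2) μ` times the trace.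
  have hyoung : ∀ n : V → ℕ, cConst ℓ k A Lam * ((n i : ℝ) + 1) ^ (ν - 1) -
      ((n i : ℝ) + 1) ^ ν ≤ muConst ℓ k A Lam := fun n =>
    young_le (cConst_nonneg ℓ hk hA0 hLam0) (by linarith) (by positivity)
  rw [mom_re_eq_sum _ hT, mom_re_eq_sum _ hT, mom_lindbladian_eq k ℓ α d lam i hT, Complex.add_re,
    Complex.add_re, show k + ℓ - 1 = ν by rw [hν]; ring]
  have h5 := (Complex.re_le_norm _).trans (norm_dissipation_sum_le hk hℓ hA hW0 hΘ)
  have h6 := (Complex.re_le_norm _).trans (norm_hamiltonian_sum_le hk hℓ hd hLam hW0 hΘ)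
  have h7 : -ℓ * ∑ n ∈ T, ((n i : ℝ) + 1) ^ ν * (y (n, n)).re + ℓ / 2 * cConst ℓ k A Lam * W ≤
      -((ℓ : ℝ) / 2) * ∑ n ∈ T, ((n i : ℝ) + 1) ^ ν * (y (n, n)).re +
        ℓ / 2 * muConst ℓ k A Lam * ∑ n ∈ T, 1 * (y (n, n)).re := by
    rw [hW]
    simp only [Finset.mul_sum]
    rw [← Finset.sum_add_distrib, ← Finset.sum_add_distrib]
    refine Finset.sum_le_sum fun n _ => ?_
    have := mul_le_mul_of_nonneg_right (hyoung n) (mul_nonneg (by linarith : (0 : ℝ) ≤ ℓ / 2) (hy0 n))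
    linarith
  refine le_trans (add_le_add (add_le_add hmain h5) h6) (le_trans (le_of_eq ?_) h7)
  unfold cConst
  ring

end LyapunovBound

/-! ### Averaging the moments over the modes with the site weights -/

section SobolevMoments

open TraceClass

variable {V : Type*} [Fintype V] [DecidableEq V]

theorem mom_sum_mul {ι : Type*} (s : Finset ι) (c : ι → ℝ) (f : ι → (V → ℕ) → ℝ) (y : FinOp V) :
    mom (fun n => ∑ i ∈ s, c i * f i n) y = ∑ i ∈ s, (c i : ℂ) * mom (f i) y := by
  induction y using Finsupp.induction_linear with
  | zero => simp
  | add y z h h' => simp only [map_add, h, h', mul_add, Finset.sum_add_distrib]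
  | single p c' =>
    obtain ⟨n, m⟩ := p
    simp only [mom_single]
    split_ifs
    · push_cast
      rw [Finset.mul_sum]
      exact Finset.sum_congr rfl fun i _ => by ring
    · simp

variable [MetricSpace V]

theorem siteWeight_nonneg (κ : ℝ) (v i : V) : 0 ≤ siteWeight κ v i := by
  unfold siteWeight
  positivity

theorem sum_siteWeight (κ : ℝ) (v : V) : ∑ i, siteWeight κ v i = 1 := by
  unfold siteWeight
  rw [← Finset.sum_div, div_self]
  exact (Finset.sum_pos (fun j _ => Real.exp_pos _) ⟨v, Finset.mem_univ v⟩).ne'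

theorem sobolevSymbol_self (κ k : ℝ) (v : V) (n : V → ℕ) :
    sobolevSymbol κ k v n n = ∑ i, siteWeight κ v i * ((n i : ℝ) + 1) ^ k := by
  unfold sobolevSymbol
  refine Finset.sum_congr rfl fun i _ => ?_
  rw [← Real.rpow_add (by positivity), add_halves]

theorem trace_sobolevOp (κ k : ℝ) (v : V) (y : FinOp V) :
    trace (sobolevOp κ k v y).toTraceClass =
      ∑ i, (siteWeight κ v i : ℂ) * mom (fun n => ((n i : ℝ) + 1) ^ k) y := by
  rw [← mom_sum_mul, ← mom_one]
  induction y using Finsupp.induction_linear with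
  | zero => simp
  | add y z h h' => rw [map_add, map_add, map_add, h, h']
  | single p c =>
    obtain ⟨n, m⟩ := p
    simp only [sobolevOp, Finsupp.linearCombination_single, Finsupp.smul_single, mom_single]
    by_cases h : n = m
    · subst h
      simp [sobolevSymbol_self]
    · simp [h]

theorem re_trace_sobolevOp_lindbladian_le (κ : ℝ) (v : V) {k : ℝ} (hk : 1 ≤ k) {ℓ : ℕ}
    (hℓ : 2 ≤ ℓ) (α : V → ℂ) {d : ℕ} (hd : d ≤ 2 * (ℓ - 1)) (lam : V → (Fin 4 → ℕ) → ℂ)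
    {ρ : FinOp V} (hρ : IsState ρ.toTraceClass) :
    (trace (sobolevOp κ k v (lindbladian ℓ d α lam ρ)).toTraceClass).re ≤
      -((ℓ : ℝ) / 2) * (trace (sobolevOp κ (k + ℓ - 1) v ρ).toTraceClass).re +
        (ℓ : ℝ) / 2 * muConst ℓ k (⨆ j, ‖α j‖) (hamiltonianSize d lam) := by
  rw [trace_sobolevOp, trace_sobolevOp, Complex.re_sum, Complex.re_sum]
  simp only [Complex.re_ofReal_mul]
  set μ := muConst ℓ k (⨆ j, ‖α j‖) (hamiltonianSize d lam)
  have h1 : ∀ i, (mom (fun n => ((n i : ℝ) + 1) ^ k) (lindbladian ℓ d α lam ρ)).re ≤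
      -((ℓ : ℝ) / 2) * (mom (fun n => ((n i : ℝ) + 1) ^ (k + ℓ - 1)) ρ).re + ℓ / 2 * μ := by
    intro i
    have := mom_lindbladian_le hk hℓ α hd lam hρ.1 i
    rwa [mom_one, hρ.2, Complex.one_re, mul_one] at this
  calc _ ≤ ∑ i, siteWeight κ v i *
        (-((ℓ : ℝ) / 2) * (mom (fun n => ((n i : ℝ) + 1) ^ (k + ℓ - 1)) ρ).re + ℓ / 2 * μ) :=
        Finset.sum_le_sum fun i _ => mul_le_mul_of_nonneg_left (h1 i) (siteWeight_nonneg κ v i)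
    _ = _ := by
      simp only [mul_add, Finset.sum_add_distrib]
      rw [← Finset.sum_mul, sum_siteWeight, one_mul, Finset.mul_sum]
      congr 1
      exact Finset.sum_congr rfl fun i _ => by ring

end SobolevMoments

/-! ### Truncation to finitely many occupation numbers -/

section Truncation

open TraceClass

variable {V : Type*} [Fintype V] [DecidableEq V]

/-- The occupation numbers that are at most `M` in each mode. -/
def box (V : Type*) [Fintype V] [DecidableEq V] (M : ℕ) : Finset (V → ℕ) :=
  Fintype.piFinset fun _ => Finset.range (M + 1)

theorem mem_box {M : ℕ} {n : V → ℕ} : n ∈ box V M ↔ ∀ i, n i ≤ M := by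
  simp [box]

theorem box_mono {M N : ℕ} (h : M ≤ N) : box V M ⊆ box V N := fun _ hn =>
  mem_box.2 fun i => (mem_box.1 hn i).trans h

theorem card_box (M : ℕ) : (box V M).card = (M + 1) ^ Fintype.card V := by
  simp [box]

theorem exists_mem_box (n : V → ℕ) : ∃ M, n ∈ box V M :=
  ⟨∑ i, n i, mem_box.2 fun i => Finset.single_le_sum (f := n) (fun _ _ => Nat.zero_le _)
    (Finset.mem_univ i)⟩

/-- The projection onto the span of the basis vectors in the box. -/
def proj (V : Type*) [Fintype V] [DecidableEq V] (M : ℕ) : Fock V →L[ℂ] Fock V :=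
  ∑ n ∈ box V M, InnerProductSpace.rankOne ℂ (ket n) (ket n)

theorem proj_ket (M : ℕ) (n : V → ℕ) : proj V M (ket n) = if n ∈ box V M then ket n else 0 := by
  simp only [proj, sum_apply, InnerProductSpace.rankOne_apply, inner_ket_ket, ite_smul, one_smul,
    zero_smul, Finset.sum_ite_eq']

theorem adjoint_proj (M : ℕ) : ContinuousLinearMap.adjoint (proj V M) = proj V M := by
  simp [proj]

theorem inner_proj_right (M : ℕ) (x y : Fock V) :
    inner ℂ x (proj V M y) = inner ℂ (proj V M x) y := by
  rw [← ContinuousLinearMap.adjoint_inner_left, adjoint_proj]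

/-- The truncation of an operator on the finite vectors. -/
def compress (M : ℕ) (A : Module.End ℂ (FinVec V)) : Fock V →L[ℂ] Fock V :=
  ∑ n ∈ box V M,
    InnerProductSpace.rankOne ℂ (proj V M (vec (A (Finsupp.single n 1)))) (ket n)

theorem compress_ket (M : ℕ) (A : Module.End ℂ (FinVec V)) (n : V → ℕ) :
    compress M A (ket n) = if n ∈ box V M then proj V M (vec (A (Finsupp.single n 1))) else 0 := by
  simp only [compress, sum_apply, InnerProductSpace.rankOne_apply, inner_ket_ket, ite_smul,
    one_smul, zero_smul, Finset.sum_ite_eq']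

theorem proj_vec_of_support {M : ℕ} {φ : FinVec V} (h : ∀ n, n ∉ box V M → φ n = 0) :
    proj V M (vec φ) = vec φ := by
  rw [vec, Finsupp.linearCombination_apply, Finsupp.sum, map_sum]
  refine Finset.sum_congr rfl fun n hn => ?_
  rw [map_smul, proj_ket, if_pos]
  by_contra h'
  exact (Finsupp.mem_support_iff.1 hn) (h n h')

theorem proj_comp_proj (M : ℕ) (x : Fock V) : proj V M (proj V M x) = proj V M x := by
  have : proj V M ∘L proj V M = proj V M := ext_inner_ket fun n m => by
    rw [ContinuousLinearMap.comp_apply, proj_ket]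
    split_ifs with h
    · rw [proj_ket, if_pos h]
    · rw [map_zero]
  exact DFunLike.congr_fun this x

theorem proj_compress_ket (M : ℕ) (A : Module.End ℂ (FinVec V)) (n : V → ℕ) :
    proj V M (compress M A (ket n)) = compress M A (ket n) := by
  rw [compress_ket]
  split_ifs
  · rw [proj_comp_proj]
  · rw [map_zero]

/-- The truncation `X ↦ P X P` of a trace-class operator. -/
def cutoff (V : Type*) [Fintype V] [DecidableEq V] (M : ℕ) :
    TraceClass (Fock V) →L[ℂ] TraceClass (Fock V) := conjMap (proj V M) (proj V M)

theorem entry_cutoff (M : ℕ) (n m : V → ℕ) (X : TraceClass (Fock V)) :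
    entry n m (cutoff V M X) = if n ∈ box V M ∧ m ∈ box V M then entry n m X else 0 := by
  rw [entry_apply, cutoff, toCLM_conjMap, adjoint_proj, ContinuousLinearMap.comp_apply,
    ContinuousLinearMap.comp_apply, inner_proj_right, proj_ket, proj_ket]
  by_cases h1 : n ∈ box V M <;> by_cases h2 : m ∈ box V M <;> simp [h1, h2, entry_apply]

/-- The part of the matrix of a trace-class operator in the box. -/
def truncate (M : ℕ) (X : TraceClass (Fock V)) : FinOp V :=
  ∑ n ∈ box V M, ∑ m ∈ box V M, Finsupp.single (n, m) (entry n m X)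

theorem truncate_apply (M : ℕ) (X : TraceClass (Fock V)) (n m : V → ℕ) :
    truncate M X (n, m) = if n ∈ box V M ∧ m ∈ box V M then entry n m X else 0 := by
  simp only [truncate, Finsupp.finsetSum_apply, Finsupp.single_apply, Prod.mk.injEq]
  by_cases h1 : n ∈ box V M
  · rw [Finset.sum_eq_single n (fun a _ ha => by simp [ha]) (fun h => absurd h1 h)]
    by_cases h2 : m ∈ box V M
    · rw [Finset.sum_eq_single m (fun a _ ha => by simp [ha]) (fun h => absurd h2 h)]
      simp [h1, h2]
    · rw [Finset.sum_eq_zero, if_neg fun h => h2 h.2]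
      intro a ha
      rw [if_neg]
      rintro ⟨-, rfl⟩
      exact h2 ha
  · rw [Finset.sum_eq_zero, if_neg fun h => h1 h.1]
    intro a ha
    refine Finset.sum_eq_zero fun b _ => ?_
    rw [if_neg]
    rintro ⟨rfl, -⟩
    exact h1 ha

theorem toTraceClass_truncate (M : ℕ) (X : TraceClass (Fock V)) :
    (truncate M X).toTraceClass = cutoff V M X :=
  ext_entry fun n m => by rw [entry_toTraceClass, truncate_apply, entry_cutoff]

theorem support_truncate (M : ℕ) (X : TraceClass (Fock V)) :
    (truncate M X).support ⊆ box V M ×ˢ box V M := fun p hp => by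
  obtain ⟨n, m⟩ := p
  rw [Finsupp.mem_support_iff, truncate_apply] at hp
  rw [Finset.mem_product]
  by_contra h
  exact hp (if_neg h)

theorem isCompletelyPositive_cutoff (M : ℕ) : IsCompletelyPositive (cutoff V M) :=
  IsCompletelyPositive.conjMap _

theorem cutoff_ketbra_ket (M : ℕ) (n m : V → ℕ) : cutoff V M (ketbra (ket n) (ket m)) =
    if n ∈ box V M ∧ m ∈ box V M then ketbra (ket n) (ket m) else 0 := by
  rw [cutoff, conjMap_ketbra, proj_ket, proj_ket]
  by_cases h1 : n ∈ box V M <;> by_cases h2 : m ∈ box V M <;> simp [h1, h2]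

theorem re_trace_cutoff_le (M : ℕ) {X : TraceClass (Fock V)} (hX : (toCLM X).IsPositive) :
    (trace (cutoff V M X)).re ≤ (trace X).re := by
  refine hasSum_le (fun n => ?_) ((hasSum_trace (cutoff V M X)).mapL Complex.reCLM)
    ((hasSum_trace X).mapL Complex.reCLM)
  rw [entry_cutoff]
  split_ifs
  · exact le_rfl
  · rw [map_zero]
    exact (Complex.nonneg_iff.1 (hX.inner_nonneg_right (ket n))).1

/-- The truncated moment `∑ n, f n ⟨n| X |n⟩`, with the sum over the box. -/
def tmom (M : ℕ) (f : (V → ℕ) → ℝ) : TraceClass (Fock V) →L[ℂ] ℂ :=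
  ∑ n ∈ box V M, (f n : ℂ) • entry n n

theorem tmom_apply (M : ℕ) (f : (V → ℕ) → ℝ) (X : TraceClass (Fock V)) :
    tmom M f X = ∑ n ∈ box V M, (f n : ℂ) * entry n n X := by
  simp [tmom]

theorem tmom_toTraceClass {M : ℕ} (f : (V → ℕ) → ℝ) {y : FinOp V}
    (hy : ∀ n, n ∉ box V M → y (n, n) = 0) : tmom M f y.toTraceClass = mom f y := by
  obtain ⟨T, hT⟩ := exists_support_subset y
  have hT' : y.support ⊆ (T ∪ box V M) ×ˢ (T ∪ box V M) :=
    hT.trans (Finset.product_subset_product Finset.subset_union_left Finset.subset_union_left)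
  rw [apply_eq_sum_of_support_subset (mom f) hT', tmom_apply]
  simp only [entry_toTraceClass]
  rw [Finset.sum_subset (Finset.subset_union_right (s₁ := T)) fun n _ hn => by
    rw [hy n hn, mul_zero]]
  refine Finset.sum_congr rfl fun n hn => ?_
  rw [Finset.sum_eq_single n]
  · rw [mom_single, if_pos rfl, one_mul, smul_eq_mul, mul_comm]
  · intro m _ hm
    rw [mom_single, if_neg (Ne.symm hm), smul_zero]
  · exact fun h => absurd hn h

variable (ℓ d : ℕ) (α : V → ℂ) (lam : V → (Fin 4 → ℕ) → ℂ)

/-- Annihilation only lowers occupation numbers, so the jump operators preserve every box. Only the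
drift, which contains creation operators, leads out of it. -/
theorem jump_apply_eq_zero {M : ℕ} (j : V) {n m : V → ℕ} (hn : n ∈ box V M) (hm : m ∉ box V M) :
    jump ℓ α j (Finsupp.single n 1) m = 0 := by
  simp only [jump, LinearMap.sub_apply, LinearMap.smul_apply, Module.End.one_apply, ann_pow_single,
    Finsupp.sub_apply, Finsupp.smul_apply, Finsupp.single_apply]
  rw [if_neg, if_neg]
  · simp
  · rintro rfl
    exact hm hn
  · rintro rfl
    refine hm (mem_box.2 fun i => ?_)
    have := mem_box.1 hn i
    by_cases hi : i = j
    · subst hi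
      rw [Function.update_self]
      lia
    · rwa [Function.update_of_ne hi]

theorem compress_jump_ket {M : ℕ} (j : V) {n : V → ℕ} (hn : n ∈ box V M) :
    compress M (jump ℓ α j) (ket n) = vec (jump ℓ α j (Finsupp.single n 1)) := by
  rw [compress_ket, if_pos hn, proj_vec_of_support fun m hm => jump_apply_eq_zero ℓ α j hn hm]

/-- The truncated generator. -/
def truncGen (M : ℕ) : TraceClass (Fock V) →L[ℂ] TraceClass (Fock V) :=
  boundedLindbladian (compress M (driftOp ℓ d α lam)) fun j => compress M (jump ℓ α j)

/-- As the jumps are not cut, compressing `K + K† + ∑ L_j† L_j = 0` to the box gives the same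
identity for the truncated operators, and the truncated dynamics loses no trace. -/
theorem compress_trace_condition (M : ℕ) (n m : V → ℕ) :
    inner ℂ (ket m) (compress M (driftOp ℓ d α lam) (ket n)) +
      inner ℂ (compress M (driftOp ℓ d α lam) (ket m)) (ket n) +
      ∑ j, inner ℂ (compress M (jump ℓ α j) (ket m)) (compress M (jump ℓ α j) (ket n)) = 0 := by
  by_cases hn : n ∈ box V M
  · by_cases hm : m ∈ box V M
    · simp only [compress_jump_ket ℓ α _ hn, compress_jump_ket ℓ α _ hm]
      rw [compress_ket, compress_ket, if_pos hn, if_pos hm, inner_proj_right, proj_ket, if_pos hm,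
        ← inner_proj_right, proj_ket, if_pos hn, inner_ket_vec, inner_vec_ket, inner_driftOp,
        conj_driftOp]
      ring
    · rw [← proj_compress_ket, inner_proj_right, proj_ket, if_neg hm]
      simp [compress_ket, hm]
  · rw [← proj_compress_ket (n := m), ← inner_proj_right, proj_ket, if_neg hn]
    simp [compress_ket, hn]

theorem commute_cutoff_truncGen (M : ℕ) : Commute (cutoff V M) (truncGen ℓ d α lam M) := by
  refine ext_ketbra_ket fun n m => ?_
  simp only [mul_apply_eq_comp]
  have h1 : ∀ (A : Module.End ℂ (FinVec V)) (n : V → ℕ), n ∉ box V M →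
      compress M A (ket n) = 0 := fun A n h => by rw [compress_ket, if_neg h]
  rw [cutoff_ketbra_ket, truncGen, boundedLindbladian_ketbra]
  simp only [map_add, map_sum]
  simp only [cutoff, conjMap_ketbra, proj_compress_ket, proj_ket]
  by_cases hn : n ∈ box V M <;> by_cases hm : m ∈ box V M
  · simp [hn, hm, boundedLindbladian_ketbra]
  · simp [hn, hm, h1]
  · simp [hn, hm, h1]
  · simp [hn, hm, h1]

/-- The diagonal does not notice the truncation: a drift term reaches the diagonal only at `n` or
`m`, which lie in the box, and the jump terms are uncut. The Lyapunov inequality thus carries over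
with the same constants. -/
theorem tmom_truncGen_ketbra {M : ℕ} (f : (V → ℕ) → ℝ) {n m : V → ℕ} (hn : n ∈ box V M)
    (hm : m ∈ box V M) :
    tmom M f (truncGen ℓ d α lam M (ketbra (ket n) (ket m))) =
      mom f (lindbladian ℓ d α lam (Finsupp.single (n, m) 1)) := by
  have hnm : ∀ p, p ∉ box V M → n ≠ p ∧ m ≠ p := fun p hp =>
    ⟨fun h => hp (h ▸ hn), fun h => hp (h ▸ hm)⟩
  rw [← tmom_toTraceClass]
  · rw [toTraceClass_lindbladian_single, truncGen, boundedLindbladian_ketbra, tmom_apply,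
      tmom_apply]
    refine Finset.sum_congr rfl fun p hp => ?_
    simp only [compress_jump_ket ℓ α _ hn, compress_jump_ket ℓ α _ hm, map_add, map_sum,
      entry_ketbra]
    rw [compress_ket, compress_ket, if_pos hn, if_pos hm, inner_proj_right, ← inner_proj_right _ _
      (ket p), proj_ket, if_pos hp]
  · intro p hp
    rw [← entry_toTraceClass, toTraceClass_lindbladian_single]
    simp only [map_add, map_sum, entry_ketbra, inner_ket_ket, inner_ket_vec, inner_vec_ket,
      jump_apply_eq_zero ℓ α _ hn hp, jump_apply_eq_zero ℓ α _ hm hp,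
      if_neg (hnm p hp).2, if_neg (hnm p hp).1.symm]
    simp

theorem tmom_truncGen {M : ℕ} (f : (V → ℕ) → ℝ) {y : FinOp V}
    (hy : y.support ⊆ box V M ×ˢ box V M) :
    tmom M f (truncGen ℓ d α lam M y.toTraceClass) = mom f (lindbladian ℓ d α lam y) := by
  rw [← Finsupp.sum_single y, Finsupp.sum, map_sum, map_sum, map_sum, map_sum, map_sum]
  refine Finset.sum_congr rfl fun p hp => ?_
  obtain ⟨hn, hm⟩ := Finset.mem_product.1 (hy hp)
  have h : (Finsupp.single p (y p) : FinOp V) = y p • Finsupp.single (p.1, p.2) 1 := by simp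
  rw [h, map_smul, map_smul, map_smul, map_smul, map_smul, toTraceClass_single, one_smul,
    tmom_truncGen_ketbra ℓ d α lam f hn hm]

end Truncation

/-! ### Operators of polynomial growth -/

section PolynomialGrowth

open TraceClass

variable {V : Type*} [Fintype V] [DecidableEq V]

/-- `φ` is supported in the box, and its `ℓ¹`-norm is at most `c`. -/
def IsBoxBounded (M : ℕ) (c : ℝ) (φ : FinVec V) : Prop :=
  (∀ n ∉ box V M, φ n = 0) ∧ ∑ n ∈ box V M, ‖φ n‖ ≤ c

theorem IsBoxBounded.mono {M N : ℕ} {c c' : ℝ} {φ : FinVec V} (h : IsBoxBounded M c φ)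
    (hMN : M ≤ N) (hc : c ≤ c') : IsBoxBounded N c' φ := by
  refine ⟨fun n hn => h.1 n fun h' => hn (box_mono hMN h'), ?_⟩
  rw [← Finset.sum_subset (box_mono hMN) fun n _ hn => by rw [h.1 n hn, norm_zero]]
  exact h.2.trans hc

theorem IsBoxBounded.add {M : ℕ} {c c' : ℝ} {φ ψ : FinVec V} (h : IsBoxBounded M c φ)
    (h' : IsBoxBounded M c' ψ) : IsBoxBounded M (c + c') (φ + ψ) := by
  refine ⟨fun n hn => by rw [Finsupp.add_apply, h.1 n hn, h'.1 n hn, add_zero], ?_⟩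
  calc _ ≤ ∑ n ∈ box V M, (‖φ n‖ + ‖ψ n‖) := Finset.sum_le_sum fun n _ => norm_add_le _ _
    _ ≤ _ := by
      rw [Finset.sum_add_distrib]
      exact add_le_add h.2 h'.2

theorem IsBoxBounded.smul {M : ℕ} {c : ℝ} {φ : FinVec V} (h : IsBoxBounded M c φ) (a : ℂ) :
    IsBoxBounded M (‖a‖ * c) (a • φ) := by
  refine ⟨fun n hn => by rw [Finsupp.smul_apply, h.1 n hn, smul_zero], ?_⟩
  simp only [Finsupp.smul_apply, norm_smul, ← Finset.mul_sum]
  exact mul_le_mul_of_nonneg_left h.2 (norm_nonneg a)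

theorem isBoxBounded_zero (M : ℕ) : IsBoxBounded M 0 (0 : FinVec V) :=
  ⟨fun _ _ => rfl, by simp⟩

theorem IsBoxBounded.sum {M : ℕ} {ι : Type*} (s : Finset ι) {c : ι → ℝ} {φ : ι → FinVec V}
    (h : ∀ i ∈ s, IsBoxBounded M (c i) (φ i)) :
    IsBoxBounded M (∑ i ∈ s, c i) (∑ i ∈ s, φ i) := by
  classical
  induction s using Finset.induction_on with
  | empty => simpa using isBoxBounded_zero M
  | insert a s ha ih =>
    rw [Finset.sum_insert ha, Finset.sum_insert ha]
    exact (h a (Finset.mem_insert_self a s)).add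
      (ih fun i hi => h i (Finset.mem_insert_of_mem hi))

theorem isBoxBounded_single {M : ℕ} {n : V → ℕ} (hn : n ∈ box V M) (c : ℂ) :
    IsBoxBounded M ‖c‖ (Finsupp.single n c) := by
  refine ⟨fun m hm => ?_, ?_⟩
  · rw [Finsupp.single_apply, if_neg]
    rintro rfl
    exact hm hn
  · rw [Finset.sum_eq_single n]
    · simp
    · intro m _ hm
      rw [Finsupp.single_apply, if_neg hm.symm, norm_zero]
    · exact fun h => absurd hn h

theorem IsBoxBounded.map {M N : ℕ} {c b : ℝ} {φ : FinVec V} (h : IsBoxBounded M c φ)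
    (hb : 0 ≤ b) {A : Module.End ℂ (FinVec V)}
    (hA : ∀ n ∈ box V M, IsBoxBounded N b (A (Finsupp.single n 1))) :
    IsBoxBounded N (c * b) (A φ) := by
  have h1 : A φ = ∑ n ∈ box V M, φ n • A (Finsupp.single n 1) := by
    have : φ = ∑ n ∈ box V M, φ n • Finsupp.single n (1 : ℂ) := by
      conv_lhs => rw [← Finsupp.sum_single φ, Finsupp.sum_of_support_subset φ
        (s := box V M) (fun n hn => by
          by_contra h'
          exact (Finsupp.mem_support_iff.1 hn) (h.1 n h')) _ (by simp)]
      simp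
    conv_lhs => rw [this]
    rw [map_sum]
    exact Finset.sum_congr rfl fun n _ => map_smul _ _ _
  rw [h1]
  refine (IsBoxBounded.sum _ fun n hn => (hA n hn).smul (φ n)).mono le_rfl ?_
  rw [← Finset.sum_mul]
  exact mul_le_mul_of_nonneg_right h.2 hb

theorem IsBoxBounded.norm_vec_le {M : ℕ} {c : ℝ} {φ : FinVec V} (h : IsBoxBounded M c φ) :
    ‖vec φ‖ ≤ c := by
  rw [vec, Finsupp.linearCombination_apply, Finsupp.sum_of_support_subset φ
    (s := box V M) (fun n hn => by
      by_contra h'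
      exact (Finsupp.mem_support_iff.1 hn) (h.1 n h')) _ (by simp)]
  refine (norm_sum_le _ _).trans (le_trans (le_of_eq ?_) h.2)
  simp [norm_smul]

/-- `A` maps the box of size `M` to the box of size `M + D`, with an `ℓ¹`-norm of order
`(M + 1) ^ D`. -/
def HasPolyGrowth (D : ℕ) (A : Module.End ℂ (FinVec V)) : Prop :=
  ∃ C : ℝ, 0 ≤ C ∧ ∀ M, ∀ n ∈ box V M,
    IsBoxBounded (M + D) (C * ((M : ℝ) + 1) ^ D) (A (Finsupp.single n 1))

namespace HasPolyGrowth

variable {D D' : ℕ} {A B : Module.End ℂ (FinVec V)}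

theorem mono (h : HasPolyGrowth D A) (hD : D ≤ D') : HasPolyGrowth D' A := by
  obtain ⟨C, hC, h⟩ := h
  refine ⟨C, hC, fun M n hn => (h M n hn).mono (by lia) ?_⟩
  gcongr
  simp

theorem add (hA : HasPolyGrowth D A) (hB : HasPolyGrowth D B) : HasPolyGrowth D (A + B) := by
  obtain ⟨C, hC, hA⟩ := hA
  obtain ⟨C', hC', hB⟩ := hB
  refine ⟨C + C', by positivity, fun M n hn => ?_⟩
  rw [add_mul]
  exact (hA M n hn).add (hB M n hn)

theorem smul (hA : HasPolyGrowth D A) (c : ℂ) : HasPolyGrowth D (c • A) := by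
  obtain ⟨C, hC, hA⟩ := hA
  refine ⟨‖c‖ * C, by positivity, fun M n hn => ?_⟩
  rw [mul_assoc]
  exact (hA M n hn).smul c

theorem sub (hA : HasPolyGrowth D A) (hB : HasPolyGrowth D B) : HasPolyGrowth D (A - B) := by
  have h : A - B = A + (-1 : ℂ) • B := by module
  rw [h]
  exact hA.add (hB.smul _)

theorem zero (D : ℕ) : HasPolyGrowth D (0 : Module.End ℂ (FinVec V)) :=
  ⟨0, le_rfl, fun M n _ => by simpa using isBoxBounded_zero (V := V) (M + D)⟩

theorem one : HasPolyGrowth 0 (1 : Module.End ℂ (FinVec V)) :=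
  ⟨1, zero_le_one, fun M n hn => by simpa using isBoxBounded_single hn 1⟩

theorem mul (hA : HasPolyGrowth D A) (hB : HasPolyGrowth D' B) :
    HasPolyGrowth (D' + D) (A * B) := by
  obtain ⟨C, hC, hA⟩ := hA
  obtain ⟨C', hC', hB⟩ := hB
  refine ⟨C' * (C * ((D' : ℝ) + 1) ^ D), by positivity, fun M n hn => ?_⟩
  rw [Module.End.mul_apply, ← add_assoc]
  refine ((hB M n hn).map (b := C * (((M + D' : ℕ) : ℝ) + 1) ^ D) (by positivity)
    (hA (M + D'))).mono le_rfl ?_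
  have h1 : ((M + D' : ℕ) : ℝ) + 1 ≤ ((D' : ℝ) + 1) * ((M : ℝ) + 1) := by
    push_cast
    have : (0 : ℝ) ≤ D' * M := by positivity
    linarith
  calc C' * ((M : ℝ) + 1) ^ D' * (C * (((M + D' : ℕ) : ℝ) + 1) ^ D)
      ≤ C' * ((M : ℝ) + 1) ^ D' * (C * (((D' : ℝ) + 1) * ((M : ℝ) + 1)) ^ D) := by gcongr
    _ = _ := by
      rw [mul_pow, pow_add]
      ring

theorem pow (hA : HasPolyGrowth D A) (r : ℕ) : HasPolyGrowth (r * D) (A ^ r) := by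
  induction r with
  | zero => simpa using one
  | succ r ih => simpa [pow_succ', add_mul] using hA.mul ih

theorem sum {ι : Type*} (s : Finset ι) {A : ι → Module.End ℂ (FinVec V)}
    (h : ∀ i ∈ s, HasPolyGrowth D (A i)) : HasPolyGrowth D (∑ i ∈ s, A i) :=
  Finset.sum_induction _ (HasPolyGrowth D) (fun _ _ => add) (zero D) h

theorem ann (j : V) : HasPolyGrowth 1 (ann j) := by
  refine ⟨1, zero_le_one, fun M n hn => ?_⟩
  have h := mem_box.1 hn
  rw [ann_single]
  refine (isBoxBounded_single (mem_box.2 fun i => ?_) _).mono le_rfl ?_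
  · by_cases hi : i = j
    · subst hi
      rw [Function.update_self]
      have := h i
      lia
    · rw [Function.update_of_ne hi]
      have := h i
      lia
  · rw [one_mul, one_mul, Complex.norm_real, Real.norm_of_nonneg (Real.sqrt_nonneg _), pow_one]
    have h2 : (n j : ℝ) ≤ M := by exact_mod_cast h j
    refine Real.sqrt_le_iff.2 ⟨by positivity, ?_⟩
    nlinarith [(Nat.cast_nonneg M : (0 : ℝ) ≤ M)]

theorem cre (j : V) : HasPolyGrowth 1 (cre j) := by
  refine ⟨1, zero_le_one, fun M n hn => ?_⟩
  have h := mem_box.1 hn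
  rw [cre_single]
  refine (isBoxBounded_single (mem_box.2 fun i => ?_) _).mono le_rfl ?_
  · by_cases hi : i = j
    · subst hi
      rw [Function.update_self]
      have := h i
      lia
    · rw [Function.update_of_ne hi]
      have := h i
      lia
  · rw [one_mul, one_mul, Complex.norm_real, Real.norm_of_nonneg (Real.sqrt_nonneg _), pow_one]
    have h2 : (n j : ℝ) ≤ M := by exact_mod_cast h j
    refine Real.sqrt_le_iff.2 ⟨by positivity, ?_⟩
    nlinarith [(Nat.cast_nonneg M : (0 : ℝ) ≤ M)]

theorem driftOp (ℓ d : ℕ) (α : V → ℂ) (lam : V → (Fin 4 → ℕ) → ℂ) :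
    ∃ D, HasPolyGrowth D (driftOp ℓ d α lam) := by
  have key : ∀ (j : V) (p r : ℕ), HasPolyGrowth (p + r) (BosonicQMS.ann j ^ p *
      BosonicQMS.cre j ^ r) := fun j p r => by
    simpa [add_comm] using ((ann j).pow p).mul ((cre j).pow r)
  refine ⟨2 * (d + ℓ), ?_⟩
  unfold BosonicQMS.driftOp
  refine sub (smul (sum _ fun j _ => ?_) _) (smul (sum _ fun j _ => ?_) _)
  · rw [twoBodyTerm_self]
    refine sum _ fun u hu => ?_
    have hu' : u 0 + u 1 + u 2 + u 3 ≤ d := by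
      have := (Finset.mem_filter.1 hu).2
      simpa [Fin.sum_univ_four] using this
    exact ((((key j _ _).mono (by lia)).smul _)).add (((key j _ _).mono (by lia)).smul _)
  · have h1 : HasPolyGrowth ℓ (jump ℓ α j) := by
      refine sub ?_ ((one.mono (Nat.zero_le _)).smul _)
      simpa using (ann j).pow ℓ
    have h2 : HasPolyGrowth ℓ (jumpAdj ℓ α j) := by
      refine sub ?_ ((one.mono (Nat.zero_le _)).smul _)
      simpa using (cre j).pow ℓ
    exact (h2.mul h1).mono (by lia)

end HasPolyGrowth

end PolynomialGrowth

/-! ### Semigroups of the truncated generators and their uniform moment bounds -/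

section TruncatedSemigroup

open TraceClass

variable {V : Type*} [Fintype V] [DecidableEq V]
variable (ℓ d : ℕ) (α : V → ℂ) (lam : V → (Fin 4 → ℕ) → ℂ)

/-- The semigroup of the truncated generator. -/
def truncSemigroup (M : ℕ) (t : ℝ) : TraceClass (Fock V) →L[ℂ] TraceClass (Fock V) :=
  expSemigroup (truncGen ℓ d α lam M) t

theorem truncSemigroup_zero (M : ℕ) : truncSemigroup ℓ d α lam M 0 = 1 := expSemigroup_zero _

theorem truncSemigroup_add (M : ℕ) (s t : ℝ) : truncSemigroup ℓ d α lam M (s + t) =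
    truncSemigroup ℓ d α lam M s * truncSemigroup ℓ d α lam M t := expSemigroup_add _ _ _

theorem hasDerivAt_truncSemigroup_apply (M : ℕ) (X : TraceClass (Fock V)) (t : ℝ) :
    HasDerivAt (fun s => truncSemigroup ℓ d α lam M s X)
      (truncGen ℓ d α lam M (truncSemigroup ℓ d α lam M t X)) t :=
  hasDerivAt_expSemigroup_apply' _ _ _

theorem isCompletelyPositive_truncSemigroup (M : ℕ) {t : ℝ} (ht : 0 ≤ t) :
    IsCompletelyPositive (truncSemigroup ℓ d α lam M t) :=
  isCompletelyPositive_expSemigroup _ _ ht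

theorem trace_truncSemigroup (M : ℕ) (t : ℝ) (X : TraceClass (Fock V)) :
    trace (truncSemigroup ℓ d α lam M t X) = trace X :=
  trace_expSemigroup (compress_trace_condition ℓ d α lam M) t X

theorem norm_truncSemigroup_apply_le (M : ℕ) {t : ℝ} (ht : 0 ≤ t) (X : TraceClass (Fock V)) :
    ‖truncSemigroup ℓ d α lam M t X‖ ≤ ‖X‖ :=
  norm_expSemigroup_apply_le (compress_trace_condition ℓ d α lam M) ht X

theorem cutoff_truncSemigroup {M : ℕ} {X : TraceClass (Fock V)} (hX : cutoff V M X = X) (t : ℝ) :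
    cutoff V M (truncSemigroup ℓ d α lam M t X) = truncSemigroup ℓ d α lam M t X := by
  have h := commute_expSemigroup (commute_cutoff_truncGen ℓ d α lam M) t
  have h2 := DFunLike.congr_fun h.eq X
  simp only [mul_apply_eq_comp, hX] at h2
  exact h2

theorem cutoff_cutoff (M : ℕ) (X : TraceClass (Fock V)) :
    cutoff V M (cutoff V M X) = cutoff V M X :=
  ext_entry fun n m => by
    rw [entry_cutoff]
    split_ifs with h
    · rfl
    · rw [entry_cutoff, if_neg h]

/-! ### Moments along the truncated semigroup -/

theorem re_tmom_truncGen_le {k : ℝ} (hk : 1 ≤ k) {ℓ : ℕ} (hℓ : 2 ≤ ℓ) (α : V → ℂ) {d : ℕ}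
    (hd : d ≤ 2 * (ℓ - 1)) (lam : V → (Fin 4 → ℕ) → ℂ) {M : ℕ} {X : TraceClass (Fock V)}
    (hX : (toCLM X).IsPositive) (hc : cutoff V M X = X) (i : V) :
    (tmom M (fun n => ((n i : ℝ) + 1) ^ k) (truncGen ℓ d α lam M X)).re ≤
      -((ℓ : ℝ) / 2) * (tmom M (fun n => ((n i : ℝ) + 1) ^ (k + ℓ - 1)) X).re +
        ℓ / 2 * muConst ℓ k (⨆ j, ‖α j‖) (hamiltonianSize d lam) * (trace X).re := by
  obtain ⟨y, hy, rfl⟩ : ∃ y : FinOp V, y.support ⊆ box V M ×ˢ box V M ∧ y.toTraceClass = X :=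
    ⟨truncate M X, support_truncate M X, by rw [toTraceClass_truncate, hc]⟩
  rw [tmom_truncGen ℓ d α lam _ hy, tmom_toTraceClass, ← mom_one]
  · exact mom_lindbladian_le hk hℓ α hd lam hX i
  · intro n hn
    by_contra h
    exact hn (Finset.mem_product.1 (hy (Finsupp.mem_support_iff.2 h))).1

theorem hasDerivAt_re_tmom_truncSemigroup (M : ℕ) (f : (V → ℕ) → ℝ) (X : TraceClass (Fock V))
    (t : ℝ) : HasDerivAt (fun s => (tmom M f (truncSemigroup ℓ d α lam M s X)).re)
      (tmom M f (truncGen ℓ d α lam M (truncSemigroup ℓ d α lam M t X))).re t :=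
  (Complex.reCLM ∘L (tmom M f).restrictScalars ℝ).hasFDerivAt.comp_hasDerivAt t
    (hasDerivAt_truncSemigroup_apply ℓ d α lam M X t)

theorem re_entry_nonneg {X : TraceClass (Fock V)} (hX : (toCLM X).IsPositive) (n : V → ℕ) :
    0 ≤ (entry n n X).re := (Complex.nonneg_iff.1 (hX.inner_nonneg_right (ket n))).1

theorem re_tmom (M : ℕ) (f : (V → ℕ) → ℝ) (X : TraceClass (Fock V)) :
    (tmom M f X).re = ∑ n ∈ box V M, f n * (entry n n X).re := by
  rw [tmom_apply, Complex.re_sum]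
  simp only [Complex.re_ofReal_mul]

theorem re_tmom_nonneg (M : ℕ) {f : (V → ℕ) → ℝ} (hf : ∀ n, 0 ≤ f n) {X : TraceClass (Fock V)}
    (hX : (toCLM X).IsPositive) : 0 ≤ (tmom M f X).re := by
  rw [re_tmom]
  exact Finset.sum_nonneg fun n _ => mul_nonneg (hf n) (re_entry_nonneg hX n)

/-- Dropping the dissipative term leaves at most linear growth in time, with a rate that does not
depend on `M`. -/
theorem re_tmom_truncSemigroup_le {k : ℝ} (hk : 1 ≤ k) {ℓ : ℕ} (hℓ : 2 ≤ ℓ) (α : V → ℂ) {d : ℕ}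
    (hd : d ≤ 2 * (ℓ - 1)) (lam : V → (Fin 4 → ℕ) → ℂ) {M : ℕ} {X : TraceClass (Fock V)}
    (hX : (toCLM X).IsPositive) (hc : cutoff V M X = X) (i : V) {t : ℝ} (ht : 0 ≤ t) :
    (tmom M (fun n => ((n i : ℝ) + 1) ^ k) (truncSemigroup ℓ d α lam M t X)).re ≤
      (tmom M (fun n => ((n i : ℝ) + 1) ^ k) X).re +
        ℓ / 2 * muConst ℓ k (⨆ j, ‖α j‖) (hamiltonianSize d lam) * (trace X).re * t := by
  set f : (V → ℕ) → ℝ := fun n => ((n i : ℝ) + 1) ^ k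
  have hderiv := hasDerivAt_re_tmom_truncSemigroup ℓ d α lam M f X
  have h := Convex.image_sub_le_mul_sub_of_deriv_le (convex_Icc 0 t)
    (f := fun s => (tmom M f (truncSemigroup ℓ d α lam M s X)).re)
    (C := ℓ / 2 * muConst ℓ k (⨆ j, ‖α j‖) (hamiltonianSize d lam) * (trace X).re)
    (fun s _ => (hderiv s).continuousAt.continuousWithinAt)
    (fun s _ => (hderiv s).differentiableAt.differentiableWithinAt) (fun s hs => ?_)
    0 ⟨le_rfl, ht⟩ t ⟨ht, le_rfl⟩ ht
  · simp only [truncSemigroup_zero, one_apply_eq_self, sub_zero] at h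
    linarith
  · rw [(hderiv s).deriv]
    rw [interior_Icc] at hs
    have hpos := (isCompletelyPositive_truncSemigroup ℓ d α lam M hs.1.le).isPositive hX
    have h1 := re_tmom_truncGen_le hk hℓ α hd lam hpos (cutoff_truncSemigroup ℓ d α lam hc s) i
    rw [trace_truncSemigroup] at h1
    have h2 := re_tmom_nonneg M (f := fun n => ((n i : ℝ) + 1) ^ (k + ℓ - 1))
      (fun n => by positivity) hpos
    have h3 : 0 ≤ (ℓ : ℝ) / 2 * (tmom M (fun n => ((n i : ℝ) + 1) ^ (k + ℓ - 1))
      (truncSemigroup ℓ d α lam M s X)).re := mul_nonneg (by positivity) h2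
    linarith

/-! ### Dependence of the truncated generator on the truncation -/

theorem norm_proj_le (M : ℕ) (x : Fock V) : ‖proj V M x‖ ≤ ‖x‖ := by
  have h1 : ‖proj V M x‖ * ‖proj V M x‖ ≤ ‖x‖ * ‖proj V M x‖ := by
    calc _ = ‖inner ℂ (proj V M x) (proj V M x)‖ := by
          rw [inner_self_eq_norm_sq_to_K, norm_pow, RCLike.norm_ofReal, abs_norm, sq]
      _ = ‖inner ℂ x (proj V M x)‖ := by rw [← inner_proj_right, proj_comp_proj]
      _ ≤ _ := norm_inner_le_norm _ _
  rcases (norm_nonneg (proj V M x)).eq_or_lt with h | h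
  · rw [← h]
    exact norm_nonneg x
  · exact le_of_mul_le_mul_right h1 h

theorem compress_ket_of_isBoxBounded {M D : ℕ} {c : ℝ} {A : Module.End ℂ (FinVec V)} {n : V → ℕ}
    (hn : n ∈ box V M) (hA : IsBoxBounded D c (A (Finsupp.single n 1))) {N : ℕ} (hD : D ≤ N)
    (hM : M ≤ N) : compress N A (ket n) = vec (A (Finsupp.single n 1)) := by
  rw [compress_ket, if_pos (box_mono hM hn), proj_vec_of_support fun m hm =>
    hA.1 m fun h => hm (box_mono hD h)]

/-- A basis vector at depth `D` inside the box is mapped into the box, so neither compression cuts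
its image. In the boundary layer both images have at most polynomial size. -/
theorem norm_compress_sub_le {D : ℕ} {C : ℝ} {A : Module.End ℂ (FinVec V)}
    (hA : ∀ M, ∀ n ∈ box V M,
      IsBoxBounded (M + D) (C * ((M : ℝ) + 1) ^ D) (A (Finsupp.single n 1)))
    {M N : ℕ} (hD : D ≤ M) (hMN : M ≤ N) {n : V → ℕ} (hn : n ∈ box V M) :
    ‖compress N A (ket n) - compress M A (ket n)‖ ≤
      2 * (C * ((M : ℝ) + 1) ^ D) * if n ∈ box V (M - D) then 0 else 1 := by
  split_ifs with h
  · have hb := hA _ n h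
    rw [compress_ket_of_isBoxBounded h hb (by lia) (by lia),
      compress_ket_of_isBoxBounded h hb (by lia) (by lia), sub_self, norm_zero, mul_zero]
  · rw [compress_ket, compress_ket, if_pos hn, if_pos (box_mono hMN hn)]
    have h1 := (hA M n hn).norm_vec_le
    have h2 := norm_proj_le N (vec (A (Finsupp.single n 1)))
    have h3 := norm_proj_le M (vec (A (Finsupp.single n 1)))
    have h4 := norm_sub_le (proj V N (vec (A (Finsupp.single n 1))))
      (proj V M (vec (A (Finsupp.single n 1))))
    linarith

theorem norm_truncGen_sub_ketbra_le {M N : ℕ} (hMN : M ≤ N) {n m : V → ℕ} (hn : n ∈ box V M)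
    (hm : m ∈ box V M) :
    ‖truncGen ℓ d α lam N (ketbra (ket n) (ket m)) -
        truncGen ℓ d α lam M (ketbra (ket n) (ket m))‖ ≤
      ‖compress N (driftOp ℓ d α lam) (ket n) - compress M (driftOp ℓ d α lam) (ket n)‖ +
      ‖compress N (driftOp ℓ d α lam) (ket m) - compress M (driftOp ℓ d α lam) (ket m)‖ := by
  rw [truncGen, truncGen, boundedLindbladian_ketbra, boundedLindbladian_ketbra]
  simp only [compress_jump_ket ℓ α _ hn, compress_jump_ket ℓ α _ hm,
    compress_jump_ket ℓ α _ (box_mono hMN hn), compress_jump_ket ℓ α _ (box_mono hMN hm)]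
  rw [add_sub_add_right_eq_sub, add_sub_add_comm, ← ketbra_sub_left, ← ketbra_sub_right]
  refine (norm_add_le _ _).trans (add_le_add ?_ ?_)
  · simpa using norm_ketbra_le (compress N (driftOp ℓ d α lam) (ket n) -
      compress M (driftOp ℓ d α lam) (ket n)) (ket m)
  · simpa using norm_ketbra_le (ket n) (compress N (driftOp ℓ d α lam) (ket m) -
      compress M (driftOp ℓ d α lam) (ket m))

theorem eq_sum_ketbra {M : ℕ} {X : TraceClass (Fock V)} (hc : cutoff V M X = X) :
    X = ∑ n ∈ box V M, ∑ m ∈ box V M, entry n m X • ketbra (ket n) (ket m) := by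
  conv_lhs => rw [← hc, ← toTraceClass_truncate, truncate]
  simp only [map_sum, toTraceClass_single]

theorem norm_truncGen_sub_le {D : ℕ} {C : ℝ}
    (hA : ∀ M, ∀ n ∈ box V M,
      IsBoxBounded (M + D) (C * ((M : ℝ) + 1) ^ D) (driftOp ℓ d α lam (Finsupp.single n 1)))
    {M N : ℕ} (hD : D ≤ M) (hMN : M ≤ N) {X : TraceClass (Fock V)} (hc : cutoff V M X = X) :
    ‖truncGen ℓ d α lam N X - truncGen ℓ d α lam M X‖ ≤ 2 * (C * ((M : ℝ) + 1) ^ D) *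
      ∑ n ∈ box V M, ∑ m ∈ box V M, ‖entry n m X‖ *
        ((if n ∈ box V (M - D) then 0 else 1) + if m ∈ box V (M - D) then 0 else 1) := by
  have h1 : truncGen ℓ d α lam N X - truncGen ℓ d α lam M X =
      ∑ n ∈ box V M, ∑ m ∈ box V M, entry n m X •
        (truncGen ℓ d α lam N (ketbra (ket n) (ket m)) -
          truncGen ℓ d α lam M (ketbra (ket n) (ket m))) := by
    conv_lhs => rw [eq_sum_ketbra hc]
    simp only [map_sum, map_smul, smul_sub, Finset.sum_sub_distrib]
  rw [h1, Finset.mul_sum]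
  refine (norm_sum_le _ _).trans (Finset.sum_le_sum fun n hn => ?_)
  rw [Finset.mul_sum]
  refine (norm_sum_le _ _).trans (Finset.sum_le_sum fun m hm => ?_)
  rw [norm_smul, mul_left_comm]
  refine mul_le_mul_of_nonneg_left ?_ (norm_nonneg _)
  rw [mul_add]
  exact (norm_truncGen_sub_ketbra_le ℓ d α lam hMN hn hm).trans
    (add_le_add (norm_compress_sub_le hA hD hMN hn) (norm_compress_sub_le hA hD hMN hm))

/-- An abstract estimate of off-diagonal mass near the boundary. Here `x` stands for the moduli of
the matrix elements, `A` and `C` for diagonals of positive operators, and `h` for the indicator of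
the layer. The index in the layer receives the large factor `a` against its small mass `ε`, the free
index the small factor `a⁻¹`; this is why both weightings of AM-GM are assumed. -/
theorem sum_sum_mul_add_le {ι : Type*} (B : Finset ι) {x : ι → ι → ℝ} {A C h : ι → ℝ} {a ε : ℝ}
    (ha : 0 < a) (hA : ∀ p ∈ B, 0 ≤ A p) (hC : ∀ p ∈ B, 0 ≤ C p)
    (hx : ∀ p ∈ B, ∀ q ∈ B, x p q ≤ (a * A p + a⁻¹ * C q) / 2)
    (hx' : ∀ p ∈ B, ∀ q ∈ B, x p q ≤ (a⁻¹ * A p + a * C q) / 2)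
    (h0 : ∀ p ∈ B, 0 ≤ h p) (h1 : ∀ p ∈ B, h p ≤ 1) (hA1 : ∑ p ∈ B, A p ≤ 1)
    (hC1 : ∑ p ∈ B, C p ≤ 1) (hAε : ∑ p ∈ B, h p * A p ≤ ε) (hCε : ∑ p ∈ B, h p * C p ≤ ε) :
    ∑ p ∈ B, ∑ q ∈ B, x p q * (h p + h q) ≤ B.card * (a * ε + a⁻¹) := by
  have key : ∀ A C : ι → ℝ, (∀ p ∈ B, 0 ≤ A p) → (∀ p ∈ B, 0 ≤ C p) → ∑ p ∈ B, C p ≤ 1 →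
      ∑ p ∈ B, h p * A p ≤ ε →
      ∑ p ∈ B, ∑ q ∈ B, (a * A p + a⁻¹ * C q) / 2 * h p ≤ B.card * (a * ε + a⁻¹) / 2 := by
    intro A C hA hC hC1 hAε
    calc _ ≤ ∑ p ∈ B, ∑ q ∈ B, (a * (h p * A p) + a⁻¹ * C q) / 2 := by
          refine Finset.sum_le_sum fun p hp => Finset.sum_le_sum fun q hq => ?_
          have : a⁻¹ * C q * h p ≤ a⁻¹ * C q :=
            mul_le_of_le_one_right (mul_nonneg (inv_nonneg.2 ha.le) (hC q hq)) (h1 p hp)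
          linarith
      _ = B.card * (a * ∑ p ∈ B, h p * A p + a⁻¹ * ∑ q ∈ B, C q) / 2 := by
          simp only [← Finset.sum_div, Finset.sum_add_distrib, Finset.sum_const, nsmul_eq_mul,
            ← Finset.mul_sum]
          ring
      _ ≤ B.card * (a * ε + a⁻¹ * 1) / 2 := by gcongr
      _ = _ := by rw [mul_one]
  have k1 := key A C hA hC hC1 hAε
  have k2 := key C A hC hA hA1 hCε
  rw [Finset.sum_comm] at k2
  calc _ ≤ ∑ p ∈ B, ∑ q ∈ B, ((a * A p + a⁻¹ * C q) / 2 * h p +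
        (a * C q + a⁻¹ * A p) / 2 * h q) := by
        refine Finset.sum_le_sum fun p hp => Finset.sum_le_sum fun q hq => ?_
        have e1 := mul_le_mul_of_nonneg_right (hx p hp q hq) (h0 p hp)
        have e2 := mul_le_mul_of_nonneg_right (hx' p hp q hq) (h0 q hq)
        linarith
    _ ≤ _ := by
        simp only [Finset.sum_add_distrib]
        linarith

/-- Markov's inequality: off the smaller box some `n i + 1` is at least `(M + 1) / 2`. -/
theorem indicator_box_le {D M s : ℕ} (hM : 2 * D ≤ M) (n : V → ℕ) :
    (if n ∈ box V (M - D) then 0 else 1 : ℝ) ≤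
      2 ^ s / ((M : ℝ) + 1) ^ s * ∑ i, ((n i : ℝ) + 1) ^ (s : ℝ) := by
  split_ifs with h
  · positivity
  · obtain ⟨i, hi⟩ : ∃ i, M - D < n i := by
      by_contra! h'
      exact h (mem_box.2 h')
    have h1 : (M : ℝ) + 1 ≤ 2 * ((n i : ℝ) + 1) := by
      have : M + 1 ≤ 2 * (n i + 1) := by lia
      exact_mod_cast this
    calc (1 : ℝ) ≤ (2 * ((n i : ℝ) + 1)) ^ s / ((M : ℝ) + 1) ^ s := by
          rw [one_le_div (by positivity)]
          gcongr
      _ = 2 ^ s / ((M : ℝ) + 1) ^ s * ((n i : ℝ) + 1) ^ (s : ℝ) := by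
          rw [Real.rpow_natCast, mul_pow]
          ring
      _ ≤ _ := by
          gcongr
          exact Finset.single_le_sum (f := fun i => ((n i : ℝ) + 1) ^ (s : ℝ))
            (fun i _ => by positivity) (Finset.mem_univ i)

theorem sum_indicator_mul_entry_le {D M s : ℕ} (hM : 2 * D ≤ M) {X : TraceClass (Fock V)}
    (hX : (toCLM X).IsPositive) :
    ∑ n ∈ box V M, (if n ∈ box V (M - D) then 0 else 1 : ℝ) * (entry n n X).re ≤
      2 ^ s / ((M : ℝ) + 1) ^ s *
        ∑ i, (tmom M (fun n : V → ℕ => ((n i : ℝ) + 1) ^ (s : ℝ)) X).re := by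
  simp only [re_tmom]
  rw [Finset.sum_comm, Finset.mul_sum]
  refine Finset.sum_le_sum fun n _ => ?_
  rw [← Finset.sum_mul, ← mul_assoc]
  exact mul_le_mul_of_nonneg_right (indicator_box_le hM n) (re_entry_nonneg hX n)

theorem sum_re_entry_le_trace {X : TraceClass (Fock V)} (hX : (toCLM X).IsPositive)
    (B : Finset (V → ℕ)) : ∑ n ∈ B, (entry n n X).re ≤ (trace X).re :=
  sum_le_hasSum B (fun n _ => re_entry_nonneg hX n) ((hasSum_trace X).mapL Complex.reCLM)

theorem cutoff_ketbra_of_mem {M : ℕ} {n m : V → ℕ} (hn : n ∈ box V M) (hm : m ∈ box V M) :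
    cutoff V M (ketbra (ket n) (ket m)) = ketbra (ket n) (ket m) := by
  rw [cutoff_ketbra_ket, if_pos ⟨hn, hm⟩]

theorem tmom_ketbra {M : ℕ} (f : (V → ℕ) → ℝ) {n : V → ℕ} (hn : n ∈ box V M) :
    tmom M f (ketbra (ket n) (ket n)) = f n := by
  rw [tmom_apply, Finset.sum_eq_single n]
  · simp [entry_ketbra]
  · intro m _ hm
    simp [entry_ketbra, inner_ket_ket, hm]
  · exact fun h => absurd hn h

theorem norm_entry_ketbra_le {Φ : TraceClass (Fock V) →L[ℂ] TraceClass (Fock V)}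
    (hΦ : IsCompletelyPositive Φ) (n m p q : V → ℕ) {a : ℝ} (ha : 0 < a) :
    ‖entry p q (Φ (ketbra (ket n) (ket m)))‖ ≤
      (a * (entry p p (Φ (ketbra (ket n) (ket n)))).re +
        a⁻¹ * (entry q q (Φ (ketbra (ket m) (ket m)))).re) / 2 := by
  have h := hΦ.norm_inner_ketbra_le (((√a : ℝ) : ℂ) • ket n) ((((√a)⁻¹ : ℝ) : ℂ) • ket m)
    (ket p) (ket q)
  have hs : √a ≠ 0 := (Real.sqrt_pos.2 ha).ne'
  simp only [ketbra_smul_left, ketbra_smul_right, Complex.conj_ofReal, smul_smul, map_smul,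
    ← Complex.ofReal_mul, Real.mul_self_sqrt ha.le, inv_mul_cancel₀ hs,
    smul_apply, inner_smul_right, ← mul_inv, Complex.re_ofReal_mul, Complex.ofReal_one,
    one_mul] at h
  exact h

/-- The generators differ only through the boundary layer, where the evolved states have mass of
order `(M+1)^(-s)` by the uniform bound on the moment of order `s`. Complete positivity passes this
smallness from `|n⟩⟨n|` and `|m⟩⟨m|` to the off-diagonal `|n⟩⟨m|`. -/
theorem exists_norm_truncGen_sub_ketbra_le {ℓ : ℕ} (hℓ : 2 ≤ ℓ) (α : V → ℂ) {d : ℕ}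
    (hd : d ≤ 2 * (ℓ - 1)) (lam : V → (Fin 4 → ℕ) → ℂ) (n m : V → ℕ) (τ : ℝ) :
    ∃ (C : ℝ) (M₀ : ℕ), ∀ M N : ℕ, M₀ ≤ M → M ≤ N → ∀ t ∈ Set.Icc 0 τ,
      ‖truncGen ℓ d α lam N (truncSemigroup ℓ d α lam M t (ketbra (ket n) (ket m))) -
        truncGen ℓ d α lam M (truncSemigroup ℓ d α lam M t (ketbra (ket n) (ket m)))‖ ≤
          C / ((M : ℝ) + 1) := by
  obtain ⟨D, C, hC, hA⟩ := HasPolyGrowth.driftOp ℓ d α lam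
  obtain ⟨Mn, hMn⟩ := exists_mem_box n
  obtain ⟨Mm, hMm⟩ := exists_mem_box m
  -- With `b = M + 1`, the drift costs `b^D` and the size of the box `b^(card V)`. Weighting AM-GM
  -- by `a = b^r` against layer mass of order `b^(-2r)` gains `b^(-r)`, so this `r` leaves exactly
  -- `1 / b`, and moments of order `s = 2r` are needed.
  set r := D + Fintype.card V + 1 with hr
  set s := 2 * r with hs
  have hs1 : (1 : ℝ) ≤ (s : ℝ) := by
    have : 1 ≤ s := by lia
    exact_mod_cast this
  set μ := muConst ℓ s (⨆ j, ‖α j‖) (hamiltonianSize d lam)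
  have hμ : 0 ≤ μ := muConst_nonneg hs1 hℓ (iSup_norm_nonneg α) (hamiltonianSize_nonneg d lam)
  set U : (V → ℕ) → ℝ := fun n => ∑ i, (((n i : ℝ) + 1) ^ (s : ℝ) + ℓ / 2 * μ * τ)
  refine ⟨2 * C * (2 ^ s * max (U n) (U m) + 1), max (2 * D) (max Mn Mm), ?_⟩
  intro M N hM hMN t ht
  have hMD : 2 * D ≤ M := (le_max_left _ _).trans hM
  have hnM : n ∈ box V M :=
    box_mono ((le_max_left _ _).trans ((le_max_right _ _).trans hM)) hMn
  have hmM : m ∈ box V M :=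
    box_mono ((le_max_right _ _).trans ((le_max_right _ _).trans hM)) hMm
  have hcp := isCompletelyPositive_truncSemigroup ℓ d α lam M ht.1
  have hpos : ∀ n : V → ℕ, (toCLM (truncSemigroup ℓ d α lam M t
      (ketbra (ket n) (ket n)))).IsPositive := fun n => hcp.isPositive (isPositive_ketbra _)
  have htr : ∀ n : V → ℕ, (trace (truncSemigroup ℓ d α lam M t
      (ketbra (ket n) (ket n)))).re = 1 := fun n => by
    rw [trace_truncSemigroup, trace_ketbra, inner_ket_ket, if_pos rfl, Complex.one_re]
  have hmom : ∀ n ∈ box V M, ∑ i, (tmom M (fun n : V → ℕ => ((n i : ℝ) + 1) ^ (s : ℝ))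
      (truncSemigroup ℓ d α lam M t (ketbra (ket n) (ket n)))).re ≤ U n := fun n hn => by
    refine Finset.sum_le_sum fun i _ => ?_
    refine (re_tmom_truncSemigroup_le hs1 hℓ α hd lam (isPositive_ketbra _)
      (cutoff_ketbra_of_mem hn hn) i ht.1).trans ?_
    rw [tmom_ketbra _ hn, trace_ketbra, inner_ket_ket, if_pos rfl, Complex.one_re, mul_one,
      Complex.ofReal_re]
    gcongr
    exact ht.2
  set b : ℝ := (M : ℝ) + 1 with hb
  have hb0 : 0 < b := by positivity
  have hind : ∀ n ∈ box V M, ∀ c : ℝ, U n ≤ c →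
      ∑ p ∈ box V M, (if p ∈ box V (M - D) then 0 else 1 : ℝ) *
        (entry p p (truncSemigroup ℓ d α lam M t (ketbra (ket n) (ket n)))).re ≤
      2 ^ s / b ^ s * c := fun n hn c hc => by
    refine (sum_indicator_mul_entry_le (s := s) hMD (hpos n)).trans ?_
    gcongr
    exact (hmom n hn).trans hc
  refine (norm_truncGen_sub_le ℓ d α lam hA (by lia) hMN
    (cutoff_truncSemigroup ℓ d α lam (cutoff_ketbra_of_mem hnM hmM) t)).trans ?_
  have hsum := sum_sum_mul_add_le (box V M) (a := b ^ r)
    (x := fun p q => ‖entry p q (truncSemigroup ℓ d α lam M t (ketbra (ket n) (ket m)))‖)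
    (h := fun p => if p ∈ box V (M - D) then 0 else 1) (pow_pos hb0 r)
    (fun p _ => re_entry_nonneg (hpos n) p) (fun p _ => re_entry_nonneg (hpos m) p)
    (fun p _ q _ => norm_entry_ketbra_le hcp n m p q (pow_pos hb0 r))
    (fun p _ q _ => by
      simpa using norm_entry_ketbra_le hcp n m p q (inv_pos.2 (pow_pos hb0 r)))
    (fun p _ => by split_ifs <;> norm_num) (fun p _ => by split_ifs <;> norm_num)
    ((sum_re_entry_le_trace (hpos n) _).trans (htr n).le)
    ((sum_re_entry_le_trace (hpos m) _).trans (htr m).le)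
    (hind n hnM _ (le_max_left _ _)) (hind m hmM _ (le_max_right _ _))
  refine (mul_le_mul_of_nonneg_left hsum (by positivity)).trans (le_of_eq ?_)
  rw [card_box, hs, hr, Nat.cast_pow, Nat.cast_add, Nat.cast_one, ← hb]
  field_simp
  ring

theorem exists_norm_truncGen_sub_toTraceClass_le {ℓ : ℕ} (hℓ : 2 ≤ ℓ) (α : V → ℂ) {d : ℕ}
    (hd : d ≤ 2 * (ℓ - 1)) (lam : V → (Fin 4 → ℕ) → ℂ) (y : FinOp V) (τ : ℝ) :
    ∃ (C : ℝ) (M₀ : ℕ), ∀ M N : ℕ, M₀ ≤ M → M ≤ N → ∀ t ∈ Set.Icc 0 τ,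
      ‖truncGen ℓ d α lam N (truncSemigroup ℓ d α lam M t y.toTraceClass) -
        truncGen ℓ d α lam M (truncSemigroup ℓ d α lam M t y.toTraceClass)‖ ≤
          C / ((M : ℝ) + 1) := by
  induction y using Finsupp.induction_linear with
  | zero => exact ⟨0, 0, fun M N _ _ t _ => by simp⟩
  | add y z hy hz =>
    obtain ⟨C, M₀, h⟩ := hy
    obtain ⟨C', M₀', h'⟩ := hz
    refine ⟨C + C', max M₀ M₀', fun M N hM hN t ht => ?_⟩
    have e1 := h M N ((le_max_left _ _).trans hM) hN t ht
    have e2 := h' M N ((le_max_right _ _).trans hM) hN t ht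
    simp only [map_add]
    rw [add_sub_add_comm, add_div]
    exact (norm_add_le _ _).trans (add_le_add e1 e2)
  | single p c =>
    obtain ⟨C, M₀, h⟩ := exists_norm_truncGen_sub_ketbra_le hℓ α hd lam p.1 p.2 τ
    refine ⟨‖c‖ * C, M₀, fun M N hM hN t ht => ?_⟩
    simp only [toTraceClass_single, map_smul]
    rw [← smul_sub, norm_smul, mul_div_assoc]
    exact mul_le_mul_of_nonneg_left (h M N hM hN t ht) (norm_nonneg c)

end TruncatedSemigroup

/-! ### The limit of the truncated semigroups -/

section LimitSemigroup

open TraceClass Filter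

variable {V : Type*} [Fintype V] [DecidableEq V]

theorem hasDerivAt_clm_apply {F : Type*} [NormedAddCommGroup F] [NormedSpace ℂ F]
    {A : ℝ → F →L[ℂ] F} {x : ℝ → F} {A' : F →L[ℂ] F} {x' : F} {s : ℝ} (hA : HasDerivAt A A' s)
    (hx : HasDerivAt x x' s) : HasDerivAt (fun s => A s (x s)) (A s x' + A' (x s)) s := by
  have h := ((isBoundedBilinearMap_apply (𝕜 := ℂ) (E := F) (F := F)).hasFDerivAt
    (A s, x s)).restrictScalars ℝ
  exact h.comp_hasDerivAt s (hA.prodMk hx)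

/-- Duhamel's formula: along `s ↦ T^N_(t-s) T^M_s X` the derivative is `T^N_(t-s) (G_M - G_N) T^M_s
X`, and `T^N` is a contraction. -/
theorem norm_truncSemigroup_sub_le {ℓ d : ℕ} {α : V → ℂ} {lam : V → (Fin 4 → ℕ) → ℂ} {M N : ℕ}
    {X : TraceClass (Fock V)} {τ ε : ℝ}
    (h : ∀ t ∈ Set.Icc 0 τ, ‖truncGen ℓ d α lam N (truncSemigroup ℓ d α lam M t X) -
      truncGen ℓ d α lam M (truncSemigroup ℓ d α lam M t X)‖ ≤ ε) {t : ℝ}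
    (ht : t ∈ Set.Icc 0 τ) :
    ‖truncSemigroup ℓ d α lam N t X - truncSemigroup ℓ d α lam M t X‖ ≤ ε * t := by
  have hd : ∀ s, HasDerivAt
      (fun s => truncSemigroup ℓ d α lam N (t - s) (truncSemigroup ℓ d α lam M s X))
      (truncSemigroup ℓ d α lam N (t - s)
        (truncGen ℓ d α lam M (truncSemigroup ℓ d α lam M s X)) +
        (-(truncSemigroup ℓ d α lam N (t - s) * truncGen ℓ d α lam N))
          (truncSemigroup ℓ d α lam M s X)) s := fun s => by
    refine hasDerivAt_clm_apply ?_ (hasDerivAt_truncSemigroup_apply ℓ d α lam M X s)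
    have := (hasDerivAt_expSemigroup (truncGen ℓ d α lam N) (t - s)).scomp s
      ((hasDerivAt_id s).const_sub t)
    rw [neg_one_smul] at this
    exact this
  have h1 := norm_image_sub_le_of_norm_deriv_le_segment' (a := 0) (b := t) (C := ε)
    (fun s _ => (hd s).hasDerivWithinAt) (fun s hs => ?_) t ⟨ht.1, le_rfl⟩
  · simp only [sub_self, truncSemigroup_zero, one_apply_eq_self, sub_zero] at h1
    rwa [norm_sub_rev]
  · simp only [neg_apply, mul_apply_eq_comp]
    rw [← sub_eq_add_neg, ← map_sub, ← norm_neg, ← map_neg, neg_sub]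
    exact (norm_truncSemigroup_apply_le ℓ d α lam N (sub_nonneg.2 hs.2.le) _).trans
      (h s ⟨hs.1, hs.2.le.trans ht.2⟩)

theorem exists_norm_truncSemigroup_sub_le {ℓ : ℕ} (hℓ : 2 ≤ ℓ) (α : V → ℂ) {d : ℕ}
    (hd : d ≤ 2 * (ℓ - 1)) (lam : V → (Fin 4 → ℕ) → ℂ) (y : FinOp V) (τ : ℝ) {ε : ℝ}
    (hε : 0 < ε) :
    ∃ M₀ : ℕ, ∀ M N : ℕ, M₀ ≤ M → M ≤ N → ∀ t ∈ Set.Icc 0 τ,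
      ‖truncGen ℓ d α lam N (truncSemigroup ℓ d α lam M t y.toTraceClass) -
        truncGen ℓ d α lam M (truncSemigroup ℓ d α lam M t y.toTraceClass)‖ ≤ ε ∧
      ‖truncSemigroup ℓ d α lam N t y.toTraceClass -
        truncSemigroup ℓ d α lam M t y.toTraceClass‖ ≤ ε := by
  obtain ⟨C, M₀, h⟩ := exists_norm_truncGen_sub_toTraceClass_le hℓ α hd lam y τ
  have hlim : Tendsto (fun M : ℕ => C / ((M : ℝ) + 1)) atTop (𝓝 0) :=
    tendsto_const_div_atTop_nhds_zero_nat C |>.comp (tendsto_add_atTop_nat 1) |>.congr fun M => by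
      simp
  have hlim' : Tendsto (fun M : ℕ => C / ((M : ℝ) + 1) * τ) atTop (𝓝 0) := by
    simpa using hlim.mul_const τ
  obtain ⟨M₁, h1⟩ := eventually_atTop.1 ((hlim.eventually_le_const hε).and
    (hlim'.eventually_le_const hε))
  refine ⟨max M₀ M₁, fun M N hM hN t ht => ?_⟩
  have h2 := h1 M ((le_max_right _ _).trans hM)
  have h3 := h M N ((le_max_left _ _).trans hM) hN
  refine ⟨(h3 t ht).trans h2.1, (norm_truncSemigroup_sub_le h3 ht).trans ?_⟩
  have h4 : 0 ≤ C / ((M : ℝ) + 1) := (norm_nonneg _).trans (h3 t ht)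
  exact (mul_le_mul_of_nonneg_left ht.2 h4).trans h2.2

theorem cauchySeq_truncSemigroup {ℓ : ℕ} (hℓ : 2 ≤ ℓ) (α : V → ℂ) {d : ℕ}
    (hd : d ≤ 2 * (ℓ - 1)) (lam : V → (Fin 4 → ℕ) → ℂ) {t : ℝ} (ht : 0 ≤ t)
    (X : TraceClass (Fock V)) : CauchySeq fun M => truncSemigroup ℓ d α lam M t X := by
  rw [Metric.cauchySeq_iff']
  intro ε hε
  obtain ⟨y, hy⟩ := denseRange_toTraceClass.exists_dist_lt X (by positivity : 0 < ε / 4)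
  obtain ⟨M, hM⟩ := exists_norm_truncSemigroup_sub_le hℓ α hd lam y t (by positivity : 0 < ε / 4)
  refine ⟨M, fun N hN => ?_⟩
  have h1 := (hM M N le_rfl hN t ⟨ht, le_rfl⟩).2
  have h2 := norm_truncSemigroup_apply_le ℓ d α lam N ht (X - y.toTraceClass)
  have h3 := norm_truncSemigroup_apply_le ℓ d α lam M ht (y.toTraceClass - X)
  rw [map_sub] at h2 h3
  rw [dist_eq_norm] at hy ⊢
  rw [norm_sub_rev] at hy
  rw [norm_sub_rev X] at h2
  calc _ = ‖(truncSemigroup ℓ d α lam N t X - truncSemigroup ℓ d α lam N t y.toTraceClass) +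
        (truncSemigroup ℓ d α lam N t y.toTraceClass -
          truncSemigroup ℓ d α lam M t y.toTraceClass) +
        (truncSemigroup ℓ d α lam M t y.toTraceClass - truncSemigroup ℓ d α lam M t X)‖ := by
        congr 1
        abel
    _ ≤ _ := norm_add₃_le
    _ < ε := by linarith

/-- `T` is the strong limit of the truncated semigroups. -/
def IsTruncationLimit (ℓ d : ℕ) (α : V → ℂ) (lam : V → (Fin 4 → ℕ) → ℂ)
    (T : ℝ≥0 → TraceClass (Fock V) →L[ℂ] TraceClass (Fock V)) : Prop :=
  ∀ (t : ℝ≥0) (X), Tendsto (fun M => truncSemigroup ℓ d α lam M t X) atTop (𝓝 (T t X))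

theorem exists_isTruncationLimit {ℓ : ℕ} (hℓ : 2 ≤ ℓ) (α : V → ℂ) {d : ℕ}
    (hd : d ≤ 2 * (ℓ - 1)) (lam : V → (Fin 4 → ℕ) → ℂ) :
    ∃ T, IsTruncationLimit ℓ d α lam T := by
  have h : ∀ (t : ℝ≥0) X, ∃ Y, Tendsto (fun M => truncSemigroup ℓ d α lam M t X) atTop (𝓝 Y) :=
    fun t X => cauchySeq_tendsto_of_complete (cauchySeq_truncSemigroup hℓ α hd lam t.2 X)
  choose f hf using h
  exact ⟨fun t => continuousLinearMapOfTendsto (fun M => truncSemigroup ℓ d α lam M t)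
    (tendsto_pi_nhds.2 (hf t)), fun t X => hf t X⟩

/-! ### The generator on `𝒯_f` -/

/-- A finite operator and its image under the drift fit into a large enough box, where nothing is
cut. -/
theorem exists_truncGen_toTraceClass (ℓ d : ℕ) (α : V → ℂ) (lam : V → (Fin 4 → ℕ) → ℂ)
    (y : FinOp V) : ∃ M₀ : ℕ, ∀ M, M₀ ≤ M →
      truncGen ℓ d α lam M y.toTraceClass = (lindbladian ℓ d α lam y).toTraceClass := by
  induction y using Finsupp.induction_linear with
  | zero => exact ⟨0, fun M _ => by simp⟩
  | add y z hy hz =>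
    obtain ⟨M₀, h⟩ := hy
    obtain ⟨M₁, h'⟩ := hz
    refine ⟨max M₀ M₁, fun M hM => ?_⟩
    rw [map_add, map_add, map_add, map_add, h M ((le_max_left _ _).trans hM),
      h' M ((le_max_right _ _).trans hM)]
  | single p c =>
    obtain ⟨n, m⟩ := p
    obtain ⟨D, C, hC, hA⟩ := HasPolyGrowth.driftOp ℓ d α lam
    obtain ⟨Mn, hMn⟩ := exists_mem_box n
    obtain ⟨Mm, hMm⟩ := exists_mem_box m
    have hn : n ∈ box V (max Mn Mm) := box_mono (le_max_left _ _) hMn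
    have hm : m ∈ box V (max Mn Mm) := box_mono (le_max_right _ _) hMm
    refine ⟨max Mn Mm + D, fun M hM => ?_⟩
    have h : (Finsupp.single (n, m) c : FinOp V) = c • Finsupp.single (n, m) 1 := by simp
    have hM' : max Mn Mm ≤ M := by lia
    rw [h, map_smul, map_smul, map_smul, map_smul, toTraceClass_single, one_smul,
      toTraceClass_lindbladian_single, truncGen, boundedLindbladian_ketbra,
      compress_ket_of_isBoxBounded hn (hA _ n hn) hM hM',
      compress_ket_of_isBoxBounded hm (hA _ m hm) hM hM']
    simp only [compress_jump_ket ℓ α _ (box_mono hM' hn), compress_jump_ket ℓ α _ (box_mono hM' hm)]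

theorem norm_truncSemigroup_sub_self_sub_le (ℓ d : ℕ) (α : V → ℂ) (lam : V → (Fin 4 → ℕ) → ℂ)
    {M : ℕ} {X : TraceClass (Fock V)} {t ε : ℝ} (ht : 0 ≤ t)
    (h : ∀ s ∈ Set.Icc 0 t, ‖truncSemigroup ℓ d α lam M s (truncGen ℓ d α lam M X) -
      truncGen ℓ d α lam M X‖ ≤ ε) :
    ‖truncSemigroup ℓ d α lam M t X - X - (t : ℂ) • truncGen ℓ d α lam M X‖ ≤ ε * t := by
  have hd : ∀ s : ℝ, HasDerivAt
      (fun s : ℝ => truncSemigroup ℓ d α lam M s X - s • truncGen ℓ d α lam M X)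
      (truncSemigroup ℓ d α lam M s (truncGen ℓ d α lam M X) - (1 : ℝ) • truncGen ℓ d α lam M X)
      s := fun s =>
    (hasDerivAt_expSemigroup_apply _ X s).sub ((hasDerivAt_id s).smul_const _)
  have h1 := norm_image_sub_le_of_norm_deriv_le_segment' (a := 0) (b := t) (C := ε)
    (fun s _ => (hd s).hasDerivWithinAt) (fun s hs => ?_) t ⟨ht, le_rfl⟩
  · simp only [truncSemigroup_zero, one_apply_eq_self, zero_smul, sub_zero] at h1
    rwa [sub_right_comm, Complex.coe_smul]
  · rw [one_smul]
    exact h s ⟨hs.1, hs.2.le⟩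

namespace IsTruncationLimit

variable {ℓ d : ℕ} {α : V → ℂ} {lam : V → (Fin 4 → ℕ) → ℂ}
  {T : ℝ≥0 → TraceClass (Fock V) →L[ℂ] TraceClass (Fock V)}

theorem norm_apply_le (hT : IsTruncationLimit ℓ d α lam T) (t : ℝ≥0) (X : TraceClass (Fock V)) :
    ‖T t X‖ ≤ ‖X‖ :=
  le_of_tendsto (hT t X).norm (Eventually.of_forall fun M =>
    norm_truncSemigroup_apply_le ℓ d α lam M t.2 X)

theorem isCompletelyPositive (hT : IsTruncationLimit ℓ d α lam T) (t : ℝ≥0) :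
    IsCompletelyPositive (T t) :=
  IsCompletelyPositive.of_tendsto
    (fun M => isCompletelyPositive_truncSemigroup ℓ d α lam M t.2) (hT t)

theorem zero (hT : IsTruncationLimit ℓ d α lam T) :
    T 0 = ContinuousLinearMap.id ℂ (TraceClass (Fock V)) := by
  ext1 X
  refine tendsto_nhds_unique (hT 0 X) ?_
  simp only [NNReal.coe_zero, truncSemigroup_zero, one_apply_eq_self]
  exact tendsto_const_nhds

theorem add (hT : IsTruncationLimit ℓ d α lam T) (s t : ℝ≥0) : T (s + t) = (T s).comp (T t) := by
  ext1 X
  refine tendsto_nhds_unique (hT (s + t) X) ?_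
  have h1 : Tendsto (fun M => truncSemigroup ℓ d α lam M s
      (truncSemigroup ℓ d α lam M t X - T t X)) atTop (𝓝 0) := by
    refine squeeze_zero_norm (fun M => norm_truncSemigroup_apply_le ℓ d α lam M s.2 _) ?_
    simpa using ((hT t X).sub_const (T t X)).norm
  have h2 := h1.add (hT s (T t X))
  rw [zero_add] at h2
  refine h2.congr fun M => ?_
  rw [map_sub, sub_add_cancel, NNReal.coe_add, truncSemigroup_add, mul_apply_eq_comp]

theorem trace_apply (hT : IsTruncationLimit ℓ d α lam T) (t : ℝ≥0) (X : TraceClass (Fock V)) :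
    trace (T t X) = trace X := by
  refine tendsto_nhds_unique (((traceL V).continuous.tendsto _).comp (hT t X)) ?_
  simp only [Function.comp_def, traceL_apply, trace_truncSemigroup]
  exact tendsto_const_nhds

/-- The first-order expansion of `T` at `𝒯_f`. -/
theorem norm_sub_self_sub_le (hT : IsTruncationLimit ℓ d α lam T) (hℓ : 2 ≤ ℓ)
    (hd : d ≤ 2 * (ℓ - 1)) (y : FinOp V) {t : ℝ≥0} {ε : ℝ}
    (h : ∀ s ≤ t, ‖T s (lindbladian ℓ d α lam y).toTraceClass -
      (lindbladian ℓ d α lam y).toTraceClass‖ ≤ ε) :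
    ‖T t y.toTraceClass - y.toTraceClass -
      ((t : ℝ) : ℂ) • (lindbladian ℓ d α lam y).toTraceClass‖ ≤ ε * t := by
  set z := (lindbladian ℓ d α lam y).toTraceClass with hz
  -- The truncated semigroup satisfies the expansion by integrating its derivative. It is `η`-close
  -- to `T` uniformly on `[0, t]` for large `M`, which costs `η` in the bound.
  have key : ∀ η > 0, ‖T t y.toTraceClass - y.toTraceClass - ((t : ℝ) : ℂ) • z‖ ≤
      (ε + η) * t := by
    intro η hη
    obtain ⟨M₀, h0⟩ := exists_norm_truncSemigroup_sub_le hℓ α hd lam (lindbladian ℓ d α lam y)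
      (t : ℝ) hη
    obtain ⟨M₁, h1⟩ := exists_truncGen_toTraceClass ℓ d α lam y
    refine le_of_tendsto (((hT t y.toTraceClass).sub_const _).sub_const _).norm
      (eventually_atTop.2 ⟨max M₀ M₁, fun M hM => ?_⟩)
    have hM1 := h1 M ((le_max_right _ _).trans hM)
    rw [hz, ← hM1]
    refine norm_truncSemigroup_sub_self_sub_le ℓ d α lam t.2 fun s hs => ?_
    lift s to ℝ≥0 using hs.1
    rw [hM1, ← hz]
    have e1 : ‖T s z - truncSemigroup ℓ d α lam M s z‖ ≤ η :=
      le_of_tendsto ((hT s z).sub_const _).norm (eventually_atTop.2 ⟨M, fun N hN =>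
        (h0 M N ((le_max_left _ _).trans hM) hN s hs).2⟩)
    have e2 := h s (by exact_mod_cast hs.2)
    rw [norm_sub_rev] at e1
    calc _ = ‖(truncSemigroup ℓ d α lam M s z - T s z) + (T s z - z)‖ := by
          congr 1
          abel
      _ ≤ _ := norm_add_le _ _
      _ ≤ _ := by linarith
  have hlim : Tendsto (fun η : ℝ => (ε + η) * t) (𝓝[>] 0) (𝓝 (ε * t)) := by
    have : Tendsto (fun η : ℝ => (ε + η) * t) (𝓝 0) (𝓝 ((ε + 0) * t)) :=
      (Continuous.tendsto (by fun_prop) 0)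
    rw [add_zero] at this
    exact this.mono_left nhdsWithin_le_nhds
  exact ge_of_tendsto hlim (eventually_nhdsWithin_of_forall key)

theorem norm_sub_self_le (hT : IsTruncationLimit ℓ d α lam T) (hℓ : 2 ≤ ℓ)
    (hd : d ≤ 2 * (ℓ - 1)) (y : FinOp V) (t : ℝ≥0) :
    ‖T t y.toTraceClass - y.toTraceClass‖ ≤ 3 * ‖(lindbladian ℓ d α lam y).toTraceClass‖ * t := by
  set z := (lindbladian ℓ d α lam y).toTraceClass with hz
  -- Contractivity alone supplies the crude `ε = 2 ‖z‖`. The resulting Lipschitz bound on `𝒯_f`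
  -- yields strong continuity, which then permits arbitrarily small `ε`.
  have h := hT.norm_sub_self_sub_le hℓ hd y (t := t) (ε := 2 * ‖z‖) fun s _ => by
    have := hT.norm_apply_le s z
    have h2 := norm_sub_le (T s z) z
    linarith
  have h3 := norm_add_le (T t y.toTraceClass - y.toTraceClass - ((t : ℝ) : ℂ) • z)
    (((t : ℝ) : ℂ) • z)
  rw [sub_add_cancel, norm_smul, Complex.norm_real, Real.norm_of_nonneg t.coe_nonneg] at h3
  have h4 : (t : ℝ) * ‖z‖ = ‖z‖ * t := mul_comm _ _
  calc _ ≤ _ := h3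
    _ ≤ _ := by linarith

theorem tendsto_zero (hT : IsTruncationLimit ℓ d α lam T) (hℓ : 2 ≤ ℓ)
    (hd : d ≤ 2 * (ℓ - 1)) (X : TraceClass (Fock V)) :
    Tendsto (fun t => T t X) (𝓝 0) (𝓝 X) := by
  rw [Metric.tendsto_nhds]
  intro ε hε
  obtain ⟨y, hy⟩ := denseRange_toTraceClass.exists_dist_lt X (by positivity : 0 < ε / 4)
  have hlim : Tendsto (fun t : ℝ≥0 => 3 * ‖(lindbladian ℓ d α lam y).toTraceClass‖ * (t : ℝ)) (𝓝 0)
      (𝓝 0) := by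
    have : Tendsto (fun t : ℝ≥0 => 3 * ‖(lindbladian ℓ d α lam y).toTraceClass‖ * (t : ℝ)) (𝓝 0)
      (𝓝 (3 * ‖(lindbladian ℓ d α lam y).toTraceClass‖ * ((0 : ℝ≥0) : ℝ))) :=
      Continuous.tendsto (by fun_prop) 0
    simpa using this
  filter_upwards [hlim.eventually_lt_const (by positivity : (0 : ℝ) < ε / 4)] with t ht
  have h1 := hT.norm_sub_self_le hℓ hd y t
  have h2 := hT.norm_apply_le t (X - y.toTraceClass)
  rw [map_sub] at h2
  rw [dist_eq_norm] at hy ⊢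
  have h3 := norm_add₃_le (a := T t X - T t y.toTraceClass)
    (b := T t y.toTraceClass - y.toTraceClass) (c := y.toTraceClass - X)
  rw [sub_add_sub_cancel, sub_add_sub_cancel] at h3
  rw [norm_sub_rev y.toTraceClass X] at h3
  linarith

theorem isQMS (hT : IsTruncationLimit ℓ d α lam T) (hℓ : 2 ≤ ℓ) (hd : d ≤ 2 * (ℓ - 1)) :
    IsQMS T where
  zero := hT.zero
  add := hT.add
  continuous_zero X := (hT.tendsto_zero hℓ hd X).mono_left nhdsWithin_le_nhds
  completelyPositive := hT.isCompletelyPositive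
  trace_preserving := hT.trace_apply

theorem norm_sub_self_sub_le_of_mem_closure (hT : IsTruncationLimit ℓ d α lam T) (hℓ : 2 ≤ ℓ)
    (hd : d ≤ 2 * (ℓ - 1)) {p : TraceClass (Fock V) × TraceClass (Fock V)}
    (hp : p ∈ closure (Set.range fun x : FinOp V =>
      (x.toTraceClass, (lindbladian ℓ d α lam x).toTraceClass))) {t : ℝ≥0} {ε : ℝ}
    (h : ∀ s ≤ t, ‖T s p.2 - p.2‖ ≤ ε) :
    ‖T t p.1 - p.1 - ((t : ℝ) : ℂ) • p.2‖ ≤ ε * t := by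
  obtain ⟨q, hq, hlim⟩ := mem_closure_iff_seq_limit.1 hp
  choose x hx using hq
  have h1 : Tendsto (fun j => (x j).toTraceClass) atTop (𝓝 p.1) := by
    have := (continuous_fst.tendsto p).comp hlim
    refine this.congr fun j => ?_
    rw [Function.comp_apply, ← hx j]
  have h2 : Tendsto (fun j => (lindbladian ℓ d α lam (x j)).toTraceClass) atTop (𝓝 p.2) := by
    have := (continuous_snd.tendsto p).comp hlim
    refine this.congr fun j => ?_
    rw [Function.comp_apply, ← hx j]
  have hl : Tendsto (fun j => ‖T t (x j).toTraceClass - (x j).toTraceClass -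
      ((t : ℝ) : ℂ) • (lindbladian ℓ d α lam (x j)).toTraceClass‖) atTop
      (𝓝 ‖T t p.1 - p.1 - ((t : ℝ) : ℂ) • p.2‖) :=
    (((((T t).continuous.tendsto _).comp h1).sub h1).sub (h2.const_smul _)).norm
  have hr : Tendsto (fun j => (ε + 2 * ‖(lindbladian ℓ d α lam (x j)).toTraceClass - p.2‖) * t)
      atTop (𝓝 ((ε + 2 * ‖p.2 - p.2‖) * t)) :=
    (((h2.sub_const p.2).norm.const_mul 2).const_add ε).mul_const _
  rw [sub_self, norm_zero, mul_zero, add_zero] at hr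
  refine le_of_tendsto_of_tendsto' hl hr fun j => ?_
  refine hT.norm_sub_self_sub_le hℓ hd (x j) fun s hs => ?_
  set z := (lindbladian ℓ d α lam (x j)).toTraceClass
  have e1 := hT.norm_apply_le s (z - p.2)
  rw [map_sub] at e1
  have e3 := norm_add₃_le (a := T s z - T s p.2) (b := T s p.2 - p.2) (c := p.2 - z)
  rw [sub_add_sub_cancel, sub_add_sub_cancel, norm_sub_rev p.2 z] at e3
  have := h s hs
  linarith

theorem closure_subset_generatorGraph (hT : IsTruncationLimit ℓ d α lam T) (hℓ : 2 ≤ ℓ)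
    (hd : d ≤ 2 * (ℓ - 1)) :
    closure (Set.range fun x : FinOp V =>
      (x.toTraceClass, (lindbladian ℓ d α lam x).toTraceClass)) ⊆ generatorGraph T := by
  intro p hp
  rw [generatorGraph, Set.mem_ofPred_eq, Metric.tendsto_nhds]
  intro ε hε
  have h1 := Metric.tendsto_nhds.1 (hT.tendsto_zero hℓ hd p.2) (ε / 2) (by positivity)
  obtain ⟨δ, hδ, h2⟩ := Metric.eventually_nhds_iff.1 h1
  have h3 : ∀ᶠ t : ℝ≥0 in 𝓝[>] 0, dist t 0 < δ :=
    (Metric.eventually_nhds_iff.2 ⟨δ, hδ, fun _ h => h⟩ : ∀ᶠ t : ℝ≥0 in 𝓝 0, dist t 0 < δ).filter_mono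
      nhdsWithin_le_nhds
  filter_upwards [h3, self_mem_nhdsWithin] with t ht ht0
  have ht0' : (0 : ℝ) < t := ht0
  have h4 := hT.norm_sub_self_sub_le_of_mem_closure hℓ hd hp (t := t) (ε := ε / 2) fun s hs => by
    rw [← dist_eq_norm]
    refine (h2 (lt_of_le_of_lt ?_ ht)).le
    rw [NNReal.dist_eq, NNReal.dist_eq, NNReal.coe_zero, sub_zero, sub_zero, abs_of_nonneg s.coe_nonneg,
      abs_of_nonneg t.coe_nonneg]
    exact_mod_cast hs
  have hc : ((t : ℝ) : ℂ) ≠ 0 := by exact_mod_cast ht0'.ne'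
  have h5 : (((t : ℝ) : ℂ))⁻¹ • (T t p.1 - p.1) - p.2 =
      (((t : ℝ) : ℂ))⁻¹ • (T t p.1 - p.1 - ((t : ℝ) : ℂ) • p.2) := by
    rw [smul_sub _ (T t p.1 - p.1), smul_smul, inv_mul_cancel₀ hc, one_smul]
  rw [dist_eq_norm, h5, norm_smul, norm_inv, Complex.norm_real, Real.norm_of_nonneg t.coe_nonneg]
  calc _ ≤ (t : ℝ)⁻¹ * (ε / 2 * t) := by gcongr
    _ = ε / 2 := by field_simp
    _ < ε := by linarith

theorem generatorGraph_sub {p q : TraceClass (Fock V) × TraceClass (Fock V)}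
    (hp : p ∈ generatorGraph T) (hq : q ∈ generatorGraph T) : p - q ∈ generatorGraph T := by
  refine (Tendsto.sub hp hq).congr fun t => ?_
  rw [← smul_sub, Prod.fst_sub, map_sub]
  congr 1
  abel

/-- Dissipativity of the generator. -/
theorem norm_le_norm_sub (hT : IsTruncationLimit ℓ d α lam T)
    {p : TraceClass (Fock V) × TraceClass (Fock V)} (hp : p ∈ generatorGraph T) :
    ‖p.1‖ ≤ ‖p.1 - p.2‖ := by
  have : (𝓝[>] (0 : ℝ≥0)).NeBot := inferInstance
  refine ge_of_tendsto (Tendsto.norm (Tendsto.sub (tendsto_const_nhds (x := p.1)) hp)) ?_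
  filter_upwards [self_mem_nhdsWithin] with t ht0
  have ht0' : (0 : ℝ) < t := ht0
  have h1 := hT.norm_apply_le t p.1
  have h2 : p.1 - ((t : ℝ) : ℂ)⁻¹ • (T t p.1 - p.1) =
      ((1 + (t : ℝ)⁻¹ : ℝ) : ℂ) • p.1 - ((t : ℝ) : ℂ)⁻¹ • T t p.1 := by
    push_cast
    module
  have h3 := norm_sub_norm_le (((1 + (t : ℝ)⁻¹ : ℝ) : ℂ) • p.1) (((t : ℝ) : ℂ)⁻¹ • T t p.1)
  rw [h2]
  rw [norm_smul, norm_smul, Complex.norm_real, Real.norm_of_nonneg (by positivity), norm_inv,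
    Complex.norm_real, Real.norm_of_nonneg t.coe_nonneg] at h3
  have h4 := mul_le_mul_of_nonneg_left h1 (inv_nonneg.2 ht0'.le)
  linarith

end IsTruncationLimit

theorem exists_cutoff_toTraceClass (y : FinOp V) :
    ∃ M₀ : ℕ, ∀ M, M₀ ≤ M → cutoff V M y.toTraceClass = y.toTraceClass := by
  induction y using Finsupp.induction_linear with
  | zero => exact ⟨0, fun M _ => by simp⟩
  | add y z hy hz =>
    obtain ⟨M₀, h⟩ := hy
    obtain ⟨M₁, h'⟩ := hz
    refine ⟨max M₀ M₁, fun M hM => ?_⟩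
    rw [map_add, map_add, h M ((le_max_left _ _).trans hM), h' M ((le_max_right _ _).trans hM)]
  | single p c =>
    obtain ⟨Mn, hMn⟩ := exists_mem_box p.1
    obtain ⟨Mm, hMm⟩ := exists_mem_box p.2
    refine ⟨max Mn Mm, fun M hM => ?_⟩
    rw [toTraceClass_single, map_smul, cutoff_ketbra_of_mem
      (box_mono ((le_max_left _ _).trans hM) hMn) (box_mono ((le_max_right _ _).trans hM) hMm)]

/-- The range of `1 - 𝓛` on `𝒯_f` is dense in `𝒯₁`. -/
theorem exists_norm_sub_lindbladian_sub_le {ℓ : ℕ} (hℓ : 2 ≤ ℓ) (α : V → ℂ) {d : ℕ}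
    (hd : d ≤ 2 * (ℓ - 1)) (lam : V → (Fin 4 → ℕ) → ℂ) (y : FinOp V) {ε : ℝ} (hε : 0 < ε) :
    ∃ z : FinOp V, ‖z.toTraceClass - (lindbladian ℓ d α lam z).toTraceClass - y.toTraceClass‖ ≤
      ε := by
  obtain ⟨τ, hτ, hτ0⟩ : ∃ τ : ℝ, Real.exp (-τ) * ‖y.toTraceClass‖ ≤ ε / 2 ∧ 0 ≤ τ := by
    have : Tendsto (fun τ : ℝ => Real.exp (-τ) * ‖y.toTraceClass‖) atTop (𝓝 0) := by
      simpa using (Real.tendsto_exp_neg_atTop_nhds_zero).mul_const ‖y.toTraceClass‖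
    exact ((this.eventually_le_const (by positivity : (0 : ℝ) < ε / 2)).and
      (eventually_ge_atTop 0)).exists
  obtain ⟨M₀, h0⟩ := exists_norm_truncSemigroup_sub_le hℓ α hd lam y τ
    (by positivity : 0 < ε / (2 * (τ + 1)))
  obtain ⟨M₁, h1⟩ := exists_cutoff_toTraceClass y
  set M := max M₀ M₁
  have hc := h1 M (le_max_right _ _)
  -- The integrand of the Laplace transform of the truncated semigroup at `1`. The cut at `τ` was
  -- chosen so that `g τ` is at most `ε / 2`, and `M` so that the change of generators, integrated
  -- over `[0, τ]`, is too.
  set g : ℝ → TraceClass (Fock V) := fun s =>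
    Real.exp (-s) • truncSemigroup ℓ d α lam M s y.toTraceClass with hg
  have hgc : Continuous g := by
    refine (Real.continuous_exp.comp continuous_neg).smul ?_
    exact (continuous_iff_continuousAt.2 fun s =>
      (hasDerivAt_truncSemigroup_apply ℓ d α lam M y.toTraceClass s).continuousAt)
  have hgi : IntervalIntegrable g MeasureTheory.volume 0 τ := hgc.intervalIntegrable _ _
  set Z : TraceClass (Fock V) := ∫ s in (0 : ℝ)..τ, g s with hZ
  have hcomm : ∀ Φ : TraceClass (Fock V) →L[ℂ] TraceClass (Fock V),
      Φ Z = ∫ s in (0 : ℝ)..τ, Φ (g s) := fun Φ =>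
    (Φ.intervalIntegral_comp_comm hgi).symm
  have hcZ : cutoff V M Z = Z := by
    rw [hcomm, hZ]
    refine intervalIntegral.integral_congr fun s _ => ?_
    simp only [hg, ContinuousLinearMap.map_smul_of_tower]
    rw [cutoff_truncSemigroup ℓ d α lam hc]
  have hz : (truncate M Z).toTraceClass = Z := by rw [toTraceClass_truncate, hcZ]
  -- The integral `Z` lies in the box, hence in `𝒯_f`, and on it the true generator equals the
  -- truncated one at some larger level `N`.
  obtain ⟨M₂, h2⟩ := exists_truncGen_toTraceClass ℓ d α lam (truncate M Z)
  refine ⟨truncate M Z, ?_⟩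
  set N := max M M₂
  rw [← h2 N (le_max_right _ _), hz]
  -- The integrand of `(1 - G_M) Z` is the derivative of `-g`.
  have e1 : Z - truncGen ℓ d α lam M Z = y.toTraceClass - g τ := by
    have hd : ∀ s : ℝ, HasDerivAt (fun s => -g s) (g s - truncGen ℓ d α lam M (g s)) s := by
      intro s
      have h := (((Real.hasDerivAt_exp (-s)).scomp s (hasDerivAt_neg s)).smul
        (hasDerivAt_truncSemigroup_apply ℓ d α lam M y.toTraceClass s)).neg
      refine h.congr_deriv ?_
      simp only [hg, ContinuousLinearMap.map_smul_of_tower, Function.comp_apply, smul_eq_mul]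
      module
    have hGi : IntervalIntegrable (fun s => truncGen ℓ d α lam M (g s)) MeasureTheory.volume 0 τ :=
      ((truncGen ℓ d α lam M).continuous.comp hgc).intervalIntegrable 0 τ
    have h := intervalIntegral.integral_eq_sub_of_hasDerivAt (fun s _ => hd s) (hgi.sub hGi)
    rw [intervalIntegral.integral_sub hgi hGi, ← hcomm, ← hZ] at h
    rw [h]
    simp only [hg, neg_zero, Real.exp_zero, truncSemigroup_zero, one_apply_eq_self, one_smul]
    abel
  have e2 : ‖truncGen ℓ d α lam N Z - truncGen ℓ d α lam M Z‖ ≤ ε / (2 * (τ + 1)) * |τ - 0| := by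
    rw [← sub_apply, hcomm]
    refine intervalIntegral.norm_integral_le_of_norm_le_const fun s hs => ?_
    rw [Set.uIoc_of_le hτ0] at hs
    simp only [hg, ContinuousLinearMap.map_smul_of_tower, sub_apply]
    rw [← smul_sub, norm_smul, Real.norm_of_nonneg (Real.exp_pos _).le]
    have h3 := (h0 M N (le_max_left _ _) (le_max_left _ _) s ⟨hs.1.le, hs.2⟩).1
    have h4 : Real.exp (-s) ≤ 1 := Real.exp_le_one_iff.2 (by linarith [hs.1])
    calc _ ≤ 1 * (ε / (2 * (τ + 1))) := by gcongr
      _ = _ := one_mul _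
  have e3 : ‖g τ‖ ≤ ε / 2 := by
    rw [hg, norm_smul, Real.norm_of_nonneg (Real.exp_pos _).le]
    exact (mul_le_mul_of_nonneg_left (norm_truncSemigroup_apply_le ℓ d α lam M hτ0 _)
      (Real.exp_pos _).le).trans hτ
  have e4 : ε / (2 * (τ + 1)) * |τ - 0| ≤ ε / 2 := by
    rw [sub_zero, abs_of_nonneg hτ0, div_mul_eq_mul_div, div_le_div_iff₀ (by positivity)
      (by positivity)]
    nlinarith
  have e5 : Z - truncGen ℓ d α lam N Z - y.toTraceClass =
      -g τ - (truncGen ℓ d α lam N Z - truncGen ℓ d α lam M Z) := by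
    rw [← sub_add_sub_cancel Z (truncGen ℓ d α lam M Z), e1]
    abel
  rw [e5]
  refine (norm_sub_le _ _).trans ?_
  rw [norm_neg]
  linarith

/-- Given `p` in the graph of the generator, density of the range of `1 - 𝓛` supplies `z` in `𝒯_f`
with `(1 - 𝓛) z` close to `p.1 - p.2`. Dissipativity bounds the distance of the first components by
that of the images under `1 - 𝓛`, and the second components follow by subtraction. -/
theorem IsTruncationLimit.isGeneratedBy {ℓ : ℕ} (hℓ : 2 ≤ ℓ) {α : V → ℂ} {d : ℕ}
    (hd : d ≤ 2 * (ℓ - 1)) {lam : V → (Fin 4 → ℕ) → ℂ}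
    {T : ℝ≥0 → TraceClass (Fock V) →L[ℂ] TraceClass (Fock V)}
    (hT : IsTruncationLimit ℓ d α lam T) : IsGeneratedBy T (lindbladian ℓ d α lam) := by
  refine Set.Subset.antisymm (fun p hp => ?_) (hT.closure_subset_generatorGraph hℓ hd)
  rw [Metric.mem_closure_iff]
  intro ε hε
  obtain ⟨y, hy⟩ := denseRange_toTraceClass.exists_dist_lt (p.1 - p.2)
    (by positivity : 0 < ε / 8)
  obtain ⟨z, hz⟩ := exists_norm_sub_lindbladian_sub_le hℓ α hd lam y (by positivity : 0 < ε / 8)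
  refine ⟨_, ⟨z, rfl⟩, ?_⟩
  set u := z.toTraceClass
  set w := (lindbladian ℓ d α lam z).toTraceClass
  have h1 := hT.norm_le_norm_sub (generatorGraph_sub hp
    (hT.closure_subset_generatorGraph hℓ hd (subset_closure ⟨z, rfl⟩)))
  simp only [Prod.fst_sub, Prod.snd_sub] at h1
  have h2 : ‖(p.1 - p.2) - (u - w)‖ ≤ ε / 4 := by
    rw [dist_eq_norm] at hy
    rw [← norm_sub_rev] at hz
    have h3 := norm_add_le (p.1 - p.2 - y.toTraceClass) (y.toTraceClass - (u - w))
    rw [sub_add_sub_cancel] at h3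
    linarith
  have h4 : p.1 - u - (p.2 - w) = (p.1 - p.2) - (u - w) := by abel
  rw [h4] at h1
  have h5 : ‖p.2 - w‖ ≤ ε / 2 := by
    have h6 : p.2 - w = (p.1 - u) - ((p.1 - p.2) - (u - w)) := by abel
    rw [h6]
    refine (norm_sub_le _ _).trans ?_
    linarith
  rw [Prod.dist_eq, dist_eq_norm, dist_eq_norm]
  exact max_lt (by linarith) (by linarith)

end LimitSemigroup

/-! ### A differential inequality -/

section DifferentialInequality

/-- Comparison with `φ + m`, where `φ' = -b φ^p`. At a contact point superadditivity `φ^p + m^p ≤ (φ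
+ m)^p` gives `u' ≤ -a φ^p`, and `b < a` provides the strict inequality that the comparison
principle requires. -/
theorem le_of_deriv_le_rpow_of_lt {u u' : ℝ → ℝ} {a b p m : ℝ} (hb : 0 < b) (hab : b < a)
    (hp : 1 < p) (hm : 0 ≤ m) (hu : ∀ t, HasDerivAt u (u' t) t)
    (h : ∀ t, 0 ≤ t → u' t ≤ -a * u t ^ p + a * m ^ p) {t : ℝ} (ht : 0 < t) :
    u t ≤ (b * (p - 1) * t) ^ (-(p - 1)⁻¹) + m := by
  have hp1 : 0 < p - 1 := by linarith
  -- Chosen so that `φ 0 = max (u 0) 1`. Since `c` is positive, it can be dropped in the final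
  -- bound, which thereby forgets `u 0`.
  set c : ℝ := (max (u 0) 1) ^ (-(p - 1)) with hc
  have hmax : 0 < max (u 0) 1 := lt_max_of_lt_right one_pos
  have hc0 : 0 < c := Real.rpow_pos_of_pos hmax _
  set g : ℝ → ℝ := fun s => c + b * (p - 1) * s with hg
  have hg0 : ∀ s, 0 ≤ s → 0 < g s := fun s hs => by positivity
  set φ : ℝ → ℝ := fun s => g s ^ (-(p - 1)⁻¹) with hφ
  have hφ0 : ∀ s, 0 ≤ s → 0 < φ s := fun s hs => Real.rpow_pos_of_pos (hg0 s hs) _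
  have hφd : ∀ s, 0 ≤ s → HasDerivAt φ (-b * φ s ^ p) s := fun s hs => by
    have h1 : HasDerivAt g (b * (p - 1)) s :=
      (((hasDerivAt_id s).const_mul (b * (p - 1))).const_add c).congr_deriv (mul_one _)
    refine (h1.rpow_const (p := -(p - 1)⁻¹) (Or.inl (hg0 s hs).ne')).congr_deriv ?_
    have h2 : φ s ^ p = g s ^ (-(p - 1)⁻¹ - 1) := by
      rw [hφ, ← Real.rpow_mul (hg0 s hs).le]
      congr 1
      field_simp
      ring
    rw [h2]
    field_simp
  have key := image_le_of_deriv_right_lt_deriv_boundary' (f := u) (f' := u') (a := 0) (b := t)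
    (B := fun s => φ s + m) (B' := fun s => -b * φ s ^ p)
    (fun s _ => (hu s).continuousAt.continuousWithinAt) (fun s _ => (hu s).hasDerivWithinAt)
    ?_ (fun s hs => ((hφd s hs.1).add_const m).continuousAt.continuousWithinAt)
    (fun s hs => ((hφd s hs.1).add_const m).hasDerivWithinAt) ?_ ⟨ht.le, le_rfl⟩
  · refine key.trans (add_le_add_left ?_ m)
    refine Real.rpow_le_rpow_of_nonpos (by positivity) ?_ (by simpa using hp1.le)
    simp only [hg]
    linarith
  · have h0 : φ 0 = max (u 0) 1 := by
      simp only [hφ, hg, mul_zero, add_zero, hc]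
      rw [← Real.rpow_mul hmax.le, neg_mul_neg, mul_inv_cancel₀ hp1.ne', Real.rpow_one]
    rw [h0]
    linarith [le_max_left (u 0) 1]
  · intro s hs hus
    have h1 := h s hs.1
    have h2 : φ s ^ p + m ^ p ≤ u s ^ p := by
      rw [hus]
      exact Real.add_rpow_le_rpow_add (hφ0 s hs.1).le hm hp.le
    have h3 : 0 < φ s ^ p := Real.rpow_pos_of_pos (hφ0 s hs.1) _
    have h4 : 0 < a := hb.trans hab
    nlinarith [mul_le_mul_of_nonneg_left h2 h4.le, mul_pos (sub_pos.2 hab) h3]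

theorem le_of_deriv_le_rpow {u u' : ℝ → ℝ} {a p m : ℝ} (ha : 0 < a) (hp : 1 < p) (hm : 0 ≤ m)
    (hu : ∀ t, HasDerivAt u (u' t) t)
    (h : ∀ t, 0 ≤ t → u' t ≤ -a * u t ^ p + a * m ^ p) {t : ℝ} (ht : 0 < t) :
    u t ≤ (a * (p - 1) * t) ^ (-(p - 1)⁻¹) + m := by
  have hpos : 0 < a * (p - 1) * t := mul_pos (mul_pos ha (by linarith)) ht
  have hlim : Filter.Tendsto (fun b => (b * (p - 1) * t) ^ (-(p - 1)⁻¹) + m) (𝓝[<] a)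
      (𝓝 ((a * (p - 1) * t) ^ (-(p - 1)⁻¹) + m)) := by
    refine Filter.Tendsto.add_const m ?_
    have : ContinuousAt (fun b => (b * (p - 1) * t) ^ (-(p - 1)⁻¹)) a :=
      ContinuousAt.rpow_const (by fun_prop) (Or.inl hpos.ne')
    exact this.tendsto.mono_left nhdsWithin_le_nhds
  refine ge_of_tendsto hlim ?_
  filter_upwards [Ioo_mem_nhdsLT ha] with b hb
  exact le_of_deriv_le_rpow_of_lt hb.1 hb.2 hp hm hu h ht

end DifferentialInequality

/-! ### Regularization of the moments -/

section Regularization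

open TraceClass Filter

variable {V : Type*} [Fintype V] [DecidableEq V]

/-- Hölder's inequality with the diagonal entries as weights, whose total is at most `1`. -/
theorem re_tmom_rpow_le {M : ℕ} {X : TraceClass (Fock V)} (hX : (toCLM X).IsPositive)
    (htr : (trace X).re ≤ 1) (i : V) {k ν : ℝ} (hk : 0 < k) (hν : k ≤ ν) :
    (tmom M (fun n => ((n i : ℝ) + 1) ^ k) X).re ^ (ν / k) ≤
      (tmom M (fun n => ((n i : ℝ) + 1) ^ ν) X).re := by
  rw [re_tmom, re_tmom]
  have hp : 1 ≤ ν / k := (one_le_div hk).2 hν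
  have hp0 : 0 < ν / k := by linarith
  have h1 := Real.inner_le_weight_mul_Lp_of_nonneg (box V M) hp (fun n => (entry n n X).re)
    (fun n => ((n i : ℝ) + 1) ^ k) (fun n => re_entry_nonneg hX n) (fun n => by positivity)
  have h2 : ∀ n : V → ℕ, (((n i : ℝ) + 1) ^ k) ^ (ν / k) = ((n i : ℝ) + 1) ^ ν := fun n => by
    rw [← Real.rpow_mul (by positivity), mul_div_cancel₀ _ hk.ne']
  simp only [h2] at h1
  have hW : 0 ≤ ∑ n ∈ box V M, (entry n n X).re :=
    Finset.sum_nonneg fun n _ => re_entry_nonneg hX n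
  have hS : 0 ≤ ∑ n ∈ box V M, (entry n n X).re * ((n i : ℝ) + 1) ^ ν :=
    Finset.sum_nonneg fun n _ => mul_nonneg (re_entry_nonneg hX n) (by positivity)
  have h3 : (∑ n ∈ box V M, (entry n n X).re) ^ (1 - (ν / k)⁻¹) ≤ 1 :=
    Real.rpow_le_one hW ((sum_re_entry_le_trace hX _).trans htr)
      (sub_nonneg.2 (inv_le_one_of_one_le₀ hp))
  have h4 := h1.trans (mul_le_of_le_one_left (Real.rpow_nonneg hS _) h3)
  simp only [mul_comm _ (entry _ _ X).re]
  refine (Real.rpow_le_rpow (Finset.sum_nonneg fun n _ =>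
    mul_nonneg (re_entry_nonneg hX n) (by positivity)) h4 hp0.le).trans (le_of_eq ?_)
  rw [← Real.rpow_mul hS, inv_mul_cancel₀ hp0.ne', Real.rpow_one]

/-- The bound on the regularization at time `t`. -/
def regularizationBound (ℓ : ℕ) (k μ t : ℝ) : ℝ :=
  (2 * k / (((ℓ : ℝ) - 1) * ℓ * t)) ^ (k / ((ℓ : ℝ) - 1)) + μ ^ (k / (k + ℓ - 1))

theorem regularizationBound_nonneg {ℓ : ℕ} {k μ t : ℝ} (hk : 1 ≤ k) (hℓ : 2 ≤ ℓ) (hμ : 0 ≤ μ)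
    (ht : 0 ≤ t) : 0 ≤ regularizationBound ℓ k μ t := by
  have hℓ' : (0 : ℝ) ≤ (ℓ : ℝ) - 1 := by
    have : (2 : ℝ) ≤ ℓ := by exact_mod_cast hℓ
    linarith
  exact add_nonneg (Real.rpow_nonneg (by positivity) _) (Real.rpow_nonneg hμ _)

theorem re_tmom_truncSemigroup_le_regularizationBound {k : ℝ} (hk : 1 ≤ k) {ℓ : ℕ} (hℓ : 2 ≤ ℓ)
    (α : V → ℂ) {d : ℕ} (hd : d ≤ 2 * (ℓ - 1)) (lam : V → (Fin 4 → ℕ) → ℂ) {M : ℕ}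
    {X : TraceClass (Fock V)} (hX : (toCLM X).IsPositive) (hc : cutoff V M X = X)
    (htr : (trace X).re ≤ 1) (i : V) {t : ℝ} (ht : 0 < t) :
    (tmom M (fun n => ((n i : ℝ) + 1) ^ k) (truncSemigroup ℓ d α lam M t X)).re ≤
      regularizationBound ℓ k (muConst ℓ k (⨆ j, ‖α j‖) (hamiltonianSize d lam)) t := by
  set μ := muConst ℓ k (⨆ j, ‖α j‖) (hamiltonianSize d lam)
  have hμ : 0 ≤ μ := muConst_nonneg hk hℓ (iSup_norm_nonneg α) (hamiltonianSize_nonneg d lam)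
  have hℓ' : (2 : ℝ) ≤ ℓ := by exact_mod_cast hℓ
  have hk0 : 0 < k := by linarith
  have hν : 0 < k + ℓ - 1 := by linarith
  have hp1 : (k + ℓ - 1) / k - 1 = (ℓ - 1) / k := by field_simp; ring
  have hp : 1 < (k + ℓ - 1) / k := by
    rw [one_lt_div hk0]
    linarith
  have hm : (μ ^ (k / (k + ℓ - 1))) ^ ((k + ℓ - 1) / k) = μ := by
    rw [← Real.rpow_mul hμ, div_mul_div_cancel₀ hν.ne', div_self hk0.ne', Real.rpow_one]
  -- With `p = (k + ℓ - 1) / k` one has `p - 1 = (ℓ - 1) / k`, which yields the decay exponent `k /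
  -- (ℓ - 1)`; the level `m` is determined by `m^p = μ`.
  have key := le_of_deriv_le_rpow (a := (ℓ : ℝ) / 2) (p := (k + ℓ - 1) / k)
    (m := μ ^ (k / (k + ℓ - 1))) (by positivity) hp (Real.rpow_nonneg hμ _)
    (hasDerivAt_re_tmom_truncSemigroup ℓ d α lam M (fun n => ((n i : ℝ) + 1) ^ k) X)
    (fun s hs => ?_) ht
  · refine key.trans (le_of_eq ?_)
    rw [regularizationBound, hp1, Real.rpow_neg (mul_nonneg (mul_nonneg (by positivity)
      (div_nonneg (by linarith) hk0.le)) ht.le), ← Real.inv_rpow (mul_nonneg (mul_nonneg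
      (by positivity) (div_nonneg (by linarith) hk0.le)) ht.le), inv_div]
    congr 2
    have : (ℓ : ℝ) - 1 ≠ 0 := by linarith
    field_simp
  · have hpos := (isCompletelyPositive_truncSemigroup ℓ d α lam M hs).isPositive hX
    have h1 := re_tmom_truncGen_le hk hℓ α hd lam hpos (cutoff_truncSemigroup ℓ d α lam hc s) i
    rw [trace_truncSemigroup] at h1
    have h2 := re_tmom_rpow_le (M := M) hpos (by rwa [trace_truncSemigroup]) i hk0
      (show k ≤ k + ℓ - 1 by linarith)
    rw [hm]
    have h3 : (ℓ : ℝ) / 2 * μ * (trace X).re ≤ ℓ / 2 * μ * 1 :=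
      mul_le_mul_of_nonneg_left htr (by positivity)
    have h4 := mul_le_mul_of_nonneg_left h2 (by positivity : (0 : ℝ) ≤ (ℓ : ℝ) / 2)
    linarith

/-! ### The truncated Sobolev weight -/

section SobolevWeight

variable [MetricSpace V]

/-- The truncated diagonal operator `(N_i + 1) ^ (k / 2)`. -/
def sobolevFactor (k : ℝ) (M : ℕ) (i : V) : Fock V →L[ℂ] Fock V :=
  ∑ n ∈ box V M, ((((n i : ℝ) + 1) ^ (k / 2) : ℝ) : ℂ) •
    InnerProductSpace.rankOne ℂ (ket n) (ket n)

/-- The truncation of `𝒲_v^k`. -/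
def sobolevTrunc (κ k : ℝ) (v : V) (M : ℕ) : TraceClass (Fock V) →L[ℂ] TraceClass (Fock V) :=
  ∑ i, ((siteWeight κ v i : ℝ) : ℂ) • conjMap (sobolevFactor k M i) (sobolevFactor k M i)

theorem sobolevFactor_ket (k : ℝ) (M : ℕ) (i : V) (n : V → ℕ) :
    sobolevFactor k M i (ket n) =
      if n ∈ box V M then ((((n i : ℝ) + 1) ^ (k / 2) : ℝ) : ℂ) • ket n else 0 := by
  simp only [sobolevFactor, sum_apply, smul_apply, InnerProductSpace.rankOne_apply, inner_ket_ket,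
    ite_smul, one_smul, zero_smul, smul_ite, smul_zero, Finset.sum_ite_eq']

/-- This is what allows a Sobolev norm to be estimated by traces on pure states, that is, by
moments. -/
theorem isCompletelyPositive_sobolevTrunc (κ k : ℝ) (v : V) (M : ℕ) :
    IsCompletelyPositive (sobolevTrunc κ k v M) :=
  IsCompletelyPositive.sum _ fun i =>
    (IsCompletelyPositive.conjMap _).smul (siteWeight_nonneg κ v i)

theorem entry_sobolevTrunc (κ k : ℝ) (v : V) (M : ℕ) (n m : V → ℕ) (X : TraceClass (Fock V)) :
    entry n m (sobolevTrunc κ k v M X) = if n ∈ box V M ∧ m ∈ box V M then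
      ((sobolevSymbol κ k v n m : ℝ) : ℂ) * entry n m X else 0 := by
  have h : entry n m ∘L sobolevTrunc κ k v M = (if n ∈ box V M ∧ m ∈ box V M then
      ((sobolevSymbol κ k v n m : ℝ) : ℂ) else 0) • entry n m := by
    refine ext_ketbra_ket fun p q => ?_
    simp only [ContinuousLinearMap.comp_apply, sobolevTrunc, sum_apply, smul_apply, map_sum,
      map_smul, conjMap_ketbra, entry_ketbra, sobolevFactor_ket, inner_ket_ket, smul_eq_mul]
    by_cases hp : n = p
    · by_cases hq : q = m
      · subst hp hq
        by_cases h1 : n ∈ box V M <;> by_cases h2 : q ∈ box V M <;>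
          simp [h1, h2, sobolevSymbol]
      · by_cases h1 : p ∈ box V M <;> by_cases h2 : q ∈ box V M <;>
          simp [h1, h2, hq, inner_ket_ket]
    · by_cases h1 : p ∈ box V M <;> simp [h1, hp, inner_ket_ket]
  have := DFunLike.congr_fun h X
  simp only [ContinuousLinearMap.comp_apply, smul_apply, smul_eq_mul, ite_mul, zero_mul] at this
  exact this

theorem re_trace_sobolevTrunc (κ k : ℝ) (v : V) (M : ℕ) (X : TraceClass (Fock V)) :
    (trace (sobolevTrunc κ k v M X)).re =
      ∑ n ∈ box V M, sobolevSymbol κ k v n n * (entry n n X).re := by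
  have h := (hasSum_trace (sobolevTrunc κ k v M X)).mapL Complex.reCLM
  simp only [Complex.reCLM_apply] at h
  rw [← h.tsum_eq, tsum_eq_sum (s := box V M) fun n hn => by
    rw [entry_sobolevTrunc, if_neg fun h => hn h.1, Complex.zero_re]]
  refine Finset.sum_congr rfl fun n hn => ?_
  rw [entry_sobolevTrunc, if_pos ⟨hn, hn⟩, Complex.re_ofReal_mul]

theorem re_trace_sobolevTrunc' (κ k : ℝ) (v : V) (M : ℕ) (X : TraceClass (Fock V)) :
    (trace (sobolevTrunc κ k v M X)).re =
      ∑ i, siteWeight κ v i * (tmom M (fun n => ((n i : ℝ) + 1) ^ k) X).re := by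
  simp only [re_trace_sobolevTrunc, sobolevSymbol_self, re_tmom, Finset.mul_sum, Finset.sum_mul]
  rw [Finset.sum_comm]
  simp only [mul_assoc]

theorem one_le_sobolevSymbol_self (κ : ℝ) {k : ℝ} (hk : 0 ≤ k) (v : V) (n : V → ℕ) :
    1 ≤ sobolevSymbol κ k v n n := by
  rw [sobolevSymbol_self]
  refine (sum_siteWeight κ v).symm.le.trans ?_
  refine Finset.sum_le_sum fun i _ => le_mul_of_one_le_right (siteWeight_nonneg κ v i) ?_
  exact Real.one_le_rpow (le_add_of_nonneg_left (Nat.cast_nonneg _)) hk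

end SobolevWeight

/-! ### Weak limits -/

/-- Along an ultrafilter all `⟨x, Y_M y⟩` converge by boundedness. The limits form a bounded
sesquilinear form, hence an operator, whose trace norm is controlled by weak lower semicontinuity
and whose entries are the given ones. -/
theorem exists_of_tendsto_entry {Y : ℕ → TraceClass (Fock V)} {c : ℝ} (hY : ∀ M, ‖Y M‖ ≤ c)
    {z : (V → ℕ) → (V → ℕ) → ℂ}
    (h : ∀ n m, Tendsto (fun M => entry n m (Y M)) atTop (𝓝 (z n m))) :
    ∃ X : TraceClass (Fock V), ‖X‖ ≤ c ∧ ∀ n m, entry n m X = z n m := by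
  set l : Ultrafilter ℕ := hyperfilter ℕ
  have hbound : ∀ (x y : Fock V) M, ‖inner ℂ x (toCLM (Y M) y)‖ ≤ c * ‖x‖ * ‖y‖ :=
    fun x y M => (norm_inner_toCLM_le (Y M) x y).trans (by gcongr; exact hY M)
  have hex : ∀ x y : Fock V, ∃ b : ℂ,
      Tendsto (fun M => inner ℂ x (toCLM (Y M) y)) l (𝓝 b) ∧ ‖b‖ ≤ c * ‖x‖ * ‖y‖ := by
    intro x y
    obtain ⟨b, hb, hb'⟩ := (isCompact_closedBall (0 : ℂ) (c * ‖x‖ * ‖y‖)).ultrafilter_le_nhds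
      (l.map fun M => inner ℂ x (toCLM (Y M) y)) (le_principal_iff.2
        (mem_map.2 (univ_mem' fun M => mem_closedBall_zero_iff.2 (hbound x y M))))
    exact ⟨b, hb', mem_closedBall_zero_iff.1 hb⟩
  choose b hb hbc using hex
  have huniq : ∀ {x y : Fock V} {a : ℂ},
      Tendsto (fun M => inner ℂ x (toCLM (Y M) y)) l (𝓝 a) → b x y = a := fun {x y a} ha =>
    tendsto_nhds_unique (hb x y) ha
  let B : Fock V →ₗ⋆[ℂ] Fock V →ₗ[ℂ] ℂ := LinearMap.mk₂'ₛₗ (starRingEnd ℂ) (RingHom.id ℂ) b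
    (fun x x' y => huniq (by simpa only [inner_add_left] using (hb x y).add (hb x' y)))
    (fun a x y => huniq (by simpa only [inner_smul_left, smul_eq_mul] using (hb x y).const_mul _))
    (fun x y y' => huniq (by simpa only [map_add, inner_add_right] using (hb x y).add (hb x y')))
    (fun a x y => huniq (by simpa only [map_smul, inner_smul_right, smul_eq_mul, RingHom.id_apply] using (hb x y).const_mul _))
  let B' : Fock V →L⋆[ℂ] Fock V →L[ℂ] ℂ := B.mkContinuous₂ c hbc
  -- The operator representing a form stands in the first slot of the inner product; the adjoint
  -- moves it to the second.
  set Z := ContinuousLinearMap.adjoint (InnerProductSpace.continuousLinearMapOfBilin B')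
  have hZ : ∀ x y, inner ℂ x (Z y) = b x y := fun x y => by
    rw [ContinuousLinearMap.adjoint_inner_right,
      InnerProductSpace.continuousLinearMapOfBilin_apply]
    rfl
  obtain ⟨X, hX, hXc⟩ := exists_of_tendsto_inner (l := (l : Filter ℕ)) hY (Z := Z) fun x y => by
    rw [hZ]
    exact hb x y
  refine ⟨X, hXc, fun n m => ?_⟩
  rw [entry_apply, hX, hZ]
  exact huniq ((h n m).mono_left (Nat.hyperfilter_le_atTop))

/-! ### Sobolev estimates for the limit semigroup -/

theorem norm_cutoff_apply_le (M : ℕ) (X : TraceClass (Fock V)) : ‖cutoff V M X‖ ≤ ‖X‖ := by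
  refine ((isCompletelyPositive_cutoff M).norm_apply_le (c := 1) (fun x hx => ?_) X).trans
    (one_mul _).le
  refine (re_trace_cutoff_le M (isPositive_ketbra x)).trans (le_of_eq ?_)
  rw [trace_ketbra, inner_self_eq_norm_sq_to_K, hx]
  simp

theorem tendsto_cutoff (X : TraceClass (Fock V)) :
    Tendsto (fun M => cutoff V M X) atTop (𝓝 X) := by
  rw [Metric.tendsto_nhds]
  intro ε hε
  obtain ⟨y, hy⟩ := denseRange_toTraceClass.exists_dist_lt X (by positivity : 0 < ε / 2)
  obtain ⟨M₀, h0⟩ := exists_cutoff_toTraceClass y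
  filter_upwards [eventually_ge_atTop M₀] with M hM
  have h1 := norm_cutoff_apply_le M (X - y.toTraceClass)
  rw [map_sub, h0 M hM] at h1
  rw [dist_eq_norm] at hy ⊢
  have h2 := norm_add_le (cutoff V M X - y.toTraceClass) (y.toTraceClass - X)
  rw [sub_add_sub_cancel, norm_sub_rev y.toTraceClass X] at h2
  linarith

namespace IsTruncationLimit

variable {ℓ d : ℕ} {α : V → ℂ} {lam : V → (Fin 4 → ℕ) → ℂ}
  {T : ℝ≥0 → TraceClass (Fock V) →L[ℂ] TraceClass (Fock V)}

theorem tendsto_cutoff (hT : IsTruncationLimit ℓ d α lam T) (t : ℝ≥0) (X : TraceClass (Fock V)) :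
    Tendsto (fun M => truncSemigroup ℓ d α lam M t (cutoff V M X)) atTop (𝓝 (T t X)) := by
  have h1 : Tendsto (fun M => truncSemigroup ℓ d α lam M t (cutoff V M X - X)) atTop (𝓝 0) := by
    refine squeeze_zero_norm (fun M => norm_truncSemigroup_apply_le ℓ d α lam M t.2 _) ?_
    simpa using ((BosonicQMS.tendsto_cutoff X).sub_const X).norm
  have h2 := h1.add (hT t X)
  rw [zero_add] at h2
  refine h2.congr fun M => ?_
  rw [map_sub, sub_add_cancel]

variable [MetricSpace V]

/-- The truncated Sobolev images are bounded and converge entrywise to the symbol times the entries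
of `T t X`. Their weak limit is therefore the Sobolev image of `T t X`, of norm at most `c`. -/
theorem sobolevNorm_apply_le (hT : IsTruncationLimit ℓ d α lam T) (κ k : ℝ) (v : V) {t : ℝ≥0}
    {X : TraceClass (Fock V)} {c : ℝ} (h : ∀ M, ‖sobolevTrunc κ k v M
      (truncSemigroup ℓ d α lam M t (cutoff V M X))‖ ≤ c) :
    sobolevNorm κ k v (T t X) ≤ ENNReal.ofReal c := by
  obtain ⟨Y, hY, hY'⟩ := exists_of_tendsto_entry h
    (z := fun n m => ((sobolevSymbol κ k v n m : ℝ) : ℂ) * entry n m (T t X)) fun n m => by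
      obtain ⟨Mn, hMn⟩ := exists_mem_box n
      obtain ⟨Mm, hMm⟩ := exists_mem_box m
      refine ((((entry n m).continuous.tendsto _).comp (hT.tendsto_cutoff t X)).const_mul
        ((sobolevSymbol κ k v n m : ℝ) : ℂ)).congr' ?_
      filter_upwards [eventually_ge_atTop (max Mn Mm)] with M hM
      rw [entry_sobolevTrunc, if_pos ⟨box_mono ((le_max_left _ _).trans hM) hMn,
        box_mono ((le_max_right _ _).trans hM) hMm⟩, Function.comp_apply]
  refine (iInf₂_le Y hY').trans ?_
  rw [← ofReal_norm]
  exact ENNReal.ofReal_le_ofReal hY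

theorem sobolevNorm_apply_le_regularizationBound (hT : IsTruncationLimit ℓ d α lam T)
    (κ : ℝ) (v : V) {k : ℝ} (hk : 1 ≤ k) (hℓ : 2 ≤ ℓ) (hd : d ≤ 2 * (ℓ - 1)) {t : ℝ≥0}
    (ht : 0 < t) (X : TraceClass (Fock V)) :
    sobolevNorm κ k v (T t X) ≤ ENNReal.ofReal (regularizationBound ℓ k
      (muConst ℓ k (⨆ j, ‖α j‖) (hamiltonianSize d lam)) t) * ‖X‖ₑ := by
  set μ := muConst ℓ k (⨆ j, ‖α j‖) (hamiltonianSize d lam)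
  have hμ : 0 ≤ μ := muConst_nonneg hk hℓ (iSup_norm_nonneg α) (hamiltonianSize_nonneg d lam)
  rw [← ofReal_norm, ← ENNReal.ofReal_mul (regularizationBound_nonneg hk hℓ hμ t.coe_nonneg)]
  refine hT.sobolevNorm_apply_le κ k v fun M => ?_
  -- The whole composition is completely positive, so its norm on arbitrary `X` is governed by
  -- traces on pure states, where the moment bound applies.
  have hcp : IsCompletelyPositive
      (sobolevTrunc κ k v M * (truncSemigroup ℓ d α lam M t * cutoff V M)) :=
    (isCompletelyPositive_sobolevTrunc κ k v M).mul
      ((isCompletelyPositive_truncSemigroup ℓ d α lam M t.2).mul (isCompletelyPositive_cutoff M))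
  refine hcp.norm_apply_le (fun x hx => ?_) X
  have hpos := (isCompletelyPositive_cutoff M).isPositive (isPositive_ketbra x)
  have htr : (trace (cutoff V M (ketbra x x))).re ≤ 1 := by
    refine (re_trace_cutoff_le M (isPositive_ketbra x)).trans (le_of_eq ?_)
    rw [trace_ketbra, inner_self_eq_norm_sq_to_K, hx]
    simp
  rw [mul_apply_eq_comp, mul_apply_eq_comp, re_trace_sobolevTrunc']
  calc _ ≤ ∑ i, siteWeight κ v i * regularizationBound ℓ k μ t :=
        Finset.sum_le_sum fun i _ => mul_le_mul_of_nonneg_left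
          (re_tmom_truncSemigroup_le_regularizationBound hk hℓ α hd lam hpos
            (cutoff_cutoff M _) htr i ht) (siteWeight_nonneg κ v i)
    _ = _ := by rw [← Finset.sum_mul, sum_siteWeight, one_mul]

/-- For positive `X` the norm on the left is bounded by a trace, hence by a weighted moment, which
grows at most linearly in time. Since the diagonal symbol is at least `1`, the trace in the growth
rate is bounded by `‖Y‖` as well. -/
theorem norm_sobolevTrunc_le (κ : ℝ) (v : V) {k : ℝ} (hk : 1 ≤ k) (hℓ : 2 ≤ ℓ)
    (hd : d ≤ 2 * (ℓ - 1)) (t : ℝ≥0) {X Y : TraceClass (Fock V)} (hX : (toCLM X).IsPositive)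
    (hXY : IsSobolevImage κ k v X Y) (M : ℕ) :
    ‖sobolevTrunc κ k v M (truncSemigroup ℓ d α lam M t (cutoff V M X))‖ ≤
      (1 + ℓ / 2 * muConst ℓ k (⨆ j, ‖α j‖) (hamiltonianSize d lam) * t) * ‖Y‖ := by
  set μ := muConst ℓ k (⨆ j, ‖α j‖) (hamiltonianSize d lam)
  have hμ : 0 ≤ μ := muConst_nonneg hk hℓ (iSup_norm_nonneg α) (hamiltonianSize_nonneg d lam)
  have hcX := (isCompletelyPositive_cutoff M).isPositive hX
  have hpos := (isCompletelyPositive_sobolevTrunc κ k v M).isPositive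
    ((isCompletelyPositive_truncSemigroup ℓ d α lam M t.2).isPositive hcX)
  have hent : ∀ n ∈ box V M, entry n n (cutoff V M X) = entry n n X := fun n hn => by
    rw [entry_cutoff, if_pos ⟨hn, hn⟩]
  have e1 : ∑ n ∈ box V M, sobolevSymbol κ k v n n * (entry n n (cutoff V M X)).re ≤ ‖Y‖ := by
    refine le_trans (Finset.sum_le_sum fun n hn => ?_) (sum_norm_entry_diag_le Y (box V M))
    rw [hent n hn, ← Complex.re_ofReal_mul]
    exact (le_of_eq (congrArg Complex.re (hXY n n).symm)).trans (Complex.re_le_norm _)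
  have e2 : (trace (cutoff V M X)).re ≤
      ∑ n ∈ box V M, sobolevSymbol κ k v n n * (entry n n (cutoff V M X)).re := by
    have h := (hasSum_trace (cutoff V M X)).mapL Complex.reCLM
    simp only [Complex.reCLM_apply] at h
    rw [← h.tsum_eq, tsum_eq_sum (s := box V M) fun n hn => by
      rw [entry_cutoff, if_neg fun h => hn h.1, Complex.zero_re]]
    exact Finset.sum_le_sum fun n _ => le_mul_of_one_le_left (re_entry_nonneg hcX n)
      (one_le_sobolevSymbol_self κ (by linarith) v n)
  refine (IsPositive.norm_le_trace hpos).trans ?_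
  rw [re_trace_sobolevTrunc']
  calc _ ≤ ∑ i, siteWeight κ v i * ((tmom M (fun n => ((n i : ℝ) + 1) ^ k) (cutoff V M X)).re +
          ℓ / 2 * μ * (trace (cutoff V M X)).re * t) :=
        Finset.sum_le_sum fun i _ => mul_le_mul_of_nonneg_left
          (re_tmom_truncSemigroup_le hk hℓ α hd lam hcX (cutoff_cutoff M X) i t.2)
          (siteWeight_nonneg κ v i)
    _ = ∑ n ∈ box V M, sobolevSymbol κ k v n n * (entry n n (cutoff V M X)).re +
          ℓ / 2 * μ * t * (trace (cutoff V M X)).re := by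
        simp only [mul_add, Finset.sum_add_distrib]
        rw [← re_trace_sobolevTrunc', re_trace_sobolevTrunc, ← Finset.sum_mul, sum_siteWeight]
        ring
    _ ≤ ‖Y‖ + ℓ / 2 * μ * t * ‖Y‖ := by
        gcongr
        exact e2.trans e1
    _ = _ := by ring

theorem sobolevNorm_apply_le_exp (hT : IsTruncationLimit ℓ d α lam T)
    (κ : ℝ) (v : V) {k : ℝ} (hk : 1 ≤ k) (hℓ : 2 ≤ ℓ) (hd : d ≤ 2 * (ℓ - 1)) (t : ℝ≥0)
    {X : TraceClass (Fock V)} (hX : (toCLM X).IsPositive) :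
    sobolevNorm κ k v (T t X) ≤ ENNReal.ofReal (Real.exp ((ℓ / 2 *
      muConst ℓ k (⨆ j, ‖α j‖) (hamiltonianSize d lam) + 1) * t)) * sobolevNorm κ k v X := by
  set μ := muConst ℓ k (⨆ j, ‖α j‖) (hamiltonianSize d lam)
  set a := Real.exp ((ℓ / 2 * μ + 1) * t)
  have ha : 0 < a := Real.exp_pos _
  have ha' : ENNReal.ofReal a ≠ 0 := (ENNReal.ofReal_pos.2 ha).ne'
  rw [← ENNReal.div_le_iff' ha' ENNReal.ofReal_ne_top]
  refine le_iInf₂ fun Y hXY => ?_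
  rw [ENNReal.div_le_iff' ha' ENNReal.ofReal_ne_top, ← ofReal_norm, ← ENNReal.ofReal_mul ha.le]
  refine hT.sobolevNorm_apply_le κ k v fun M =>
    (norm_sobolevTrunc_le κ v hk hℓ hd t hX hXY M).trans ?_
  refine mul_le_mul_of_nonneg_right ?_ (norm_nonneg Y)
  -- Linear growth is majorized by an exponential; the extra `1` in the rate makes the rate
  -- manifestly positive.
  have h1 := Real.add_one_le_exp ((ℓ / 2 * μ + 1) * (t : ℝ))
  have h2 := t.coe_nonneg
  linarith

end IsTruncationLimit

end Regularization

end BosonicQMS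

end

open BosonicQMS in
theorem mainTheorem10 {V : Type*} [Fintype V] [DecidableEq V] [MetricSpace V]
    (κ : ℝ) (hκ : 0 < κ) (v : V) (k : ℝ) (hk : 1 ≤ k) (ℓ : ℕ) (hℓ : 2 ≤ ℓ) (α : V → ℂ)
    (d : ℕ) (hd : d ≤ 2 * (ℓ - 1)) (lam : V → (Fin 4 → ℕ) → ℂ)
    (μ : ℝ) (hμ : μ = muConst ℓ k (⨆ j, ‖α j‖) (hamiltonianSize d lam)) :
    (∀ ρ : FinOp V, IsState ρ.toTraceClass →
      (trace (sobolevOp κ k v (lindbladian ℓ d α lam ρ)).toTraceClass).re ≤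
        -((ℓ : ℝ) / 2) * (trace (sobolevOp κ (k + ℓ - 1) v ρ).toTraceClass).re
          + (ℓ : ℝ) / 2 * μ) ∧
    ∃ T : ℝ≥0 → TraceClass (Fock V) →L[ℂ] TraceClass (Fock V),
      IsQMS T ∧ IsGeneratedBy T (lindbladian ℓ d α lam) ∧
      (∀ t X, sobolevNorm κ k v X < ⊤ → sobolevNorm κ k v (T t X) < ⊤) ∧
      (∃ C > 0, ∃ ω > 0, ∀ (t : ℝ≥0) (X : TraceClass (Fock V)),
        (TraceClass.toCLM X).IsPositive →
        sobolevNorm κ k v (T t X) ≤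
          ENNReal.ofReal (C * Real.exp (ω * t)) * sobolevNorm κ k v X) ∧
      (∀ (t : ℝ≥0) (X : TraceClass (Fock V)), 0 < t →
        sobolevNorm κ k v (T t X) ≤
          ENNReal.ofReal ((2 * k / (((ℓ : ℝ) - 1) * ℓ * t)) ^ (k / ((ℓ : ℝ) - 1))
            + μ ^ (k / (k + ℓ - 1))) * ‖X‖ₑ) := by
  subst hμ
  obtain ⟨T, hT⟩ := exists_isTruncationLimit hℓ α hd lam
  have hμ0 : 0 ≤ muConst ℓ k (⨆ j, ‖α j‖) (hamiltonianSize d lam) :=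
    muConst_nonneg hk hℓ (iSup_norm_nonneg α) (hamiltonianSize_nonneg d lam)
  have hreg : ∀ (t : ℝ≥0) (X : TraceClass (Fock V)), 0 < t → sobolevNorm κ k v (T t X) ≤
      ENNReal.ofReal (regularizationBound ℓ k
        (muConst ℓ k (⨆ j, ‖α j‖) (hamiltonianSize d lam)) t) * ‖X‖ₑ := fun t X ht =>
    hT.sobolevNorm_apply_le_regularizationBound κ v hk hℓ hd ht X
  refine ⟨fun ρ hρ => re_trace_sobolevOp_lindbladian_le κ v hk hℓ α hd lam hρ, T,
    hT.isQMS hℓ hd, hT.isGeneratedBy hℓ hd, fun t X hX => ?_, ⟨1, one_pos, ℓ / 2 *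
    muConst ℓ k (⨆ j, ‖α j‖) (hamiltonianSize d lam) + 1, by positivity, fun t X hX => ?_⟩, hreg⟩
  -- For `t > 0` regularization maps all of `𝒯₁` into the Sobolev space, so invariance holds also
  -- without positivity; only `t = 0` uses the hypothesis on `X`.
  · rcases eq_or_ne t 0 with rfl | ht
    · rwa [hT.zero]
    · exact (hreg t X (pos_iff_ne_zero.2 ht)).trans_lt
        (ENNReal.mul_lt_top ENNReal.ofReal_lt_top enorm_lt_top)
  · rw [one_mul]
    exact hT.sobolevNorm_apply_le_exp κ v hk hℓ hd t hX
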